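/- Let $k$ be a field, $Q$ a finite acyclic quiver (finitely many vertices and arrows), and $\tau$ an involution of $Q$ (a quiver automorphism with $\tau^2=\mathrm{Id}$; $\tau=\mathrm{Id}$ is allowed). Modules are left modules, $\operatorname{mod}(A)$ is the category of finite-dimensional left $A$-modules, $D=\operatorname{Hom}_k(-,k)$, and paths are composed like functions, so that an arrow $\alpha:i\to j$ satisfies $e_j\alpha=\alpha=\alpha e_i$. Let $R_2$ be the path algebra of the quiver with vertices $1,1'$ and arrows $\varepsilon:1\to 1'$, $\varepsilon':1'\to 1$ modulo $\varepsilon'\varepsilon=0=\varepsilon\varepsilon'$, let $\Lambda=kQ\otimes_k R_2$, let $\tau^\sharp$ be the automorphism $\tau\otimes\operatorname{swap}$ of $\Lambda$, where $\operatorname{swap}$ exchanges $e_1\leftrightarrow e_{1'}$ and $\varepsilon\leftrightarrow\varepsilon'$, and let $\Lambda^\imath=\{x\in\Lambda\mid\tau^\sharp(x)=x\}$. We identify $kQ$ with a subalgebra of $\Lambda^\imath$ via $x\mapsto x\otimes e_1+\tau(x)\otimes e_{1'}$. A $\Lambda^\imath$-module $L$ is the same as a family of vector spaces $L_i=e_iL$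 ($i\in Q_0$) with linear maps $\alpha:L_i\to L_j$ for the arrows $\alpha:i\to j$ of $Q$ and $\varepsilon_i:L_i\to L_{\tau i}$ for the vertices $i$ (the action of $1\otimes\varepsilon+1\otimes\varepsilon'$), such that $\varepsilon_{\tau i}\varepsilon_i=0$ and $\varepsilon_j\alpha=\tau(\alpha)\varepsilon_i$ for every arrow $\alpha:i\to j$. For $i\in Q_0$ let ${\mathbb E}_i$ be the generalized simple $\Lambda^\imath$-module: all arrows of $Q$ act by zero, and ${\mathbb E}_i=k[\varepsilon_i]/(\varepsilon_i^2)$ concentrated at $i$ if $\tau i=i$, while if $\tau i\ne i$ it is $k$ at $i$ and $k$ at $\tau i$ with $\varepsilon_i=1$ and $\varepsilon_{\tau i}=0$. Let $\ell$ be a sink of $Q$ at which at least one arrow ends. Let ${\bm s}_\ell Q$ be the quiver obtained from $Q$ by reversing all arrows ending in $\ell$ or $\tau\ell$, with the induced involution, and let ${\bm s}_\ell\Lambda^\imath$ be the algebra constructed from it as $\Lambda^\imath$ is from $Q$. The reflection functor $F_\ell^+:\operatorname{mod}(\Lambda^\imath)\to\operatorname{mod}({\bm s}_\ell\Lambda^\imath)$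 sends $L$ to the module $N$ with $N_r=L_r$ for $r\notin\{\ell,\tau\ell\}$ and $$N_r=\ker\Big(\bigoplus_{\alpha:j\to r}L_j\to L_r,\ (y_\alpha)_\alpha\mapsto\sum_\alpha\alpha y_\alpha\Big)\qquad(r\in\{\ell,\tau\ell\}),$$ where the sum is over the arrows $\alpha$ of $Q$ ending in $r$. The arrows of $Q$ not ending in $\ell$ or $\tau\ell$ and the maps $\varepsilon_r$ with $r\notin\{\ell,\tau\ell\}$ act as on $L$; the reversal $r\to j$ of an arrow $\alpha:j\to r$, $r\in\{\ell,\tau\ell\}$, acts by $(y_\beta)_\beta\mapsto y_\alpha$; and for $r\in\{\ell,\tau\ell\}$ the map $\varepsilon_r:N_r\to N_{\tau r}$ sends $(y_\beta)_\beta$ to the family whose entry at $\tau\alpha$ is $\varepsilon y_\alpha$. On morphisms $F_\ell^+$ is the evident map. Let $\operatorname{TrD}$ be the inverse Auslander–Reiten translation of $\Lambda^\imath$, that is, $\operatorname{TrD}M$ is the cokernel of $\operatorname{Hom}(P_0,\Lambda^\imath)\to\operatorname{Hom}(P_1,\Lambda^\imath)$ for a minimal projective presentation $P_1\to P_0\to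 DM\to 0$ of the right module $DM$. Since $\ell$ is a sink, ${\mathbb E}_\ell\cong\Lambda^\imath e_\ell$ and ${\mathbb E}_{\tau\ell}\cong\Lambda^\imath e_{\tau\ell}$ are direct summands of $\Lambda^\imath$. Put $$T=\begin{cases}(\Lambda^\imath/{\mathbb E}_\ell)\oplus\operatorname{TrD}{\mathbb E}_\ell,&\tau\ell=\ell,\\ \big(\Lambda^\imath/({\mathbb E}_\ell\oplus{\mathbb E}_{\tau\ell})\big)\oplus\operatorname{TrD}{\mathbb E}_\ell\oplus\operatorname{TrD}{\mathbb E}_{\tau\ell},&\tau\ell\neq\ell,\end{cases}$$ a finite-dimensional $\Lambda^\imath$-module, well defined up to isomorphism, and let $B=\operatorname{End}_{\Lambda^\imath}(T)^{op}$. Then: (1) $T$ is a tilting module of $\Lambda^\imath$: it has projective dimension at most one, $\operatorname{Ext}^1_{\Lambda^\imath}(T,T)=0$, and there is an exact sequence $0\to\Lambda^\imath\to T_0\to T_1\to 0$ where $T_0$ and $T_1$ are direct summands of finite direct sums of copies of $T$. (2) The functors $F_\ell^+:\operatorname{mod}(\Lambda^\imath)\to\operatorname{mod}({\bm s}_\ell\Lambda^\imath)$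 and $\operatorname{Hom}_{\Lambda^\imath}(T,-):\operatorname{mod}(\Lambda^\imath)\to\operatorname{mod}(B)$ are equivalent: there is a ($k$-linear) equivalence $S:\operatorname{mod}({\bm s}_\ell\Lambda^\imath)\to\operatorname{mod}(B)$ with $S\circ F_\ell^+\cong\operatorname{Hom}_{\Lambda^\imath}(T,-)$. (3) There is an isomorphism of $k$-algebras ${\bm s}_\ell\Lambda^\imath\cong\operatorname{End}_{\Lambda^\imath}(T)^{op}$. -/

import Mathlib

open CategoryTheory TensorProduct
open scoped ModuleCat

universe u

noncomputable section

/-! ### Quivers with involution and their path algebras -/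

/-- A quiver with vertex set `V` and arrow set `E`, together with an involution
(an automorphism of the quiver whose square is the identity). -/
structure IQuiver (V E : Type u) where
  /-- the source of an arrow -/
  src : E → V
  /-- the target of an arrow -/
  tgt : E → V
  /-- the involution on vertices -/
  tauV : V → V
  /-- the involution on arrows -/
  tauE : E → E
  tauV_tauV : ∀ i, tauV (tauV i) = i
  tauE_tauE : ∀ a, tauE (tauE a) = a
  src_tauE : ∀ a, src (tauE a) = tauV (src a)
  tgt_tauE : ∀ a, tgt (tauE a) = tauV (tgt a)

namespace IQuiver

variable {V E : Type u}

/-- There is no oriented cycle. -/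
def Acyclic (Q : IQuiver V E) : Prop :=
  ∀ i : V, ¬ Relation.TransGen (fun i j => ∃ a, Q.src a = i ∧ Q.tgt a = j) i i

/-- A vertex at which no arrow starts. -/
def IsSink (Q : IQuiver V E) (l : V) : Prop := ∀ a, Q.src a ≠ l

/-- The vertex `r` lies in the orbit `{l, τ l}`. -/
def InOrbit (Q : IQuiver V E) (l r : V) : Prop := r = l ∨ r = Q.tauV l

instance [DecidableEq V] (Q : IQuiver V E) (l r : V) : Decidable (Q.InOrbit l r) :=
  inferInstanceAs (Decidable (_ ∨ _))

theorem inOrbit_tau (Q : IQuiver V E) (l r : V) :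
    Q.InOrbit l (Q.tauV r) ↔ Q.InOrbit l r := by
  unfold InOrbit
  constructor
  · rintro (h | h)
    · right; rw [← h, Q.tauV_tauV]
    · left; rw [← Q.tauV_tauV r, h, Q.tauV_tauV]
  · rintro (h | h)
    · right; rw [h]
    · left; rw [h, Q.tauV_tauV]

theorem inOrbit_tgt_tau (Q : IQuiver V E) (l : V) (a : E) :
    Q.InOrbit l (Q.tgt (Q.tauE a)) ↔ Q.InOrbit l (Q.tgt a) := by
  rw [Q.tgt_tauE, inOrbit_tau]

/-- If `l` is a sink, no arrow starts in the orbit of `l`. -/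
theorem IsSink.not_inOrbit {Q : IQuiver V E} {l : V} (h : Q.IsSink l) (a : E) :
    ¬ Q.InOrbit l (Q.src a) := by
  rintro (h1 | h1)
  · exact h a h1
  · exact h (Q.tauE a) (by rw [Q.src_tauE, h1, Q.tauV_tauV])

/-- The reflected quiver `s_l Q`: all arrows ending in `l` or `τ l` are reversed, with the
induced involution. (It is used when `l` is a sink.) -/
def reflect [DecidableEq V] (Q : IQuiver V E) (l : V) : IQuiver V E where
  src a := if Q.InOrbit l (Q.tgt a) then Q.tgt a else Q.src a
  tgt a := if Q.InOrbit l (Q.tgt a) then Q.src a else Q.tgt a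
  tauV := Q.tauV
  tauE := Q.tauE
  tauV_tauV := Q.tauV_tauV
  tauE_tauE := Q.tauE_tauE
  src_tauE a := by
    simp only [inOrbit_tgt_tau]
    split_ifs <;> simp [Q.src_tauE, Q.tgt_tauE]
  tgt_tauE a := by
    simp only [inOrbit_tgt_tau]
    split_ifs <;> simp [Q.src_tauE, Q.tgt_tauE]

end IQuiver

section Algebras

variable (k : Type u) [Field k] {V E : Type u} [Fintype V]

/-- The relations of the path algebra. Paths are composed like functions: an arrow
`a : i → j` satisfies `e_j a = a = a e_i`. -/
inductive PathRel (Q : IQuiver V E) : FreeAlgebra k (V ⊕ E) → FreeAlgebra k (V ⊕ E) → Prop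
  | idem (i : V) : PathRel Q
      (FreeAlgebra.ι k (.inl i) * FreeAlgebra.ι k (.inl i)) (FreeAlgebra.ι k (.inl i))
  | orth (i j : V) (h : i ≠ j) : PathRel Q
      (FreeAlgebra.ι k (.inl i) * FreeAlgebra.ι k (.inl j)) 0
  | sum_one : PathRel Q (∑ i : V, FreeAlgebra.ι k (.inl i)) 1
  | tgt (a : E) : PathRel Q
      (FreeAlgebra.ι k (.inl (Q.tgt a)) * FreeAlgebra.ι k (.inr a)) (FreeAlgebra.ι k (.inr a))
  | src (a : E) : PathRel Q
      (FreeAlgebra.ι k (.inr a) * FreeAlgebra.ι k (.inl (Q.src a))) (FreeAlgebra.ι k (.inr a))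

/-- The path algebra `kQ`. -/
def PathAlg (Q : IQuiver V E) : Type u := RingQuot (PathRel k Q)

namespace PathAlg

variable (Q : IQuiver V E)

instance : Ring (PathAlg k Q) := inferInstanceAs (Ring (RingQuot (PathRel k Q)))

instance : Algebra k (PathAlg k Q) := inferInstanceAs (Algebra k (RingQuot (PathRel k Q)))

/-- The quotient map from the free algebra. -/
def mk : FreeAlgebra k (V ⊕ E) →ₐ[k] PathAlg k Q := RingQuot.mkAlgHom k (PathRel k Q)

/-- The trivial path `e_i`. -/
def vert (i : V) : PathAlg k Q := mk k Q (FreeAlgebra.ι k (.inl i))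

/-- The path of length one given by an arrow. -/
def arr (a : E) : PathAlg k Q := mk k Q (FreeAlgebra.ι k (.inr a))

variable {k} {Q}

theorem mk_rel {x y : FreeAlgebra k (V ⊕ E)} (h : PathRel k Q x y) : mk k Q x = mk k Q y :=
  RingQuot.mkAlgHom_rel k h

theorem vert_idem (i : V) : vert k Q i * vert k Q i = vert k Q i := by
  simpa [vert] using mk_rel (PathRel.idem (k := k) (Q := Q) i)

theorem vert_orth {i j : V} (h : i ≠ j) : vert k Q i * vert k Q j = 0 := by
  simpa [vert] using mk_rel (PathRel.orth (k := k) (Q := Q) i j h)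

theorem vert_sum : ∑ i : V, vert k Q i = 1 := by
  simpa [vert] using mk_rel (PathRel.sum_one (k := k) (Q := Q))

theorem vert_tgt_arr (a : E) : vert k Q (Q.tgt a) * arr k Q a = arr k Q a := by
  simpa [vert, arr] using mk_rel (PathRel.tgt (k := k) (Q := Q) a)

theorem arr_vert_src (a : E) : arr k Q a * vert k Q (Q.src a) = arr k Q a := by
  simpa [vert, arr] using mk_rel (PathRel.src (k := k) (Q := Q) a)

variable {A : Type*} [Ring A] [Algebra k A]

/-- The universal property of the path algebra. -/
def lift (e : V → A) (f : E → A) (idem : ∀ i, e i * e i = e i)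
    (orth : ∀ i j, i ≠ j → e i * e j = 0) (sum_one : ∑ i, e i = 1)
    (tgt : ∀ a, e (Q.tgt a) * f a = f a) (src : ∀ a, f a * e (Q.src a) = f a) :
    PathAlg k Q →ₐ[k] A :=
  RingQuot.liftAlgHom k ⟨FreeAlgebra.lift k (Sum.elim e f), by
    intro x y h
    cases h with
    | idem i => simpa using idem i
    | orth i j h => simpa using orth i j h
    | sum_one => simpa using sum_one
    | tgt a => simpa using tgt a
    | src a => simpa using src a⟩

section lift

variable {e : V → A} {f : E → A} {h1 : ∀ i, e i * e i = e i}
    {h2 : ∀ i j, i ≠ j → e i * e j = 0} {h3 : ∑ i, e i = 1}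
    {h4 : ∀ a, e (Q.tgt a) * f a = f a} {h5 : ∀ a, f a * e (Q.src a) = f a}

@[simp] theorem lift_vert (i : V) :
    lift (k := k) (Q := Q) e f h1 h2 h3 h4 h5 (vert k Q i) = e i := by
  simp only [lift, vert, mk]
  exact (RingQuot.liftAlgHom_mkAlgHom_apply k _ _ _).trans (by simp)

@[simp] theorem lift_arr (a : E) :
    lift (k := k) (Q := Q) e f h1 h2 h3 h4 h5 (arr k Q a) = f a := by
  simp only [lift, arr, mk]
  exact (RingQuot.liftAlgHom_mkAlgHom_apply k _ _ _).trans (by simp)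

end lift

theorem induction {P : PathAlg k Q → Prop} (hk : ∀ c : k, P (algebraMap k _ c))
    (hv : ∀ i, P (vert k Q i)) (ha : ∀ a, P (arr k Q a))
    (hadd : ∀ x y, P x → P y → P (x + y)) (hmul : ∀ x y, P x → P y → P (x * y))
    (x : PathAlg k Q) : P x := by
  obtain ⟨y, rfl⟩ := RingQuot.mkAlgHom_surjective k (PathRel k Q) x
  change P (mk k Q y)
  induction y using FreeAlgebra.induction with
  | grade0 c => rw [AlgHom.commutes]; exact hk c
  | grade1 z => cases z with
    | inl i => exact hv i
    | inr a => exact ha a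
  | mul a b h1 h2 => rw [map_mul]; exact hmul _ _ h1 h2
  | add a b h1 h2 => rw [map_add]; exact hadd _ _ h1 h2

variable (k) (Q)

/-- The involution of `kQ` induced by the involution of the quiver. -/
def tau : PathAlg k Q →ₐ[k] PathAlg k Q :=
  lift (fun i => vert k Q (Q.tauV i)) (fun a => arr k Q (Q.tauE a))
    (fun i => vert_idem _)
    (fun i j h => vert_orth fun h' => h (by rw [← Q.tauV_tauV i, h', Q.tauV_tauV]))
    ((Equiv.sum_comp (Function.Involutive.toPerm Q.tauV Q.tauV_tauV) (vert k Q)).trans vert_sum)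
    (fun a => by rw [← Q.tgt_tauE]; exact vert_tgt_arr _)
    (fun a => by rw [← Q.src_tauE]; exact arr_vert_src _)

@[simp] theorem tau_vert (i : V) : tau k Q (vert k Q i) = vert k Q (Q.tauV i) := lift_vert i

@[simp] theorem tau_arr (a : E) : tau k Q (arr k Q a) = arr k Q (Q.tauE a) := lift_arr a

@[simp] theorem tau_tau (x : PathAlg k Q) : tau k Q (tau k Q x) = x := by
  induction x using induction with
  | hk c => simp
  | hv i => simp [Q.tauV_tauV]
  | ha a => simp [Q.tauE_tauE]
  | hadd x y hx hy => simp [hx, hy]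
  | hmul x y hx hy => simp [hx, hy]

end PathAlg

/-! ### The algebra `R₂` -/

/-- The path algebra of the quiver with vertices `1, 1'` and arrows `ε : 1 → 1'`, `ε' : 1' → 1`
modulo `ε' ε = 0 = ε ε'`; an element is written in the basis `e_1, e_1', ε, ε'`. -/
@[ext] structure R2 (k : Type u) where
  /-- coefficient of `e_1` -/
  c : k
  /-- coefficient of `e_1'` -/
  c' : k
  /-- coefficient of `ε = e_1' ε e_1` -/
  d : k
  /-- coefficient of `ε' = e_1 ε' e_1'` -/
  d' : k

namespace R2

instance : Zero (R2 k) := ⟨⟨0, 0, 0, 0⟩⟩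
instance : One (R2 k) := ⟨⟨1, 1, 0, 0⟩⟩
instance : Add (R2 k) := ⟨fun x y => ⟨x.c + y.c, x.c' + y.c', x.d + y.d, x.d' + y.d'⟩⟩
instance : Neg (R2 k) := ⟨fun x => ⟨-x.c, -x.c', -x.d, -x.d'⟩⟩
instance : Mul (R2 k) := ⟨fun x y =>
  ⟨x.c * y.c, x.c' * y.c', x.c' * y.d + x.d * y.c, x.c * y.d' + x.d' * y.c'⟩⟩
instance : SMul k (R2 k) := ⟨fun r x => ⟨r * x.c, r * x.c', r * x.d, r * x.d'⟩⟩

variable {k}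

@[simp] theorem zero_c : (0 : R2 k).c = 0 := rfl
@[simp] theorem zero_c' : (0 : R2 k).c' = 0 := rfl
@[simp] theorem zero_d : (0 : R2 k).d = 0 := rfl
@[simp] theorem zero_d' : (0 : R2 k).d' = 0 := rfl
@[simp] theorem one_c : (1 : R2 k).c = 1 := rfl
@[simp] theorem one_c' : (1 : R2 k).c' = 1 := rfl
@[simp] theorem one_d : (1 : R2 k).d = 0 := rfl
@[simp] theorem one_d' : (1 : R2 k).d' = 0 := rfl
@[simp] theorem add_c (x y : R2 k) : (x + y).c = x.c + y.c := rfl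
@[simp] theorem add_c' (x y : R2 k) : (x + y).c' = x.c' + y.c' := rfl
@[simp] theorem add_d (x y : R2 k) : (x + y).d = x.d + y.d := rfl
@[simp] theorem add_d' (x y : R2 k) : (x + y).d' = x.d' + y.d' := rfl
@[simp] theorem neg_c (x : R2 k) : (-x).c = -x.c := rfl
@[simp] theorem neg_c' (x : R2 k) : (-x).c' = -x.c' := rfl
@[simp] theorem neg_d (x : R2 k) : (-x).d = -x.d := rfl
@[simp] theorem neg_d' (x : R2 k) : (-x).d' = -x.d' := rfl
@[simp] theorem mul_c (x y : R2 k) : (x * y).c = x.c * y.c := rfl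
@[simp] theorem mul_c' (x y : R2 k) : (x * y).c' = x.c' * y.c' := rfl
@[simp] theorem mul_d (x y : R2 k) : (x * y).d = x.c' * y.d + x.d * y.c := rfl
@[simp] theorem mul_d' (x y : R2 k) : (x * y).d' = x.c * y.d' + x.d' * y.c' := rfl
@[simp] theorem smul_c (r : k) (x : R2 k) : (r • x).c = r * x.c := rfl
@[simp] theorem smul_c' (r : k) (x : R2 k) : (r • x).c' = r * x.c' := rfl
@[simp] theorem smul_d (r : k) (x : R2 k) : (r • x).d = r * x.d := rfl
@[simp] theorem smul_d' (r : k) (x : R2 k) : (r • x).d' = r * x.d' := rfl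

instance : Ring (R2 k) where
  add_assoc x y z := by ext <;> simp [add_assoc]
  zero_add x := by ext <;> simp
  add_zero x := by ext <;> simp
  add_comm x y := by ext <;> simp [add_comm]
  nsmul := nsmulRec
  zsmul := zsmulRec
  neg_add_cancel x := by ext <;> simp
  left_distrib x y z := by ext <;> simp <;> ring
  right_distrib x y z := by ext <;> simp <;> ring
  zero_mul x := by ext <;> simp
  mul_zero x := by ext <;> simp
  mul_assoc x y z := by ext <;> simp <;> ring
  one_mul x := by ext <;> simp
  mul_one x := by ext <;> simp

instance : Module k (R2 k) where
  one_smul x := by ext <;> simp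
  mul_smul r s x := by ext <;> simp [mul_assoc]
  smul_zero r := by ext <;> simp
  smul_add r x y := by ext <;> simp [mul_add]
  add_smul r s x := by ext <;> simp [add_mul]
  zero_smul x := by ext <;> simp

instance : Algebra k (R2 k) := Algebra.ofModule
  (fun r x y => by ext <;> simp <;> ring) (fun r x y => by ext <;> simp <;> ring)

variable (k)

/-- The idempotent `e_1`. -/
def e : R2 k := ⟨1, 0, 0, 0⟩
/-- The idempotent `e_1'`. -/
def e' : R2 k := ⟨0, 1, 0, 0⟩
/-- The arrow `ε : 1 → 1'`. -/
def ep : R2 k := ⟨0, 0, 1, 0⟩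
/-- The arrow `ε' : 1' → 1`. -/
def ep' : R2 k := ⟨0, 0, 0, 1⟩

/-- The involution of `R₂` with `e_1 ↔ e_1'` and `ε ↔ ε'`. -/
def swap : R2 k →ₐ[k] R2 k :=
  AlgHom.ofLinearMap
    { toFun := fun x => ⟨x.c', x.c, x.d', x.d⟩
      map_add' := fun _ _ => rfl
      map_smul' := fun _ _ => rfl }
    rfl (fun _ _ => rfl)

/-- The coefficient of `e_1` as a linear form. -/
def coeffC : R2 k →ₗ[k] k where
  toFun x := x.c
  map_add' _ _ := rfl
  map_smul' _ _ := rfl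
/-- The coefficient of `e_1'` as a linear form. -/
def coeffC' : R2 k →ₗ[k] k where
  toFun x := x.c'
  map_add' _ _ := rfl
  map_smul' _ _ := rfl
/-- The coefficient of `ε` as a linear form. -/
def coeffD : R2 k →ₗ[k] k where
  toFun x := x.d
  map_add' _ _ := rfl
  map_smul' _ _ := rfl

end R2

/-! ### The algebra `Λ = kQ ⊗ R₂` and its fixed-point subalgebra -/

/-- `Λ = kQ ⊗ₖ R₂`. -/
abbrev DoubleAlg (Q : IQuiver V E) : Type u := PathAlg k Q ⊗[k] R2 k

/-- The involution `τ♯` of `Λ`: the composition of `τ` and the swap of the two copies of `Q`. -/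
def tauSharp (Q : IQuiver V E) : DoubleAlg k Q →ₐ[k] DoubleAlg k Q :=
  Algebra.TensorProduct.map (PathAlg.tau k Q) (R2.swap k)

/-- The fixed points `{x ∈ Λ | τ♯ x = x}`, a subalgebra of `Λ`. -/
def fixedSubalgebra (Q : IQuiver V E) : Subalgebra k (DoubleAlg k Q) :=
  AlgHom.equalizer (tauSharp k Q) (AlgHom.id k (DoubleAlg k Q))

/-- The `ı`quiver algebra `Λ^ı = {x ∈ Λ | τ♯ x = x}`. -/
def IAlg (Q : IQuiver V E) : Type u := fixedSubalgebra k Q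

namespace IAlg

variable (Q : IQuiver V E)

instance : Ring (IAlg k Q) := inferInstanceAs (Ring (fixedSubalgebra k Q))

instance : Algebra k (IAlg k Q) := inferInstanceAs (Algebra k (fixedSubalgebra k Q))

/-- The inclusion `Λ^ı ⊆ Λ`. -/
def val : IAlg k Q →ₐ[k] DoubleAlg k Q := (fixedSubalgebra k Q).val

theorem val_injective : Function.Injective (val k Q) := Subtype.val_injective

theorem tauSharp_val (x : IAlg k Q) : tauSharp k Q (val k Q x) = val k Q x := x.2

/-- The embedding `kQ ⊆ Λ^ı`, `x ↦ x ⊗ e_1 + τ x ⊗ e_1'`. -/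
def ofPath : PathAlg k Q →ₐ[k] IAlg k Q :=
  (AlgHom.codRestrict
    (AlgHom.ofLinearMap
      ((TensorProduct.mk k (PathAlg k Q) (R2 k)).flip (R2.e k) +
        ((TensorProduct.mk k (PathAlg k Q) (R2 k)).flip (R2.e' k)).comp
          (PathAlg.tau k Q).toLinearMap)
      (by
        have h : R2.e k + R2.e' k = 1 := by ext <;> simp [R2.e, R2.e']
        simp [← TensorProduct.tmul_add, h, Algebra.TensorProduct.one_def])
      (fun x y => by
        have h1 : R2.e k * R2.e k = R2.e k := by ext <;> simp [R2.e]
        have h2 : R2.e' k * R2.e' k = R2.e' k := by ext <;> simp [R2.e']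
        have h3 : R2.e k * R2.e' k = 0 := by ext <;> simp [R2.e, R2.e']
        have h4 : R2.e' k * R2.e k = 0 := by ext <;> simp [R2.e, R2.e']
        simp [mul_add, add_mul, h1, h2, h3, h4]))
    (fixedSubalgebra k Q)
    (fun x => by
      have h1 : R2.swap k (R2.e k) = R2.e' k := rfl
      have h2 : R2.swap k (R2.e' k) = R2.e k := rfl
      simp [fixedSubalgebra, AlgHom.mem_equalizer, tauSharp, h1, h2, add_comm]) :
    PathAlg k Q →ₐ[k] fixedSubalgebra k Q)

theorem val_ofPath (x : PathAlg k Q) :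
    val k Q (ofPath k Q x) = x ⊗ₜ R2.e k + PathAlg.tau k Q x ⊗ₜ R2.e' k := rfl

/-- The idempotent of `Λ^ı` at the vertex `i`. -/
def vert (i : V) : IAlg k Q := ofPath k Q (PathAlg.vert k Q i)

/-- The element of `Λ^ı` given by an arrow of `Q`. -/
def arr (a : E) : IAlg k Q := ofPath k Q (PathAlg.arr k Q a)

/-- The sum in `Λ^ı` of all the arrows `ε_i : i → τ i`. -/
def eps : IAlg k Q :=
  (⟨1 ⊗ₜ R2.ep k + 1 ⊗ₜ R2.ep' k, by
    have h1 : R2.swap k (R2.ep k) = R2.ep' k := rfl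
    have h2 : R2.swap k (R2.ep' k) = R2.ep k := rfl
    simp [fixedSubalgebra, AlgHom.mem_equalizer, tauSharp, h1, h2, add_comm]⟩ :
    fixedSubalgebra k Q)

theorem val_eps : val k Q (eps k Q) = 1 ⊗ₜ R2.ep k + 1 ⊗ₜ R2.ep' k := rfl

theorem eps_mul_eps : eps k Q * eps k Q = 0 := by
  have h1 : R2.ep k * R2.ep k = 0 := by ext <;> simp [R2.ep]
  have h2 : R2.ep' k * R2.ep' k = 0 := by ext <;> simp [R2.ep']
  have h3 : R2.ep k * R2.ep' k = 0 := by ext <;> simp [R2.ep, R2.ep']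
  have h4 : R2.ep' k * R2.ep k = 0 := by ext <;> simp [R2.ep, R2.ep']
  apply val_injective
  simp [val_eps, mul_add, add_mul, h1, h2, h3, h4]

variable {k} {Q} in
theorem vert_mul_vert (i : V) : vert k Q i * vert k Q i = vert k Q i := by
  rw [vert, ← map_mul, PathAlg.vert_idem]

variable {k} {Q} in
theorem vert_mul_vert_of_ne {i j : V} (h : i ≠ j) : vert k Q i * vert k Q j = 0 := by
  rw [vert, vert, ← map_mul, PathAlg.vert_orth h, map_zero]

theorem sum_vert : ∑ i, vert k Q i = 1 := by
  simp only [vert, ← map_sum, PathAlg.vert_sum, map_one]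

theorem vert_tgt_mul_arr (a : E) : vert k Q (Q.tgt a) * arr k Q a = arr k Q a := by
  rw [vert, arr, ← map_mul, PathAlg.vert_tgt_arr]

theorem arr_mul_vert_src (a : E) : arr k Q a * vert k Q (Q.src a) = arr k Q a := by
  rw [vert, arr, ← map_mul, PathAlg.arr_vert_src]

theorem eps_mul_ofPath (x : PathAlg k Q) :
    eps k Q * ofPath k Q x = ofPath k Q (PathAlg.tau k Q x) * eps k Q := by
  have h1 : R2.ep k * R2.e k = R2.ep k := by ext <;> simp [R2.ep, R2.e]
  have h2 : R2.ep' k * R2.e k = 0 := by ext <;> simp [R2.ep', R2.e]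
  have h3 : R2.ep k * R2.e' k = 0 := by ext <;> simp [R2.ep, R2.e']
  have h4 : R2.ep' k * R2.e' k = R2.ep' k := by ext <;> simp [R2.ep', R2.e']
  have h5 : R2.e k * R2.ep k = 0 := by ext <;> simp [R2.ep, R2.e]
  have h6 : R2.e k * R2.ep' k = R2.ep' k := by ext <;> simp [R2.ep', R2.e]
  have h7 : R2.e' k * R2.ep k = R2.ep k := by ext <;> simp [R2.ep, R2.e']
  have h8 : R2.e' k * R2.ep' k = 0 := by ext <;> simp [R2.ep', R2.e']
  apply val_injective
  simp [val_eps, val_ofPath, mul_add, add_mul, h1, h2, h3, h4, h5, h6, h7, h8, add_comm]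

theorem eps_mul_vert (i : V) : eps k Q * vert k Q i = vert k Q (Q.tauV i) * eps k Q := by
  rw [vert, eps_mul_ofPath, PathAlg.tau_vert, vert]

theorem eps_mul_arr (a : E) : eps k Q * arr k Q a = arr k Q (Q.tauE a) * eps k Q := by
  rw [arr, eps_mul_ofPath, PathAlg.tau_arr, arr]

/-- `x ↦` the coefficient of `e_1`, a linear map `kQ ⊗ R₂ → kQ`. -/
def coC : DoubleAlg k Q →ₗ[k] PathAlg k Q :=
  (TensorProduct.rid k _).toLinearMap.comp ((R2.coeffC k).lTensor _)
/-- `x ↦` the coefficient of `e_1'`. -/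
def coC' : DoubleAlg k Q →ₗ[k] PathAlg k Q :=
  (TensorProduct.rid k _).toLinearMap.comp ((R2.coeffC' k).lTensor _)
/-- `x ↦` the coefficient of `ε`. -/
def coD : DoubleAlg k Q →ₗ[k] PathAlg k Q :=
  (TensorProduct.rid k _).toLinearMap.comp ((R2.coeffD k).lTensor _)

variable {k} {Q}

@[simp] theorem coC_tmul (x : PathAlg k Q) (r : R2 k) : coC k Q (x ⊗ₜ r) = r.c • x := by
  simp [coC, R2.coeffC]
@[simp] theorem coC'_tmul (x : PathAlg k Q) (r : R2 k) : coC' k Q (x ⊗ₜ r) = r.c' • x := by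
  simp [coC', R2.coeffC']
@[simp] theorem coD_tmul (x : PathAlg k Q) (r : R2 k) : coD k Q (x ⊗ₜ r) = r.d • x := by
  simp [coD, R2.coeffD]

theorem coC_mul (x y : DoubleAlg k Q) : coC k Q (x * y) = coC k Q x * coC k Q y := by
  induction x using TensorProduct.induction_on with
  | zero => simp
  | add x1 x2 h1 h2 => simp [add_mul, h1, h2]
  | tmul p r =>
    induction y using TensorProduct.induction_on with
    | zero => simp
    | add y1 y2 h1 h2 => simp only [mul_add, map_add, h1, h2]
    | tmul q s => simp [smul_smul, mul_comm]

theorem coD_mul (x y : DoubleAlg k Q) :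
    coD k Q (x * y) = coC' k Q x * coD k Q y + coD k Q x * coC k Q y := by
  induction x using TensorProduct.induction_on with
  | zero => simp
  | add x1 x2 h1 h2 => simp only [add_mul, map_add, h1, h2]; abel
  | tmul p r =>
    induction y using TensorProduct.induction_on with
    | zero => simp
    | add y1 y2 h1 h2 => simp only [mul_add, map_add, h1, h2]; abel
    | tmul q s => simp [add_smul, smul_smul, mul_comm]

theorem coC'_tauSharp (x : DoubleAlg k Q) :
    coC' k Q (tauSharp k Q x) = PathAlg.tau k Q (coC k Q x) := by
  induction x using TensorProduct.induction_on with
  | zero => simp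
  | add x1 x2 h1 h2 => simp only [map_add, h1, h2]
  | tmul p r =>
    have : (R2.swap k r).c' = r.c := rfl
    simp [tauSharp, this]

theorem coC'_coe (x : IAlg k Q) : coC' k Q (val k Q x) = PathAlg.tau k Q (coC k Q (val k Q x)) := by
  rw [← coC'_tauSharp, tauSharp_val]

end IAlg

/-! ### Representations -/

variable {k}

/-- A representation of the bound quiver of `Λ^ı` on the vector space `N` (the direct sum of the
spaces `N_i = e_i N`): the quiver has the arrows of `Q` and an arrow `ε_i : i → τ i` for each
vertex `i`, and the relations are `ε_{τ i} ε_i = 0` and `ε_j a = (τ a) ε_i` for `a : i → j`.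
Here `ε` is the sum of the maps `ε_i`. -/
structure RepData (Q : IQuiver V E) (N : Type*) [AddCommGroup N] [Module k N] where
  /-- the projection to the component at a vertex -/
  e : V → Module.End k N
  /-- the action of an arrow -/
  f : E → Module.End k N
  /-- the sum of the maps `ε_i : N_i → N_{τ i}` -/
  ε : Module.End k N
  idem : ∀ i, e i * e i = e i
  orth : ∀ i j, i ≠ j → e i * e j = 0
  sum_one : ∑ i, e i = 1
  tgt : ∀ a, e (Q.tgt a) * f a = f a
  src : ∀ a, f a * e (Q.src a) = f a
  ε_sq : ε * ε = 0
  ε_e : ∀ i, ε * e i = e (Q.tauV i) * ε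
  ε_f : ∀ a, ε * f a = f (Q.tauE a) * ε

namespace RepData

variable {Q : IQuiver V E} {N : Type*} [AddCommGroup N] [Module k N] (ρ : RepData (k := k) Q N)

/-- The action of `kQ`. -/
def onPath : PathAlg k Q →ₐ[k] Module.End k N :=
  PathAlg.lift ρ.e ρ.f ρ.idem ρ.orth ρ.sum_one ρ.tgt ρ.src

theorem ε_onPath (x : PathAlg k Q) :
    ρ.ε * ρ.onPath x = ρ.onPath (PathAlg.tau k Q x) * ρ.ε := by
  induction x using PathAlg.induction with
  | hk c => simp [Algebra.commutes]
  | hv i => simp [onPath, ρ.ε_e]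
  | ha a => simp [onPath, ρ.ε_f]
  | hadd x y hx hy => simp [mul_add, add_mul, hx, hy]
  | hmul x y hx hy =>
    rw [map_mul, ← mul_assoc, hx, mul_assoc, hy, map_mul, map_mul, mul_assoc]

/-- The action of `Λ^ı`: the element `(x ⊗ e_1 + τ x ⊗ e_1') + (y ⊗ ε + τ y ⊗ ε')` of `Λ^ı` acts
as `x + ε y`. -/
def toAlgHom : IAlg k Q →ₐ[k] Module.End k N :=
  AlgHom.ofLinearMap
    ((ρ.onPath.toLinearMap.comp (IAlg.coC k Q) +
      (LinearMap.mulLeft k ρ.ε).comp (ρ.onPath.toLinearMap.comp (IAlg.coD k Q))).comp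
        (IAlg.val k Q).toLinearMap)
    (by simp [Algebra.TensorProduct.one_def])
    (fun x y => by
      have hE : ∀ a : PathAlg k Q, ρ.ε * ρ.onPath (PathAlg.tau k Q a) = ρ.onPath a * ρ.ε :=
        fun a => by rw [ε_onPath, PathAlg.tau_tau]
      have h0 : ∀ a b : PathAlg k Q,
          (ρ.ε * ρ.onPath a) * (ρ.ε * ρ.onPath b) = 0 := fun a b => by
        rw [ρ.ε_onPath a, mul_assoc, ← mul_assoc ρ.ε ρ.ε, ρ.ε_sq, zero_mul, mul_zero]
      simp only [LinearMap.comp_apply, LinearMap.add_apply, AlgHom.toLinearMap_apply,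
        LinearMap.mulLeft_apply, IAlg.coC_mul,
        IAlg.coD_mul, map_mul, map_add, mul_add, add_mul, IAlg.coC'_coe, h0]
      rw [← mul_assoc ρ.ε (ρ.onPath (PathAlg.tau k Q _)), hE]
      simp only [mul_assoc, add_zero, add_assoc]
      abel)

theorem toAlgHom_apply (x : IAlg k Q) :
    ρ.toAlgHom x = ρ.onPath (IAlg.coC k Q (IAlg.val k Q x)) +
      ρ.ε * ρ.onPath (IAlg.coD k Q (IAlg.val k Q x)) := rfl

/-- A morphism of representations is compatible with the action of `Λ^ı`. -/
theorem comp_toAlgHom {N' : Type*} [AddCommGroup N'] [Module k N'] (ρ' : RepData (k := k) Q N')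
    (g : N →ₗ[k] N') (he : ∀ i, g ∘ₗ ρ.e i = ρ'.e i ∘ₗ g) (hf : ∀ a, g ∘ₗ ρ.f a = ρ'.f a ∘ₗ g)
    (hε : g ∘ₗ ρ.ε = ρ'.ε ∘ₗ g) (x : IAlg k Q) :
    g ∘ₗ ρ.toAlgHom x = ρ'.toAlgHom x ∘ₗ g := by
  have h : ∀ y : PathAlg k Q, g ∘ₗ ρ.onPath y = ρ'.onPath y ∘ₗ g := by
    intro y
    induction y using PathAlg.induction with
    | hk c => ext n; simp [Algebra.algebraMap_eq_smul_one]
    | hv i => simp [onPath, he]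
    | ha a => simp [onPath, hf]
    | hadd x y hx hy => rw [map_add, map_add, LinearMap.comp_add, LinearMap.add_comp, hx, hy]
    | hmul x y hx hy =>
      rw [map_mul, map_mul, Module.End.mul_eq_comp, Module.End.mul_eq_comp,
        ← LinearMap.comp_assoc, hx, LinearMap.comp_assoc, hy, LinearMap.comp_assoc]
  rw [toAlgHom_apply, toAlgHom_apply, LinearMap.comp_add, LinearMap.add_comp, h,
    Module.End.mul_eq_comp, Module.End.mul_eq_comp, ← LinearMap.comp_assoc, hε,
    LinearMap.comp_assoc, h, LinearMap.comp_assoc]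

/-- The `Λ^ı`-module given by a representation. -/
def Carrier (_ρ : RepData (k := k) Q N) : Type _ := N

instance : AddCommGroup ρ.Carrier := inferInstanceAs (AddCommGroup N)

instance : Module k ρ.Carrier := inferInstanceAs (Module k N)

instance : Module (IAlg k Q) ρ.Carrier :=
  Module.compHom N ρ.toAlgHom.toRingHom

instance : IsScalarTower k (IAlg k Q) ρ.Carrier :=
  ⟨fun r x n => by
    change ρ.toAlgHom (r • x) n = r • ρ.toAlgHom x n
    rw [map_smul]; rfl⟩

end RepData

/-! ### Generalized simple modules -/

section GenSimple

variable [DecidableEq V] (Q : IQuiver V E) (i : V)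

variable (k) in
/-- The representation `E_i` on `k × k`; the first factor sits at the vertex `i`, the second one
at the vertex `τ i`, the arrows of `Q` act by zero, and `ε` maps the first factor
identically to the second one and the second one to zero. If `τ i = i` this is the regular
module of `k[ε_i]/(ε_i²)`; otherwise it is `k ⇄ k` with `ε_i = 1` and `ε_{τ i} = 0`. -/
def genSimpleRep : RepData (k := k) Q (k × k) where
  e r :=
    { toFun := fun x => (if r = i then x.1 else 0, if r = Q.tauV i then x.2 else 0)
      map_add' := fun x y => by ext <;> dsimp only <;> split_ifs <;> simp
      map_smul' := fun c x => by ext <;> dsimp only <;> split_ifs <;> simp }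
  f _ := 0
  ε :=
    { toFun := fun x => (0, x.1)
      map_add' := fun x y => by simp
      map_smul' := fun c x => by simp }
  idem r := by
    refine LinearMap.ext fun x => Prod.ext ?_ ?_ <;> simp <;>
      exact fun h1 h2 => absurd h2 h1
  orth r s h := by
    refine LinearMap.ext fun x => Prod.ext ?_ ?_ <;> simp <;> intros <;> simp_all
  sum_one := by
    refine LinearMap.ext fun x => Prod.ext ?_ ?_ <;>
      simp [LinearMap.sum_apply, Prod.fst_sum, Prod.snd_sum]
  tgt a := by simp
  src a := by simp
  ε_sq := by
    refine LinearMap.ext fun x => Prod.ext ?_ ?_ <;> simp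
  ε_e r := by
    have h : Q.tauV r = Q.tauV i ↔ r = i :=
      ⟨fun h => by rw [← Q.tauV_tauV r, h, Q.tauV_tauV], fun h => by rw [h]⟩
    refine LinearMap.ext fun x => Prod.ext ?_ ?_ <;> simp [h]
  ε_f a := by simp

variable (k) in
/-- The generalized simple `Λ^ı`-module `E_i`. -/
abbrev GenSimple : Type u := (genSimpleRep k Q i).Carrier

end GenSimple

/-! ### The reflection functor -/

section Reflection

open IAlg

variable [DecidableEq V] [Fintype E] (Q : IQuiver V E) (l : V)
variable (L : Type u) [AddCommGroup L] [Module k L] [Module (IAlg k Q) L]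
  [IsScalarTower k (IAlg k Q) L]

/-- The total space of `F_l⁺ L`. For vertices `r ∉ {l, τ l}` its component at `r` is `e_r L`;
for `r ∈ {l, τ l}` its component at `r` is the kernel of the map
`⨁_{a : j → r} e_j L → e_r L`, `(y_a)_a ↦ ∑ a y_a`. An element is written as a pair `(x, y)` with
`x` in the sum of the `e_r L` for `r ∉ {l, τ l}` and `y = (y_a)_a`, where `a` runs
through the arrows ending in `l` or `τ l` (and `y_a = 0` for the other arrows). -/
def reflSubmodule : Submodule k (L × (E → L)) where
  carrier := {p | (∀ r, Q.InOrbit l r → vert k Q r • p.1 = 0) ∧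
    (∀ a, Q.InOrbit l (Q.tgt a) → vert k Q (Q.src a) • p.2 a = p.2 a) ∧
    (∀ a, ¬ Q.InOrbit l (Q.tgt a) → p.2 a = 0) ∧
    (∀ r, Q.InOrbit l r → ∑ a with Q.tgt a = r, arr k Q a • p.2 a = 0)}
  zero_mem' := by simp
  add_mem' {p q} hp hq := by
    refine ⟨fun r hr => ?_, fun a ha => ?_, fun a ha => ?_, fun r hr => ?_⟩
    · simp [smul_add, hp.1 r hr, hq.1 r hr]
    · simp [smul_add, hp.2.1 a ha, hq.2.1 a ha]
    · simp [hp.2.2.1 a ha, hq.2.2.1 a ha]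
    · simp [smul_add, Finset.sum_add_distrib, hp.2.2.2 r hr, hq.2.2.2 r hr]
  smul_mem' c p hp := by
    refine ⟨fun r hr => ?_, fun a ha => ?_, fun a ha => ?_, fun r hr => ?_⟩
    · simp [smul_algebra_smul_comm, hp.1 r hr]
    · simp [smul_algebra_smul_comm, hp.2.1 a ha]
    · simp [hp.2.2.1 a ha]
    · simp [smul_algebra_smul_comm, ← Finset.smul_sum, hp.2.2.2 r hr]


variable {l} {L} in
theorem mem_reflSubmodule {p : L × (E → L)} : p ∈ reflSubmodule (k := k) Q l L ↔
    (∀ r, Q.InOrbit l r → vert k Q r • p.1 = 0) ∧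
    (∀ a, Q.InOrbit l (Q.tgt a) → vert k Q (Q.src a) • p.2 a = p.2 a) ∧
    (∀ a, ¬ Q.InOrbit l (Q.tgt a) → p.2 a = 0) ∧
    (∀ r, Q.InOrbit l r → ∑ a with Q.tgt a = r, arr k Q a • p.2 a = 0) := Iff.rfl

/-- The action of `e_r` on `F_l⁺ L`: the projection to the component at `r`. -/
def reflE (r : V) : Module.End k (reflSubmodule (k := k) Q l L) :=
  LinearMap.restrict (R := k) (M := L × (E → L)) (M₂ := L × (E → L))
    (p := reflSubmodule Q l L) (q := reflSubmodule Q l L)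
    { toFun := fun p => (vert k Q r • p.1, fun a => if Q.tgt a = r then p.2 a else 0)
      map_add' := fun p q => by
        refine Prod.ext (by simp) (funext fun a => ?_)
        dsimp; split_ifs <;> simp
      map_smul' := fun c p => by
        refine Prod.ext (by simp [smul_algebra_smul_comm]) (funext fun a => ?_)
        dsimp; split_ifs <;> simp }
    (by
      intro p hp
      rw [mem_reflSubmodule] at hp ⊢
      refine ⟨fun s hs => ?_, fun a ha => ?_, fun a ha => ?_, fun s hs => ?_⟩
      · dsimp
        rcases eq_or_ne s r with rfl | h
        · rw [hp.1 s hs, smul_zero]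
        · rw [smul_smul, vert_mul_vert_of_ne h, zero_smul]
      · dsimp; split_ifs
        · exact hp.2.1 a ha
        · simp
      · simp [hp.2.2.1 a ha]
      · dsimp
        rcases eq_or_ne s r with rfl | h
        · rw [← hp.2.2.2 s hs]
          exact Finset.sum_congr rfl fun a ha => by simp [(Finset.mem_filter.1 ha).2]
        · exact Finset.sum_eq_zero fun a ha => by simp [(Finset.mem_filter.1 ha).2, h])

/-- The action of the arrow `a` of `s_l Q` on `F_l⁺ L`. A reversed arrow `a : r → j`, `r ∈ {l, τ l}`,
acts by the inclusion of the kernel followed by the projection to `e_j L`: `(y_b)_b ↦ y_a`. The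
other arrows act as on `L`. -/
def reflF (hl : Q.IsSink l) (a : E) : Module.End k (reflSubmodule (k := k) Q l L) :=
  LinearMap.restrict (R := k) (M := L × (E → L)) (M₂ := L × (E → L))
    (p := reflSubmodule Q l L) (q := reflSubmodule Q l L)
    { toFun := fun p => (if Q.InOrbit l (Q.tgt a) then p.2 a else arr k Q a • p.1, 0)
      map_add' := fun p q => by
        refine Prod.ext ?_ (by simp)
        dsimp; split_ifs <;> simp
      map_smul' := fun c p => by
        refine Prod.ext ?_ (by simp)
        dsimp; split_ifs <;> simp [smul_algebra_smul_comm] }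
    (by
      intro p hp
      rw [mem_reflSubmodule] at hp ⊢
      refine ⟨fun s hs => ?_, fun b hb => by simp, fun b hb => by simp, fun s hs => by simp⟩
      dsimp
      split_ifs with h
      · rw [← hp.2.1 a h, smul_smul, vert_mul_vert_of_ne, zero_smul]
        rintro rfl
        exact hl.not_inOrbit a hs
      · rw [← vert_tgt_mul_arr, smul_smul, ← mul_assoc, vert_mul_vert_of_ne, zero_mul, zero_smul]
        rintro rfl
        exact h hs)

/-- The action of `ε` on `F_l⁺ L`. -/
def reflEps : Module.End k (reflSubmodule (k := k) Q l L) :=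
  LinearMap.restrict (R := k) (M := L × (E → L)) (M₂ := L × (E → L))
    (p := reflSubmodule Q l L) (q := reflSubmodule Q l L)
    { toFun := fun p => (eps k Q • p.1, fun a => eps k Q • p.2 (Q.tauE a))
      map_add' := fun p q => by
        refine Prod.ext (by simp) (funext fun a => by simp)
      map_smul' := fun c p => by
        refine Prod.ext (by simp [smul_algebra_smul_comm])
          (funext fun a => by simp [smul_algebra_smul_comm]) }
    (by
      intro p hp
      rw [mem_reflSubmodule] at hp ⊢
      refine ⟨fun s hs => ?_, fun a ha => ?_, fun a ha => ?_, fun s hs => ?_⟩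
      · dsimp
        rw [← Q.tauV_tauV s, smul_smul, ← eps_mul_vert, mul_smul,
          hp.1 _ ((Q.inOrbit_tau l s).2 hs), smul_zero]
      · dsimp
        have h := hp.2.1 _ ((Q.inOrbit_tgt_tau l a).2 ha)
        rw [Q.src_tauE] at h
        rw [← h, smul_smul (eps k Q), eps_mul_vert, Q.tauV_tauV, smul_smul, ← mul_assoc,
          vert_mul_vert]
      · simp [hp.2.2.1 _ ((Q.inOrbit_tgt_tau l a).not.2 ha)]
      · dsimp
        have h := hp.2.2.2 _ ((Q.inOrbit_tau l s).2 hs)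
        have h2 : eps k Q • ∑ a with Q.tgt a = Q.tauV s, arr k Q a • p.2 a = 0 := by
          rw [h, smul_zero]
        rw [← h2, Finset.smul_sum]
        refine Finset.sum_nbij' Q.tauE Q.tauE ?_ ?_ ?_ ?_ ?_
        · intro a ha
          simp only [Finset.mem_filter, Finset.mem_univ, true_and] at ha ⊢
          rw [Q.tgt_tauE, ha]
        · intro a ha
          simp only [Finset.mem_filter, Finset.mem_univ, true_and] at ha ⊢
          rw [Q.tgt_tauE, ha, Q.tauV_tauV]
        · intro a _; exact Q.tauE_tauE a
        · intro a _; exact Q.tauE_tauE a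
        · intro a _
          rw [smul_smul, smul_smul, eps_mul_arr, Q.tauE_tauE])

/-- The representation `F_l⁺ L` of the reflected quiver. -/
def reflRep (hl : Q.IsSink l) :
    RepData (k := k) (Q.reflect l) (reflSubmodule (k := k) Q l L) where
  e := reflE Q l L
  f := reflF Q l L hl
  ε := reflEps Q l L
  idem r := by
    refine LinearMap.ext fun p => Subtype.ext (Prod.ext ?_ (funext fun a => ?_))
    · simp [reflE, LinearMap.restrict_apply, smul_smul, vert_mul_vert]
    · simp [reflE, LinearMap.restrict_apply]
      exact fun h1 h2 => absurd h2 h1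
  orth r s h := by
    refine LinearMap.ext fun p => Subtype.ext (Prod.ext ?_ (funext fun a => ?_))
    · simp [reflE, LinearMap.restrict_apply, smul_smul, vert_mul_vert_of_ne h]
    · simp [reflE, LinearMap.restrict_apply]
      grind
  sum_one := by
    refine LinearMap.ext fun p => Subtype.ext (Prod.ext ?_ (funext fun a => ?_))
    · simp [reflE, LinearMap.restrict_apply, LinearMap.sum_apply, Prod.fst_sum,
        ← Finset.sum_smul, sum_vert]
    · simp [reflE, LinearMap.restrict_apply, LinearMap.sum_apply, Prod.snd_sum]
  tgt a := by
    refine LinearMap.ext fun p => Subtype.ext (Prod.ext ?_ (funext fun b => ?_))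
    · by_cases h : Q.InOrbit l (Q.tgt a)
      · simpa [reflE, reflF, IQuiver.reflect, LinearMap.restrict_apply, h] using p.2.2.1 a h
      · simp [reflE, reflF, IQuiver.reflect, LinearMap.restrict_apply, h, smul_smul,
          vert_tgt_mul_arr]
    · simp [reflE, reflF, LinearMap.restrict_apply]
  src a := by
    refine LinearMap.ext fun p => Subtype.ext (Prod.ext ?_ (funext fun b => ?_))
    · by_cases h : Q.InOrbit l (Q.tgt a)
      · simp [reflE, reflF, IQuiver.reflect, LinearMap.restrict_apply, h]
      · simp [reflE, reflF, IQuiver.reflect, LinearMap.restrict_apply, h, smul_smul,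
          arr_mul_vert_src]
    · simp [reflE, reflF, LinearMap.restrict_apply]
  ε_sq := by
    refine LinearMap.ext fun p => Subtype.ext (Prod.ext ?_ (funext fun b => ?_))
    · simp [reflEps, LinearMap.restrict_apply, smul_smul, eps_mul_eps]
    · simp [reflEps, LinearMap.restrict_apply, smul_smul, eps_mul_eps]
  ε_e r := by
    have hr : ∀ i, Q.tauV i = r ↔ i = Q.tauV r := fun i =>
      ⟨fun h => by rw [← h, Q.tauV_tauV], fun h => by rw [h, Q.tauV_tauV]⟩
    refine LinearMap.ext fun p => Subtype.ext (Prod.ext ?_ (funext fun b => ?_))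
    · simp [reflE, reflEps, IQuiver.reflect, LinearMap.restrict_apply, smul_smul, eps_mul_vert]
    · simp [reflE, reflEps, IQuiver.reflect, LinearMap.restrict_apply, Q.tgt_tauE, hr]
      congr
  ε_f a := by
    refine LinearMap.ext fun p => Subtype.ext (Prod.ext ?_ (funext fun b => ?_))
    · by_cases h : Q.InOrbit l (Q.tgt a)
      · simp [reflF, reflEps, IQuiver.reflect, LinearMap.restrict_apply, h,
          Q.tauE_tauE, IQuiver.inOrbit_tgt_tau]
      · simp [reflF, reflEps, IQuiver.reflect, LinearMap.restrict_apply, h, smul_smul,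
          eps_mul_arr, IQuiver.inOrbit_tgt_tau]
    · simp [reflF, reflEps, LinearMap.restrict_apply]

/-- The `s_l Λ^ı`-module `F_l⁺ L`. -/
abbrev Refl (hl : Q.IsSink l) : Type u := (reflRep (k := k) Q l L hl).Carrier

variable {L} in
/-- The map `F_l⁺ g` for a morphism `g`. -/
def reflMap (hl : Q.IsSink l) {L' : Type u} [AddCommGroup L'] [Module k L']
    [Module (IAlg k Q) L'] [IsScalarTower k (IAlg k Q) L'] (g : L →ₗ[IAlg k Q] L') :
    Refl (k := k) Q l L hl →ₗ[IAlg k (Q.reflect l)] Refl (k := k) Q l L' hl :=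
  let g₀ : reflSubmodule (k := k) Q l L →ₗ[k] reflSubmodule (k := k) Q l L' :=
    LinearMap.restrict
      ((g.restrictScalars k).prodMap ((g.restrictScalars k).compLeft E))
      (by
        intro p hp
        rw [mem_reflSubmodule] at hp ⊢
        refine ⟨fun s hs => ?_, fun a ha => ?_, fun a ha => ?_, fun s hs => ?_⟩
        · have h := congrArg g (hp.1 s hs)
          rw [map_smul, map_zero] at h
          exact h
        · have h := congrArg g (hp.2.1 a ha)
          rw [map_smul] at h
          exact h
        · exact (congrArg g (hp.2.2.1 a ha)).trans (map_zero g)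
        · have h := congrArg g (hp.2.2.2 s hs)
          simp only [map_sum, map_smul, map_zero] at h
          exact h)
  { toFun := g₀
    map_add' := g₀.map_add
    map_smul' := fun x n => LinearMap.congr_fun
      ((reflRep (k := k) Q l L hl).comp_toAlgHom (reflRep (k := k) Q l L' hl) g₀
        (fun r => by
          refine LinearMap.ext fun p => Subtype.ext (Prod.ext ?_ (funext fun b => ?_))
          · simp [reflRep, reflE, g₀, LinearMap.restrict_apply]
          · by_cases h : Q.tgt b = r <;> simp [reflRep, reflE, g₀, LinearMap.restrict_apply, h])
        (fun a => by
          refine LinearMap.ext fun p => Subtype.ext (Prod.ext ?_ (funext fun b => ?_))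
          · by_cases h : Q.InOrbit l (Q.tgt a) <;>
              simp [reflRep, reflF, g₀, LinearMap.restrict_apply, h]
          · simp [reflRep, reflF, g₀, LinearMap.restrict_apply])
        (by
          refine LinearMap.ext fun p => Subtype.ext (Prod.ext ?_ (funext fun b => ?_))
          · simp [reflRep, reflEps, g₀, LinearMap.restrict_apply]
          · simp [reflRep, reflEps, g₀, LinearMap.restrict_apply])
        x) n }

end Reflection

end Algebras

/-! ### Finite-dimensional modules, tilting modules, Auslander–Reiten translates -/

section Modules

variable (k : Type u) [Field k]

/-- `mod A`: the category of finite-dimensional left `A`-modules. -/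
abbrev FDMod (A : Type u) [Ring A] [Algebra k A] :=
  ObjectProperty.FullSubcategory (fun M : ModuleCat.{u} A => Module.Finite k M)

theorem finite_of_surjective (A : Type u) [Ring A] [Algebra k A] (M : Type u)
    [AddCommGroup M] [Module A M] [Module k M] [IsScalarTower k A M]
    [Module.Finite k M] (N : ModuleCat.{u} A) (f : M →ₗ[A] N) (hf : Function.Surjective f) :
    Module.Finite k N :=
  Module.Finite.of_surjective (f.restrictScalars k) hf

/-- The object of `mod A` given by a finite-dimensional `A`-module. -/
def FDMod.of (A : Type u) [Ring A] [Algebra k A] (M : Type u) [AddCommGroup M] [Module A M]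
    [Module k M] [IsScalarTower k A M] [Module.Finite k M] : FDMod k A :=
  ⟨ModuleCat.of A M, finite_of_surjective k A M (ModuleCat.of A M) LinearMap.id fun m => ⟨m, rfl⟩⟩

variable {k} {A : Type u} [Ring A]

/-- `X ∈ add T`: `X` is a direct summand of a finite direct sum of copies of `T`. -/
def InAdd (T X : Type u) [AddCommGroup T] [Module A T] [AddCommGroup X] [Module A X] : Prop :=
  ∃ (n : ℕ) (i : X →ₗ[A] (Fin n → T)) (r : (Fin n → T) →ₗ[A] X), r ∘ₗ i = LinearMap.id

/-- A (classical) tilting module: its projective dimension is at most one, it has no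
self-extensions, and there is an exact sequence `0 → A → T₀ → T₁ → 0` with `T₀, T₁ ∈ add T`. -/
structure IsTilting (T : ModuleCat.{u} A) : Prop where
  projDim_le : HasProjectiveDimensionLE T 1
  ext_eq_zero : Subsingleton (Abelian.Ext.{u} T T 1)
  coresolution : ∃ (T₀ T₁ : ModuleCat.{u} A) (f : A →ₗ[A] T₀) (g : T₀ →ₗ[A] T₁),
    InAdd (A := A) T T₀ ∧ InAdd (A := A) T T₁ ∧
      Function.Injective f ∧ Function.Exact f g ∧ Function.Surjective g

variable (k)

/-- The standard dual `D M = Hom_k(M, k)` of a left `A`-module, a right `A`-module. -/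
def StdDual (M : Type u) [AddCommGroup M] [Module k M] : Type u := M →ₗ[k] k

variable [Algebra k A]

instance (M : Type u) [AddCommGroup M] [Module k M] : AddCommGroup (StdDual k M) :=
  inferInstanceAs (AddCommGroup (M →ₗ[k] k))

variable {k} in
/-- An element of `D M` as a linear form. -/
def StdDual.lin {M : Type u} [AddCommGroup M] [Module k M] (φ : StdDual k M) : M →ₗ[k] k := φ

/-- The right action `(φ a)(m) = φ (a m)`. -/
instance (M : Type u) [AddCommGroup M] [Module k M] [Module A M] [IsScalarTower k A M] :
    Module Aᵐᵒᵖ (StdDual k M) where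
  smul a φ := (φ.lin ∘ₗ Algebra.lsmul k k M a.unop : M →ₗ[k] k)
  one_smul φ := LinearMap.ext fun m => congrArg φ.lin (one_smul A m)
  mul_smul a b φ := LinearMap.ext fun m => congrArg φ.lin (mul_smul b.unop a.unop m)
  smul_zero _ := rfl
  smul_add _ _ _ := rfl
  add_smul a b φ := LinearMap.ext fun m =>
    (congrArg φ.lin (add_smul a.unop b.unop m)).trans (map_add φ.lin _ _)
  zero_smul φ := LinearMap.ext fun m =>
    (congrArg φ.lin (zero_smul A m)).trans (map_zero φ.lin)

variable {k}

/-- A superfluous submodule: no proper submodule complements it to the whole module. -/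
def IsSuperfluous {R M : Type*} [Ring R] [AddCommGroup M] [Module R M] (K : Submodule R M) : Prop :=
  ∀ U : Submodule R M, K ⊔ U = ⊤ → U = ⊤

/-- `P₁ → P₀ → X → 0` (the maps being `p₁`, `p₀`) is a minimal projective presentation of the
right `A`-module `X`. -/
structure IsMinProjPres {X P₀ P₁ : Type u} [AddCommGroup X] [Module Aᵐᵒᵖ X]
    [AddCommGroup P₀] [Module Aᵐᵒᵖ P₀] [AddCommGroup P₁] [Module Aᵐᵒᵖ P₁]
    (p₁ : P₁ →ₗ[Aᵐᵒᵖ] P₀) (p₀ : P₀ →ₗ[Aᵐᵒᵖ] X) : Prop where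
  finite₀ : Module.Finite Aᵐᵒᵖ P₀
  finite₁ : Module.Finite Aᵐᵒᵖ P₁
  projective₀ : Module.Projective Aᵐᵒᵖ P₀
  projective₁ : Module.Projective Aᵐᵒᵖ P₁
  surjective : Function.Surjective p₀
  exact : Function.Exact p₁ p₀
  minimal₀ : IsSuperfluous (LinearMap.ker p₀)
  minimal₁ : IsSuperfluous (LinearMap.ker p₁)

/-- The left `A`-module `Tr X` computed from a presentation `p₁ : P₁ → P₀` of the right
`A`-module `X`: the cokernel of `Hom_A(P₀, A) → Hom_A(P₁, A)`, `f ↦ f ∘ p₁`. -/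
abbrev Transpose {P₀ P₁ : Type u} [AddCommGroup P₀] [Module Aᵐᵒᵖ P₀] [AddCommGroup P₁]
    [Module Aᵐᵒᵖ P₁] (p₁ : P₁ →ₗ[Aᵐᵒᵖ] P₀) : Type u :=
  (P₁ →ₗ[Aᵐᵒᵖ] A) ⧸ LinearMap.range (LinearMap.lcomp A A p₁)

variable (k)

variable (A) in
/-- `Y ≅ TrD M`, the inverse Auslander–Reiten translate: `Y` is isomorphic to the transpose
of a minimal projective presentation of `D M`. -/
def IsTrD (M Y : Type u) [AddCommGroup M] [Module k M] [Module A M] [IsScalarTower k A M]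
    [AddCommGroup Y] [Module A Y] : Prop :=
  ∃ (P₀ P₁ : ModuleCat.{u} Aᵐᵒᵖ) (p₁ : P₁ →ₗ[Aᵐᵒᵖ] P₀) (p₀ : P₀ →ₗ[Aᵐᵒᵖ] StdDual k M),
    IsMinProjPres p₁ p₀ ∧ Nonempty (Y ≃ₗ[A] Transpose p₁)

/-! ### The functor `Hom_A(T, -)` -/

/-- `End_A(T)^op`. -/
abbrev EndOp (T : ModuleCat.{u} A) : Type u := (Module.End A T)ᵐᵒᵖ

/-- The space `Hom_A(T, X)`. -/
def HomMod (T X : ModuleCat.{u} A) : Type u := T →ₗ[A] X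

namespace HomMod

variable (T X : ModuleCat.{u} A)

instance : AddCommGroup (HomMod T X) := inferInstanceAs (AddCommGroup (T →ₗ[A] X))

instance : Module k (HomMod T X) := inferInstanceAs (Module k (T →ₗ[A] X))

variable {T X} in
/-- An element of `Hom_A(T, X)` as a linear map. -/
def lin (f : HomMod T X) : T →ₗ[A] X := f

/-- `End_A(T)^op` acts on `Hom_A(T, X)` from the left by precomposition. -/
instance : Module (EndOp T) (HomMod T X) where
  smul b f := (f.lin ∘ₗ b.unop : T →ₗ[A] X)
  one_smul _ := rfl
  mul_smul _ _ _ := rfl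
  smul_zero _ := rfl
  smul_add _ _ _ := rfl
  add_smul b c f := LinearMap.ext fun t => map_add f.lin (b.unop t) (c.unop t)
  zero_smul f := LinearMap.ext fun _ => map_zero f.lin

instance : IsScalarTower k (EndOp T) (HomMod T X) :=
  ⟨fun c b f => LinearMap.ext fun t => by
    change f.lin (c • b.unop t) = c • f.lin (b.unop t)
    exact LinearMap.map_smul_of_tower f.lin c _⟩

variable {T X}

theorem finite [Module.Finite k T] [Module.Finite k X] : Module.Finite k (HomMod T X) := by
  let r : HomMod T X →ₗ[k] (T →ₗ[k] X) :=
    { toFun := fun f => f.lin.restrictScalars k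
      map_add' := fun _ _ => rfl
      map_smul' := fun _ _ => rfl }
  exact Module.Finite.of_injective r (LinearMap.restrictScalars_injective k)

end HomMod

/-- The functor `Hom_A(T, -) : mod A → mod End_A(T)^op`. -/
def homFunctor (T : FDMod k A) : FDMod k A ⥤ FDMod k (EndOp T.obj) where
  obj X :=
    haveI := T.property
    haveI := X.property
    haveI := HomMod.finite k (T := T.obj) (X := X.obj)
    FDMod.of k (EndOp T.obj) (HomMod T.obj X.obj)
  map {X Y} g := ObjectProperty.homMk (ModuleCat.ofHom
    { toFun := fun f : HomMod T.obj X.obj =>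
        (g.hom.hom ∘ₗ f.lin : T.obj →ₗ[A] Y.obj)
      map_add' := fun f f' => LinearMap.comp_add f.lin f'.lin g.hom.hom
      map_smul' := fun _ _ => rfl })

end Modules

/-! ### The reflection functor and the module `T` -/

section Main

variable (k : Type u) [Field k] {V E : Type u} [Fintype V] [DecidableEq V] (Q : IQuiver V E)

/-- The reflection functor `F_l⁺ : mod Λ^ı → mod s_l Λ^ı` at a sink `l`. -/
def reflFunctor [Fintype E] (l : V) (hl : Q.IsSink l) :
    FDMod k (IAlg k Q) ⥤ FDMod k (IAlg k (Q.reflect l)) where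
  obj L :=
    haveI := L.property
    haveI : Module.Finite k (Refl (k := k) Q l L.obj hl) :=
      inferInstanceAs (Module.Finite k (reflSubmodule (k := k) Q l L.obj))
    FDMod.of k _ (Refl (k := k) Q l L.obj hl)
  map g := ObjectProperty.homMk (ModuleCat.ofHom (reflMap (k := k) Q l hl g.hom.hom))

/-- `T ≅ (Λ^ı / E_l) ⊕ TrD E_l` if `τ l = l`, and
`T ≅ (Λ^ı / (E_l ⊕ E_{τ l})) ⊕ TrD E_l ⊕ TrD E_{τ l}` if `τ l ≠ l`. As `l` is a sink,
the left ideals `Λ^ı e_l` and `Λ^ı e_{τ l}` are the copies of `E_l` and `E_{τ l}` in `Λ^ı`. -/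
def IsAPRModule (l : V) (T : ModuleCat.{u} (IAlg k Q)) : Prop :=
  (Q.tauV l = l ∧ ∃ Y : ModuleCat.{u} (IAlg k Q), IsTrD k (IAlg k Q) (GenSimple k Q l) Y ∧
    Nonempty (T ≃ₗ[IAlg k Q] (IAlg k Q ⧸ Submodule.span (IAlg k Q) {IAlg.vert k Q l}) × Y)) ∨
  (Q.tauV l ≠ l ∧ ∃ Y Y' : ModuleCat.{u} (IAlg k Q), IsTrD k (IAlg k Q) (GenSimple k Q l) Y ∧
    IsTrD k (IAlg k Q) (GenSimple k Q (Q.tauV l)) Y' ∧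
    Nonempty (T ≃ₗ[IAlg k Q]
      (IAlg k Q ⧸ Submodule.span (IAlg k Q) {IAlg.vert k Q l, IAlg.vert k Q (Q.tauV l)}) × Y × Y'))

end Main

end

/-! The module `T` represents the reflection functor. Write e for the sum of the idempotents at l
and τl. An element of F_l⁺ L is a pair (x, (y_a)_a) with e x = 0 and y_a ∈ e_{src a} L, for the
arrows a ending in the orbit of l, such that ∑ a y_a = 0 (`IsReflFamily`). `T` carries a pair u that
is universal among these (`IsGenericFamily`). So g ↦ F_l⁺(g)(u) is a natural bijection Hom(T, L) ≅
F_l⁺ L, and all three assertions are deduced from the universal property alone.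

That `T` has such a pair is seen on its summands. The class of 1 in the quotient of Λ^ı by the left
ideal generated by the orbit idempotents is universal for x. The right module D E_i has top at τi,
and its minimal presentation is 0 → ⨁ e_{src a}Λ^ı → e_{τi}Λ^ı, over the arrows a ending in τi.
Dualising turns the coordinate functions into generators t_a of TrD E_i with the single relation ∑ a
t_a = 0, which is the universal y for the arrows into τi (`isGenericArrowFamily_transpose`).
Uniqueness of projective covers makes the choice of minimal presentation irrelevant.

Tilting: generators and relations of u give a resolution 0 → Λ^ı e → Λ^ı(1-e) ⊕ ⨁ Λ^ı e_{src a} → T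
→ 0. Injectivity on the left holds because Λ^ı e_r has basis e_r, ε e_r at a sink r and some arrow
ends there (`eq_zero_of_mul_arr`). Ext¹(T,T) vanishes because T is generated outside the orbit,
whence e T = ∑ e a T and maps Λ^ı e → T extend (`exists_orb_smul_eq`, `exists_extension`). The
coresolution embeds Λ^ı in the same middle term; its cokernel is a retract of T.

Endomorphisms: F_l⁺ T has to be free of rank one over s_lΛ^ı with basis u (`bijective_smul`). For
this the left adjoint of F_l⁺ is written down on the regular module (`Corefl`), and its unit s_lΛ^ı
→ F_l⁺(Corefl) is shown to be bijective. The universal property makes T a retract of `Corefl`,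
compatibly with u and the image of 1, and this transfers the bijectivity. Then End(T)^op ≅ F_l⁺ T ≅
s_lΛ^ı is multiplicative, and S is restriction of scalars along it.

The structural input on kQ is that left multiplications by distinct arrows are jointly injective
(`PathAlg.eq_zero_of_sum_arr_mul`), proved with a derivative instead of a basis of paths. Acyclicity
provides finite-dimensionality. -/

noncomputable section

/-! ### Left freeness over the arrows, and finiteness of the path algebra. -/

namespace PathAlg

variable {k : Type u} [Field k] {V E : Type u} [Fintype V] {Q : IQuiver V E}

open Classical in
variable (k) in
/-- The `2 × 2` matrix representation of `kQ` whose upper right entry is the left derivative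
with respect to the arrow `a`. -/
def derivRep (a : E) : PathAlg k Q →ₐ[k] Matrix (Fin 2) (Fin 2) (PathAlg k Q) :=
  lift (fun i => !![if i = Q.tgt a then 1 else 0, 0; 0, vert k Q i])
    (fun b => !![0, if b = a then vert k Q (Q.src a) else 0; 0, arr k Q b])
    (fun i => by
      rw [Matrix.mul_fin_two]
      congr <;> simp [vert_idem]
      exact fun h h' => absurd h' h)
    (fun i j h => by
      rw [Matrix.mul_fin_two]
      have h1 : i = Q.tgt a → j ≠ Q.tgt a := fun h1 h2 => h (h1.trans h2.symm)
      ext m n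
      fin_cases m <;> fin_cases n <;> simp [vert_orth h]
      simpa using fun h2 h3 => absurd h2 (h1 h3))
    (by
      ext i j
      rw [Matrix.sum_apply]
      fin_cases i <;> fin_cases j <;> simp [vert_sum])
    (fun b => by
      rw [Matrix.mul_fin_two]
      by_cases h : b = a
      · subst h; simp [vert_tgt_arr]
      · simp [vert_tgt_arr, h])
    (fun b => by
      rw [Matrix.mul_fin_two]
      by_cases h : b = a
      · subst h; simp [arr_vert_src, vert_idem]
      · simp [arr_vert_src, h])

theorem derivRep_lower (a : E) (x : PathAlg k Q) :
    derivRep k a x 1 0 = 0 ∧ derivRep k a x 1 1 = x := by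
  induction x using induction with
  | hk c =>
    rw [AlgHom.commutes, Matrix.algebraMap_eq_diagonal]
    simp
  | hv i => simp [derivRep]
  | ha b => simp [derivRep]
  | hadd x y hx hy => simp [hx, hy]
  | hmul x y hx hy => simp [Matrix.mul_apply, hx, hy]

variable (k) in
/-- The left derivative of `x` with respect to the arrow `a`. -/
def deriv (a : E) (x : PathAlg k Q) : PathAlg k Q := derivRep k a x 0 1

-- The matrix product gives ∂(b x) = χ(b) ∂x + ∂(b) x with χ the character at the target of a; since
-- χ kills arrows, only the second term survives.
open Classical in
theorem deriv_arr_mul (a b : E) (x : PathAlg k Q) :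
    deriv k a (arr k Q b * x) = if b = a then vert k Q (Q.src a) * x else 0 := by
  rw [deriv, map_mul, Matrix.mul_apply]
  simp only [Fin.sum_univ_two, (derivRep_lower a x).2]
  simp [derivRep]

theorem deriv_sum {ι : Type*} (a : E) (s : Finset ι) (x : ι → PathAlg k Q) :
    deriv k a (∑ i ∈ s, x i) = ∑ i ∈ s, deriv k a (x i) := by
  simp [deriv, Matrix.sum_apply]

/-- The derivative along a picks out the a-th coefficient of the sum. This is the substitute for
linear independence of paths. -/
theorem eq_zero_of_sum_arr_mul {s : Finset E} {y : E → PathAlg k Q}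
    (hy : ∀ a ∈ s, vert k Q (Q.src a) * y a = y a) (h : ∑ a ∈ s, arr k Q a * y a = 0) :
    ∀ a ∈ s, y a = 0 := by
  classical
  intro a ha
  have := congrArg (deriv k a) h
  rw [deriv_sum] at this
  simp only [deriv_arr_mul, Finset.sum_ite_eq', ha, if_true, hy a ha] at this
  rw [this, deriv, map_zero, Matrix.zero_apply]

open Classical in
variable (k) (Q) in
/-- The character of `kQ` at a vertex. -/
def character (i : V) : PathAlg k Q →ₐ[k] k :=
  lift (fun j => if j = i then 1 else 0) (fun _ => 0) (by simp) (by
    intro j j' h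
    by_cases h1 : j = i
    · simp [show j' ≠ i from fun h2 => h (h1.trans h2.symm)]
    · simp [h1]) (by simp) (by simp) (by simp)

theorem character_vert (i : V) : character k Q i (vert k Q i) = 1 := by simp [character]

theorem vert_ne_zero (i : V) : vert k Q i ≠ 0 := fun h => by
  have := character_vert (k := k) (Q := Q) i
  simp [h] at this

theorem arr_ne_zero (a : E) : arr k Q a ≠ 0 := fun h => by
  refine vert_ne_zero (k := k) (Q := Q) (Q.src a)
    (eq_zero_of_sum_arr_mul (s := {a}) (y := fun _ => vert k Q (Q.src a)) ?_ ?_ a (by simp))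
  · simp [vert_idem]
  · simp [h]

/-- A path ending in i is either trivial or has a last arrow, which can be split off on the left. -/
theorem vert_mul_eq [Fintype E] [DecidableEq V] (i : V) (x : PathAlg k Q) :
    ∃ (c : k) (y : E → PathAlg k Q), (∀ a, vert k Q (Q.src a) * y a = y a) ∧
      vert k Q i * x = c • vert k Q i + ∑ a with Q.tgt a = i, arr k Q a * y a := by
  -- The condition on y_a can be imposed at the end, because a = a e_{src a}; the induction runs
  -- without it.
  suffices h : ∀ i, ∃ (c : k) (y : E → PathAlg k Q),
      vert k Q i * x = c • vert k Q i + ∑ a with Q.tgt a = i, arr k Q a * y a by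
    obtain ⟨c, y, h⟩ := h i
    refine ⟨c, fun a => vert k Q (Q.src a) * y a, fun a => ?_, h.trans ?_⟩
    · rw [← mul_assoc, vert_idem]
    · simp only [← mul_assoc, arr_vert_src]
  clear i
  induction x using induction with
  | hk c => exact fun i => ⟨c, 0, by simp [Algebra.algebraMap_eq_smul_one]⟩
  | hv j =>
    intro i
    rcases eq_or_ne i j with rfl | h
    · exact ⟨1, 0, by simp [vert_idem]⟩
    · exact ⟨0, 0, by simp [vert_orth h]⟩
  | ha a =>
    classical
    intro i
    refine ⟨0, fun b => if b = a then 1 else 0, ?_⟩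
    by_cases h : Q.tgt a = i
    · subst h
      simp [vert_tgt_arr]
    · rw [← vert_tgt_arr, ← mul_assoc, vert_orth (Ne.symm h)]
      simp only [mul_ite, mul_one, mul_zero, zero_mul, zero_smul, zero_add]
      rw [Finset.sum_ite_eq' _ a]
      simp [h]
  | hadd x y hx hy =>
    intro i
    obtain ⟨c, p, h⟩ := hx i
    obtain ⟨d, q, h'⟩ := hy i
    refine ⟨c + d, p + q, ?_⟩
    rw [mul_add, h, h', add_smul]
    simp only [Pi.add_apply, mul_add, Finset.sum_add_distrib]
    abel
  | hmul x y hx hy =>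
    intro i
    obtain ⟨c, p, h⟩ := hx i
    obtain ⟨d, q, h'⟩ := hy i
    refine ⟨c * d, fun a => p a * y + c • q a, ?_⟩
    rw [← mul_assoc, h, add_mul, smul_mul_assoc, h', Finset.sum_mul]
    simp only [mul_add, Finset.sum_add_distrib, smul_add, smul_smul, Finset.smul_sum,
      mul_smul_comm, mul_assoc]
    abel

theorem mul_vert_of_isSink {l : V} (hl : Q.IsSink l) (x : PathAlg k Q) :
    ∃ c : k, x * vert k Q l = c • vert k Q l := by
  induction x using induction with
  | hk c => exact ⟨c, by simp [Algebra.algebraMap_eq_smul_one]⟩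
  | hv j =>
    rcases eq_or_ne j l with rfl | h
    · exact ⟨1, by simp [vert_idem]⟩
    · exact ⟨0, by simp [vert_orth h]⟩
  | ha a => exact ⟨0, by rw [← arr_vert_src, mul_assoc, vert_orth (hl a)]; simp⟩
  | hadd x y hx hy =>
    obtain ⟨c, h⟩ := hx
    obtain ⟨d, h'⟩ := hy
    exact ⟨c + d, by rw [add_mul, h, h', add_smul]⟩
  | hmul x y hx hy =>
    obtain ⟨c, h⟩ := hx
    obtain ⟨d, h'⟩ := hy
    exact ⟨d * c, by rw [mul_assoc, h', mul_smul_comm, h, smul_smul]⟩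

/-- By `vert_mul_eq`, e_i kQ is contained in the sum of k e_i and the images of e_{src a} kQ for the
arrows a into i. Acyclicity makes reachability well-founded on the finite vertex set, so induction
over the predecessors applies. -/
theorem finite [Finite E] (hQ : Q.Acyclic) : Module.Finite k (PathAlg k Q) := by
  classical
  have := Fintype.ofFinite E
  let r : V → V → Prop := Relation.TransGen fun i j => ∃ a, Q.src a = i ∧ Q.tgt a = j
  have : IsTrans V r := inferInstanceAs (IsTrans V (Relation.TransGen _))
  have : Std.Irrefl r := ⟨hQ⟩
  have key : ∀ i, (LinearMap.range (LinearMap.mulLeft k (vert k Q i))).FG := by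
    intro i
    induction i using (Finite.wellFounded_of_trans_of_irrefl r).induction with
    | _ i ih =>
      have h1 : ∀ a, (if Q.tgt a = i then Submodule.map (LinearMap.mulLeft k (arr k Q a))
          (LinearMap.range (LinearMap.mulLeft k (vert k Q (Q.src a)))) else ⊥).FG := by
        intro a
        split_ifs with h
        · exact (ih _ (.single ⟨a, rfl, h⟩)).map _
        · exact Submodule.fg_bot
      have h2 := (Submodule.fg_span_singleton (R := k) (vert k Q i)).sup (Submodule.fg_iSup _ h1)
      refine Submodule.FG.of_le h2 ?_
      rintro _ ⟨x, rfl⟩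
      obtain ⟨c, y, hy, h⟩ := vert_mul_eq i x
      rw [LinearMap.mulLeft_apply, h]
      refine Submodule.add_mem_sup (Submodule.smul_mem _ _ (Submodule.mem_span_singleton_self _))
        (Submodule.sum_mem _ fun a ha => Submodule.mem_iSup_of_mem a ?_)
      rw [if_pos (Finset.mem_filter.1 ha).2]
      exact ⟨y a, ⟨y a, hy a⟩, rfl⟩
  refine ⟨Submodule.FG.of_le (Submodule.fg_iSup _ key) fun x _ => ?_⟩
  rw [← one_mul x, ← vert_sum, Finset.sum_mul]
  exact Submodule.sum_mem _ fun i _ => Submodule.mem_iSup_of_mem i ⟨x, rfl⟩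

end PathAlg

/-! ### The decomposition Λ^ı = kQ ⊕ ε kQ and its consequences. -/

namespace IAlg

variable {k : Type u} [Field k] {V E : Type u} [Fintype V] {Q : IQuiver V E}

theorem coC_val_ofPath (x : PathAlg k Q) : coC k Q (val k Q (ofPath k Q x)) = x := by
  simp [val_ofPath, R2.e, R2.e']

theorem coD_val_ofPath (x : PathAlg k Q) : coD k Q (val k Q (ofPath k Q x)) = 0 := by
  simp [val_ofPath, R2.e, R2.e']

theorem coC_val_eps_mul (x : IAlg k Q) : coC k Q (val k Q (eps k Q * x)) = 0 := by
  rw [map_mul, coC_mul, val_eps]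
  simp [R2.ep, R2.ep']

theorem coD_val_eps_mul (x : IAlg k Q) :
    coD k Q (val k Q (eps k Q * x)) = coC k Q (val k Q x) := by
  rw [map_mul, coD_mul, val_eps]
  simp [R2.ep, R2.ep']

/-- The ε'-coefficient d appears through its link with τ♯: for a fixed point this link says that d
is τ of the ε-coefficient. -/
theorem tmul_expand (x : DoubleAlg k Q) : ∃ d : PathAlg k Q,
    x = coC k Q x ⊗ₜ R2.e k + coC' k Q x ⊗ₜ R2.e' k + coD k Q x ⊗ₜ R2.ep k + d ⊗ₜ R2.ep' k ∧
      coD k Q (tauSharp k Q x) = PathAlg.tau k Q d := by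
  induction x using TensorProduct.induction_on with
  | zero => exact ⟨0, by simp⟩
  | tmul p r =>
    refine ⟨r.d' • p, ?_, ?_⟩
    · have : r = r.c • R2.e k + r.c' • R2.e' k + r.d • R2.ep k + r.d' • R2.ep' k := by
        ext <;> simp [R2.e, R2.e', R2.ep, R2.ep']
      conv_lhs => rw [this]
      simp only [TensorProduct.tmul_add, coC_tmul, coC'_tmul, coD_tmul, TensorProduct.smul_tmul]
    · have : (R2.swap k r).d = r.d' := rfl
      simp [tauSharp, this]
  | add x y hx hy =>
    obtain ⟨d, h1, h2⟩ := hx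
    obtain ⟨d', h3, h4⟩ := hy
    refine ⟨d + d', ?_, by simp [h2, h4]⟩
    conv_lhs => rw [h1, h3]
    simp only [map_add, TensorProduct.add_tmul]
    abel

/-- For a fixed point of τ♯ the coefficients of e_1' and ε' are the τ-images of those of e_1 and ε,
so the latter two determine it. -/
theorem eq_ofPath_add (x : IAlg k Q) :
    x = ofPath k Q (coC k Q (val k Q x)) + eps k Q * ofPath k Q (coD k Q (val k Q x)) := by
  apply val_injective
  obtain ⟨d, h, h'⟩ := tmul_expand (val k Q x)
  have h1 : R2.ep k * R2.e k = R2.ep k := by ext <;> simp [R2.ep, R2.e]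
  have h2 : R2.ep' k * R2.e k = 0 := by ext <;> simp [R2.ep', R2.e]
  have h3 : R2.ep k * R2.e' k = 0 := by ext <;> simp [R2.ep, R2.e']
  have h4 : R2.ep' k * R2.e' k = R2.ep' k := by ext <;> simp [R2.ep', R2.e']
  have h5 : d = PathAlg.tau k Q (coD k Q (val k Q x)) := by
    rw [← tauSharp_val, h', PathAlg.tau_tau]
  rw [map_add, map_mul, val_ofPath, val_ofPath, val_eps, ← coC'_coe, ← h5]
  conv_lhs => rw [h]
  simp [mul_add, add_mul, h1, h2, h3, h4]
  abel

theorem ext_coeff {x y : IAlg k Q} (h : coC k Q (val k Q x) = coC k Q (val k Q y))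
    (h' : coD k Q (val k Q x) = coD k Q (val k Q y)) : x = y := by
  rw [eq_ofPath_add x, eq_ofPath_add y, h, h']

theorem coC_val_ofPath_mul (p : PathAlg k Q) (x : IAlg k Q) :
    coC k Q (val k Q (ofPath k Q p * x)) = p * coC k Q (val k Q x) := by
  rw [map_mul, coC_mul, coC_val_ofPath]

theorem coD_val_ofPath_mul (p : PathAlg k Q) (x : IAlg k Q) :
    coD k Q (val k Q (ofPath k Q p * x)) = PathAlg.tau k Q p * coD k Q (val k Q x) := by
  rw [map_mul, coD_mul, coC'_coe, coC_val_ofPath, coD_val_ofPath, zero_mul, add_zero]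

theorem induction {P : IAlg k Q → Prop} (hk : ∀ c : k, P (algebraMap k _ c))
    (hv : ∀ i, P (vert k Q i)) (ha : ∀ a, P (arr k Q a)) (he : P (eps k Q))
    (hadd : ∀ x y, P x → P y → P (x + y)) (hmul : ∀ x y, P x → P y → P (x * y))
    (x : IAlg k Q) : P x := by
  have h : ∀ p, P (ofPath k Q p) := fun p => by
    induction p using PathAlg.induction with
    | hk c => rw [AlgHom.commutes]; exact hk c
    | hv i => exact hv i
    | ha a => exact ha a
    | hadd x y hx hy => rw [map_add]; exact hadd _ _ hx hy
    | hmul x y hx hy => rw [map_mul]; exact hmul _ _ hx hy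
  rw [eq_ofPath_add x]
  exact hadd _ _ (h _) (hmul _ _ he (h _))

/-- Both coefficients reduce to the case of kQ. Moving an arrow past ε twists it by τ, so for the
ε-coefficients the sum is reindexed along `tauE`. -/
theorem eq_zero_of_sum_arr_mul {s : Finset E} {y : E → IAlg k Q}
    (hy : ∀ a ∈ s, vert k Q (Q.src a) * y a = y a) (h : ∑ a ∈ s, arr k Q a * y a = 0) :
    ∀ a ∈ s, y a = 0 := by
  classical
  have h1 := congrArg (fun x => coC k Q (val k Q x)) h
  have h2 := congrArg (fun x => coD k Q (val k Q x)) h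
  simp only [map_sum, arr, coC_val_ofPath_mul, coD_val_ofPath_mul, PathAlg.tau_arr, map_zero]
    at h1 h2
  have h3 : ∑ b ∈ s.image Q.tauE, PathAlg.arr k Q b * coD k Q (val k Q (y (Q.tauE b))) = 0 := by
    rw [Finset.sum_image fun a _ b _ hab => by rw [← Q.tauE_tauE a, hab, Q.tauE_tauE], ← h2]
    simp only [Q.tauE_tauE]
  intro a ha
  refine ext_coeff ?_ ?_ <;> simp only [map_zero]
  · refine PathAlg.eq_zero_of_sum_arr_mul (fun b hb => ?_) h1 a ha
    conv_rhs => rw [← hy b hb, vert, coC_val_ofPath_mul]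
  · have := PathAlg.eq_zero_of_sum_arr_mul (fun b hb => ?_) h3 (Q.tauE a)
      (Finset.mem_image_of_mem _ ha)
    · rwa [Q.tauE_tauE] at this
    · obtain ⟨c, hc, rfl⟩ := Finset.mem_image.1 hb
      rw [Q.tauE_tauE, Q.src_tauE]
      conv_rhs => rw [← hy c hc, vert, coD_val_ofPath_mul, PathAlg.tau_vert]

theorem eq_zero_of_arr_mul {a : E} {x : IAlg k Q} (hx : vert k Q (Q.src a) * x = x)
    (h : arr k Q a * x = 0) : x = 0 :=
  eq_zero_of_sum_arr_mul (s := {a}) (y := fun _ => x) (by simpa using hx) (by simpa using h) a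
    (by simp)

/-- As e_i ε = ε e_{τi}, the ε-coefficient is expanded at τi and its arrows are carried back to
arrows ending in i by moving them past ε. -/
theorem vert_mul_eq [Fintype E] [DecidableEq V] (i : V) (x : IAlg k Q) :
    ∃ (c d : k) (y : E → IAlg k Q), (∀ a, vert k Q (Q.src a) * y a = y a) ∧
      vert k Q i * x = c • vert k Q i + d • (vert k Q i * eps k Q) +
        ∑ a with Q.tgt a = i, arr k Q a * y a := by
  obtain ⟨c, p, hp, h1⟩ := PathAlg.vert_mul_eq i (coC k Q (val k Q x))
  obtain ⟨d, q, hq, h2⟩ := PathAlg.vert_mul_eq (Q.tauV i) (coD k Q (val k Q x))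
  refine ⟨c, d, fun a => ofPath k Q (p a) + eps k Q * ofPath k Q (q (Q.tauE a)), fun a => ?_, ?_⟩
  · dsimp only
    conv_rhs => rw [← hp a, ← hq (Q.tauE a)]
    rw [mul_add, ← mul_assoc, Q.src_tauE, map_mul, map_mul]
    conv_rhs => rw [← mul_assoc, eps_mul_ofPath, PathAlg.tau_vert, Q.tauV_tauV]
    rfl
  · have h3 : vert k Q i * eps k Q = eps k Q * vert k Q (Q.tauV i) := by
      rw [eps_mul_vert, Q.tauV_tauV]
    have h4 : ∑ a with Q.tgt a = Q.tauV i, eps k Q * (arr k Q a * ofPath k Q (q a)) =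
        ∑ a with Q.tgt a = i, arr k Q a * (eps k Q * ofPath k Q (q (Q.tauE a))) := by
      refine Finset.sum_nbij' Q.tauE Q.tauE ?_ ?_ ?_ ?_ ?_
      · intro a ha
        simp only [Finset.mem_filter, Finset.mem_univ, true_and] at ha ⊢
        rw [Q.tgt_tauE, ha, Q.tauV_tauV]
      · intro a ha
        simp only [Finset.mem_filter, Finset.mem_univ, true_and] at ha ⊢
        rw [Q.tgt_tauE, ha]
      · intro a _; exact Q.tauE_tauE a
      · intro a _; exact Q.tauE_tauE a
      · intro a _
        rw [← mul_assoc, eps_mul_arr, mul_assoc, Q.tauE_tauE]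
    conv_lhs => rw [eq_ofPath_add x, mul_add, ← mul_assoc, h3, mul_assoc, vert, vert, ← map_mul,
      ← map_mul, h1, h2]
    simp only [map_add, map_smul, map_sum, map_mul, mul_add, Finset.mul_sum,
      Finset.sum_add_distrib, mul_smul_comm]
    rw [h3, ← h4]
    simp only [vert, arr]
    abel

theorem mul_vert_of_isSink {l : V} (hl : Q.IsSink l) (x : IAlg k Q) :
    ∃ c d : k, x * vert k Q l = c • vert k Q l + d • (eps k Q * vert k Q l) := by
  obtain ⟨c, h1⟩ := PathAlg.mul_vert_of_isSink hl (coC k Q (val k Q x))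
  obtain ⟨d, h2⟩ := PathAlg.mul_vert_of_isSink hl (coD k Q (val k Q x))
  refine ⟨c, d, ?_⟩
  conv_lhs => rw [eq_ofPath_add x, add_mul, vert, mul_assoc, ← map_mul, ← map_mul, h1, h2]
  rw [map_smul, map_smul, mul_smul_comm, vert]

theorem finite [Finite E] (hQ : Q.Acyclic) : Module.Finite k (IAlg k Q) := by
  have := PathAlg.finite (k := k) hQ
  let f : PathAlg k Q × PathAlg k Q →ₗ[k] IAlg k Q :=
    (ofPath k Q).toLinearMap.coprod
      (LinearMap.mulLeft k (eps k Q) ∘ₗ (ofPath k Q).toLinearMap)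
  exact Module.Finite.of_surjective f fun x => ⟨(_, _), (eq_ofPath_add x).symm⟩

end IAlg

/-! ### Idempotents attached to the orbit of l, uniform in τl = l and τl ≠ l. -/

namespace IAlg

variable {k : Type u} [Field k] {V E : Type u} [Fintype V] [DecidableEq V] {Q : IQuiver V E}

variable (k) (Q) in
/-- The idempotent `e_l + e_{τ l}` (which is `e_l` if `τ l = l`). -/
def orb (l : V) : IAlg k Q := ∑ r with Q.InOrbit l r, vert k Q r

variable (k) (Q) in
/-- The idempotent at the source of `a` if `a` ends in the orbit of `l`, and zero otherwise. -/
def gate (l : V) (a : E) : IAlg k Q := if Q.InOrbit l (Q.tgt a) then vert k Q (Q.src a) else 0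

theorem vert_mul_orb (l r : V) :
    vert k Q r * orb k Q l = if Q.InOrbit l r then vert k Q r else 0 := by
  have : ∀ s, vert k Q r * vert k Q s = if r = s then vert k Q r else 0 := fun s => by
    split_ifs with h
    · rw [← h, vert_mul_vert]
    · exact vert_mul_vert_of_ne h
  simp [orb, Finset.mul_sum, this]

theorem orb_mul_vert (l r : V) :
    orb k Q l * vert k Q r = if Q.InOrbit l r then vert k Q r else 0 := by
  have : ∀ s, vert k Q s * vert k Q r = if s = r then vert k Q r else 0 := fun s => by
    split_ifs with h
    · rw [← h, vert_mul_vert]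
    · exact vert_mul_vert_of_ne h
  simp [orb, Finset.sum_mul, this]

theorem orb_mul_orb (l : V) : orb k Q l * orb k Q l = orb k Q l := by
  conv_lhs => enter [1]; rw [orb]
  rw [Finset.sum_mul, orb]
  refine Finset.sum_congr rfl fun r hr => ?_
  rw [← orb, vert_mul_orb, if_pos (Finset.mem_filter.1 hr).2]

theorem orb_mul_arr (l : V) (a : E) :
    orb k Q l * arr k Q a = if Q.InOrbit l (Q.tgt a) then arr k Q a else 0 := by
  rw [← vert_tgt_mul_arr, ← mul_assoc, orb_mul_vert]
  split_ifs <;> simp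

theorem arr_mul_gate (l : V) (a : E) : arr k Q a * gate k Q l a = orb k Q l * arr k Q a := by
  rw [orb_mul_arr, gate]
  split_ifs
  · exact arr_mul_vert_src k Q a
  · exact mul_zero _

theorem gate_mul_gate (l : V) (a : E) : gate k Q l a * gate k Q l a = gate k Q l a := by
  rw [gate]
  split_ifs
  · exact vert_mul_vert _
  · exact mul_zero _

theorem orb_mul_gate {l : V} (hl : Q.IsSink l) (a : E) : orb k Q l * gate k Q l a = 0 := by
  rw [gate]
  split_ifs
  · rw [orb_mul_vert, if_neg (hl.not_inOrbit a)]
  · exact mul_zero _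

theorem eps_mul_orb (l : V) : eps k Q * orb k Q l = orb k Q l * eps k Q := by
  rw [orb, Finset.mul_sum, Finset.sum_mul]
  refine Finset.sum_nbij' Q.tauV Q.tauV ?_ ?_ ?_ ?_ ?_
  · intro r hr
    simpa [Q.inOrbit_tau] using hr
  · intro r hr
    simpa [Q.inOrbit_tau] using hr
  · intro r _; exact Q.tauV_tauV r
  · intro r _; exact Q.tauV_tauV r
  · intro r _; exact eps_mul_vert k Q r

end IAlg

/-! ### Elements of F_l⁺ L as families, and universal families. -/

section Family

open IAlg

variable {k : Type u} [Field k] {V E : Type u} [Fintype V] [DecidableEq V] [Fintype E]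
  (Q : IQuiver V E) (l : V)

/-- A pair consisting of an element `x` of `L` with zero components at `l` and `τ l` and a family
`y_a ∈ e_{src a} L`, indexed by the arrows ending in `l` or `τ l`, with `∑ a y_a = 0`. -/
structure IsReflFamily {L : Type u} [AddCommGroup L] [Module (IAlg k Q) L] (p : L × (E → L)) :
    Prop where
  orb_smul : orb k Q l • p.1 = 0
  gate_smul : ∀ a, gate k Q l a • p.2 a = p.2 a
  sum_eq_zero : ∑ a, arr k Q a • p.2 a = 0

variable {Q} {l}

/-- The conditions vertex by vertex are equivalent to three identities with idempotents: multiplying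
the single relation ∑ a y_a = 0 by e_r isolates the arrows ending in r. -/
theorem isReflFamily_iff {L : Type u} [AddCommGroup L] [Module (IAlg k Q) L] {p : L × (E → L)} :
    (∀ r, Q.InOrbit l r → vert k Q r • p.1 = 0) ∧
    (∀ a, Q.InOrbit l (Q.tgt a) → vert k Q (Q.src a) • p.2 a = p.2 a) ∧
    (∀ a, ¬ Q.InOrbit l (Q.tgt a) → p.2 a = 0) ∧
    (∀ r, Q.InOrbit l r → ∑ a with Q.tgt a = r, arr k Q a • p.2 a = 0) ↔
      IsReflFamily (k := k) Q l p := by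
  constructor
  · rintro ⟨h1, h2, h3, h4⟩
    refine ⟨?_, fun a => ?_, ?_⟩
    · rw [orb, Finset.sum_smul]
      exact Finset.sum_eq_zero fun r hr => h1 r (Finset.mem_filter.1 hr).2
    · rw [gate]
      split_ifs with h
      · exact h2 a h
      · rw [h3 a h, smul_zero]
    · rw [← Finset.sum_fiberwise (g := Q.tgt)]
      refine Finset.sum_eq_zero fun r _ => ?_
      by_cases h : Q.InOrbit l r
      · exact h4 r h
      · refine Finset.sum_eq_zero fun a ha => ?_
        rw [h3 a (by rwa [(Finset.mem_filter.1 ha).2]), smul_zero]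
  · rintro ⟨h1, h2, h3⟩
    refine ⟨fun r hr => ?_, fun a ha => ?_, fun a ha => ?_, fun r _ => ?_⟩
    · have := vert_mul_orb (k := k) (Q := Q) l r
      rw [if_pos hr] at this
      rw [← this, mul_smul, h1, smul_zero]
    · simpa [gate, ha] using h2 a
    · simpa [gate, ha] using (h2 a).symm
    · have := congrArg (vert k Q r • ·) h3
      simp only [Finset.smul_sum, smul_smul, smul_zero] at this
      rw [← this, Finset.sum_filter]
      refine Finset.sum_congr rfl fun a _ => ?_
      split_ifs with h
      · rw [← h, vert_tgt_mul_arr]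
      · rw [← vert_tgt_mul_arr, ← mul_assoc, vert_mul_vert_of_ne (Ne.symm h), zero_mul, zero_smul]

theorem mem_reflSubmodule_iff {L : Type u} [AddCommGroup L] [Module k L] [Module (IAlg k Q) L]
    [IsScalarTower k (IAlg k Q) L] {p : L × (E → L)} :
    p ∈ reflSubmodule (k := k) Q l L ↔ IsReflFamily (k := k) Q l p :=
  (mem_reflSubmodule Q).trans isReflFamily_iff

namespace IsReflFamily

variable {L L' : Type u} [AddCommGroup L] [Module (IAlg k Q) L] [AddCommGroup L']
  [Module (IAlg k Q) L'] {p : L × (E → L)}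

theorem map (hp : IsReflFamily (k := k) Q l p) (g : L →ₗ[IAlg k Q] L') :
    IsReflFamily (k := k) Q l (g p.1, fun a => g (p.2 a)) where
  orb_smul := by rw [← map_smul, hp.orb_smul, map_zero]
  gate_smul a := by rw [← map_smul, hp.gate_smul]
  sum_eq_zero := by simp only [← map_smul, ← map_sum, hp.sum_eq_zero, map_zero]

theorem eq_zero (hp : IsReflFamily (k := k) Q l p) {a : E} (ha : ¬ Q.InOrbit l (Q.tgt a)) :
    p.2 a = 0 := by
  rw [← hp.gate_smul a, gate, if_neg ha, zero_smul]

theorem one_sub_orb_smul (hp : IsReflFamily (k := k) Q l p) : (1 - orb k Q l) • p.1 = p.1 := by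
  rw [sub_smul, one_smul, hp.orb_smul, sub_zero]

end IsReflFamily

variable (Q) (l) in
/-- A family as in `IsReflFamily` which is universal: it generates its module, and every other
family is the image of it under a homomorphism. -/
structure IsGenericFamily {T : Type u} [AddCommGroup T] [Module (IAlg k Q) T] (u : T × (E → T)) :
    Prop where
  isReflFamily : IsReflFamily (k := k) Q l u
  span_eq_top : Submodule.span (IAlg k Q) (insert u.1 (Set.range u.2)) = ⊤
  exists_lift : ∀ {L : Type u} [AddCommGroup L] [Module (IAlg k Q) L] (p : L × (E → L)),
    IsReflFamily (k := k) Q l p → ∃ g : T →ₗ[IAlg k Q] L, g u.1 = p.1 ∧ ∀ a, g (u.2 a) = p.2 a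

namespace IsGenericFamily

variable {T L : Type u} [AddCommGroup T] [Module (IAlg k Q) T] [AddCommGroup L]
  [Module (IAlg k Q) L] {u : T × (E → T)}

theorem hom_ext (hu : IsGenericFamily (k := k) Q l u) {g h : T →ₗ[IAlg k Q] L}
    (h1 : g u.1 = h u.1) (h2 : ∀ a, g (u.2 a) = h (u.2 a)) : g = h := by
  refine LinearMap.ext_on hu.span_eq_top ?_
  rintro _ (rfl | ⟨a, rfl⟩)
  exacts [h1, h2 a]

theorem map_equiv (hu : IsGenericFamily (k := k) Q l u) (e : T ≃ₗ[IAlg k Q] L) :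
    IsGenericFamily (k := k) Q l (e u.1, fun a => e (u.2 a)) where
  isReflFamily := hu.isReflFamily.map e.toLinearMap
  span_eq_top := by
    have := congrArg (Submodule.map e.toLinearMap) hu.span_eq_top
    rw [Submodule.map_span, Submodule.map_top, LinearEquiv.range, Set.image_insert_eq,
      ← Set.range_comp] at this
    exact this
  exists_lift p hp := by
    obtain ⟨g, h1, h2⟩ := hu.exists_lift p hp
    exact ⟨g ∘ₗ e.symm.toLinearMap, by simp [h1], by simp [h2]⟩

/-- `e_r T = ∑ a T` for `r ∈ {l, τ l}`, the sum over the arrows ending in `r`. -/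
theorem exists_orb_smul_eq (hl : Q.IsSink l) (hu : IsGenericFamily (k := k) Q l u) (t : T) :
    ∃ z : E → T, orb k Q l • t = ∑ a, orb k Q l • arr k Q a • z a := by
  -- The set of t with this property is stable under the algebra, checked on generators; it then
  -- suffices that it contains the entries of u.
  have key : ∀ x : IAlg k Q, ∀ t : T,
      (∃ z : E → T, orb k Q l • t = ∑ a, orb k Q l • arr k Q a • z a) →
      ∃ z : E → T, orb k Q l • x • t = ∑ a, orb k Q l • arr k Q a • z a := by
    intro x
    induction x using IAlg.induction with
    | hk c =>
      rintro t ⟨z, hz⟩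
      refine ⟨fun a => algebraMap k (IAlg k Q) c • z a, ?_⟩
      rw [smul_smul, ← Algebra.commutes, mul_smul, hz, Finset.smul_sum]
      refine Finset.sum_congr rfl fun a _ => ?_
      simp only [smul_smul]
      rw [← mul_assoc, Algebra.commutes, mul_assoc, Algebra.commutes c (arr k Q a)]
    | hv r =>
      rintro t ⟨z, hz⟩
      rw [smul_smul, orb_mul_vert]
      split_ifs with hr
      · have h1 := vert_mul_orb (k := k) (Q := Q) l r
        rw [if_pos hr] at h1
        rw [← h1, mul_smul, hz]
        classical
        refine ⟨fun a => if Q.tgt a = r then z a else 0, ?_⟩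
        rw [Finset.smul_sum]
        refine Finset.sum_congr rfl fun a _ => ?_
        rw [smul_smul, h1, ← vert_tgt_mul_arr, smul_smul, ← mul_assoc]
        dsimp only
        split_ifs with ha
        · rw [ha, vert_mul_vert, mul_smul, smul_smul (orb k Q l), orb_mul_vert, if_pos hr]
        · rw [vert_mul_vert_of_ne (Ne.symm ha), zero_mul, zero_smul, smul_zero, smul_zero]
      · exact ⟨0, by simp⟩
    | ha b =>
      classical
      -- No hypothesis on t is needed for an arrow: e b t is already a one-term sum of the required
      -- shape.
      rintro t -
      refine ⟨Pi.single b t, ?_⟩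
      rw [Finset.sum_eq_single b]
      · simp
      · intro a _ hab; simp [hab]
      · simp
    | he =>
      rintro t ⟨z, hz⟩
      refine ⟨fun a => eps k Q • z (Q.tauE a), ?_⟩
      rw [smul_smul, ← eps_mul_orb, mul_smul, hz, Finset.smul_sum]
      refine Finset.sum_nbij' Q.tauE Q.tauE (by simp) (by simp) (fun a _ => Q.tauE_tauE a)
        (fun a _ => Q.tauE_tauE a) fun a _ => ?_
      simp only [Q.tauE_tauE, smul_smul]
      rw [← mul_assoc, eps_mul_orb, mul_assoc, eps_mul_arr]
    | hadd x y hx hy =>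
      intro t ht
      obtain ⟨z, hz⟩ := hx t ht
      obtain ⟨w, hw⟩ := hy t ht
      refine ⟨z + w, ?_⟩
      rw [add_smul, smul_add, hz, hw, ← Finset.sum_add_distrib]
      simp only [Pi.add_apply, smul_add]
    | hmul x y hx hy =>
      intro t ht
      rw [mul_smul]
      exact hx _ (hy _ ht)
  have ht : t ∈ Submodule.span (IAlg k Q) (insert u.1 (Set.range u.2)) := by
    rw [hu.span_eq_top]; trivial
  induction ht using Submodule.span_induction with
  | mem x hx =>
    refine ⟨0, ?_⟩
    obtain rfl | ⟨a, rfl⟩ := hx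
    · simpa using hu.isReflFamily.orb_smul
    -- The entries u_a sit at sources of arrows, which are outside the orbit of the sink, so e
    -- annihilates them.
    · rw [← hu.isReflFamily.gate_smul a, smul_smul, orb_mul_gate hl]; simp
  | zero => exact ⟨0, by simp⟩
  | add x y _ _ hx hy =>
    obtain ⟨z, hz⟩ := hx
    obtain ⟨w, hw⟩ := hy
    refine ⟨z + w, ?_⟩
    rw [smul_add, hz, hw, ← Finset.sum_add_distrib]
    simp only [Pi.add_apply, smul_add]
  | smul x t _ ht => exact key x t ht

end IsGenericFamily

end Family

/-! ### Projective dimension and Ext¹ from a two-term projective resolution. -/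

section Resolution

variable {A : Type u} [Ring A] {K P : Type u} [AddCommGroup K] [Module A K] [AddCommGroup P]
  [Module A P]

theorem hasProjectiveDimensionLE_one_of_exact [Module.Projective A K] [Module.Projective A P]
    {T : ModuleCat.{u} A} (i : K →ₗ[A] P) (p : P →ₗ[A] T) (hi : Function.Injective i)
    (hip : Function.Exact i p) (hp : Function.Surjective p) : HasProjectiveDimensionLE T 1 := by
  have hS := ModuleCat.shortComplex_shortExact
    (ModuleCat.shortComplexOfCompEqZero i p hip.linearMap_comp_eq_zero) hip hi hp
  have h1 : Projective (ModuleCat.of A K) :=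
    (ModuleCat.of A K).projective_of_categoryTheory_projective
  have h2 : Projective (ModuleCat.of A P) :=
    (ModuleCat.of A P).projective_of_categoryTheory_projective
  exact (hS.hasProjectiveDimensionLT_X₃_iff 0 h2).2
    (inferInstanceAs (HasProjectiveDimensionLT (ModuleCat.of A K) 1))

/-- As Ext¹(P, X) = 0, every class in Ext¹(T, X) is the connecting image of some K → X, and this
image vanishes when the map extends to P. -/
theorem subsingleton_ext_one_of_exact [Module.Projective A P] {T X : ModuleCat.{u} A}
    (i : K →ₗ[A] P) (p : P →ₗ[A] T) (hi : Function.Injective i)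
    (hip : Function.Exact i p) (hp : Function.Surjective p)
    (h : ∀ f : K →ₗ[A] X, ∃ g : P →ₗ[A] X, g ∘ₗ i = f) :
    Subsingleton (Abelian.Ext.{u} T X 1) := by
  have hS := ModuleCat.shortComplex_shortExact
    (ModuleCat.shortComplexOfCompEqZero i p hip.linearMap_comp_eq_zero) hip hi hp
  have h2 : Projective (ModuleCat.of A P) :=
    (ModuleCat.of A P).projective_of_categoryTheory_projective
  refine subsingleton_of_forall_eq 0 fun x => ?_
  obtain ⟨y, rfl⟩ := Abelian.Ext.contravariant_sequence_exact₃ hS X x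
    (Abelian.Ext.eq_zero_of_projective _) (add_zero 1)
  obtain ⟨f, rfl⟩ := Abelian.Ext.homEquiv₀.symm.surjective y
  obtain ⟨g, hg⟩ := h f.hom
  have hf : f = ModuleCat.ofHom i ≫ ModuleCat.ofHom g := by
    ext x
    exact (LinearMap.congr_fun hg x).symm
  rw [Abelian.Ext.homEquiv₀_symm_apply, hf, ← Abelian.Ext.mk₀_comp_mk₀]
  exact hS.extClass_comp_assoc _

end Resolution

theorem InAdd.of_linearMap {A : Type u} [Ring A] {T X : Type u} [AddCommGroup T] [Module A T]
    [AddCommGroup X] [Module A X] {ι : Type*} [Finite ι] (i : X →ₗ[A] (ι → T))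
    (r : (ι → T) →ₗ[A] X) (h : ∀ x, r (i x) = x) : InAdd (A := A) T X := by
  obtain ⟨n, ⟨e⟩⟩ := Finite.exists_equiv_fin ι
  let e' : (ι → T) ≃ₗ[A] (Fin n → T) := LinearEquiv.funCongrLeft A T e.symm
  exact ⟨n, e'.toLinearMap ∘ₗ i, r ∘ₗ e'.symm.toLinearMap, LinearMap.ext fun x => by simp [h]⟩

/-! ### Tilting property of a module with a universal family. -/

section Tilting

open IAlg

variable {k : Type u} [Field k] {V E : Type u} [Fintype V] [DecidableEq V]

variable (k) in
/-- The projective module `⨁ Λ^ı e_i ⊕ ⨁ Λ^ı e_{src a}`, where `i` runs through the vertices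
outside of the orbit of `l`, and `a` through the arrows ending in the orbit of `l`. -/
def familyProj (Q : IQuiver V E) (l : V) : Submodule (IAlg k Q) (IAlg k Q × (E → IAlg k Q)) where
  carrier := {p | p.1 * orb k Q l = 0 ∧ ∀ a, p.2 a * gate k Q l a = p.2 a}
  zero_mem' := by simp
  add_mem' {p q} hp hq :=
    ⟨by simp [add_mul, hp.1, hq.1], fun a => by simp [add_mul, hp.2 a, hq.2 a]⟩
  smul_mem' c p hp := ⟨by simp [mul_assoc, hp.1], fun a => by simp [mul_assoc, hp.2 a]⟩

variable (k) in
/-- The projective module `⨁ Λ^ı e_r`, where `r` runs through the orbit of `l`. -/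
def orbProj (Q : IQuiver V E) (l : V) : Submodule (IAlg k Q) (IAlg k Q) where
  carrier := {x | x * orb k Q l = x}
  zero_mem' := by simp
  add_mem' {p q} hp hq := by
    rw [Set.mem_ofPred_eq] at *
    rw [add_mul, hp, hq]
  smul_mem' c p hp := by
    rw [Set.mem_ofPred_eq] at *
    rw [smul_eq_mul, mul_assoc, hp]

variable {Q : IQuiver V E} {l : V}

/-- The projection onto `familyProj`. -/
def toFamilyProj : IAlg k Q × (E → IAlg k Q) →ₗ[IAlg k Q] familyProj k Q l where
  toFun p := ⟨(p.1 * (1 - orb k Q l), fun a => p.2 a * gate k Q l a), by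
    simp [mul_sub, sub_mul, mul_assoc, orb_mul_orb], fun a => by
    simp [mul_assoc, gate_mul_gate]⟩
  map_add' p q := Subtype.ext (Prod.ext (add_mul _ _ _) (funext fun a => add_mul _ _ _))
  map_smul' c p := Subtype.ext (Prod.ext (mul_assoc _ _ _) (funext fun a => mul_assoc _ _ _))

theorem toFamilyProj_coe (p : familyProj k Q l) : toFamilyProj p.1 = p :=
  Subtype.ext (Prod.ext (by simp [toFamilyProj, mul_sub, p.2.1]) (funext p.2.2))

instance [Finite E] : Module.Projective (IAlg k Q) (familyProj k Q l) :=
  .of_split (familyProj k Q l).subtype toFamilyProj (LinearMap.ext toFamilyProj_coe)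

/-- The projection onto `orbProj`. -/
def toOrbProj : IAlg k Q →ₗ[IAlg k Q] orbProj k Q l where
  toFun x := ⟨x * orb k Q l, by
    change _ * _ * _ = _
    rw [mul_assoc, orb_mul_orb]⟩
  map_add' p q := Subtype.ext (add_mul _ _ _)
  map_smul' c p := Subtype.ext (mul_assoc _ _ _)

theorem toOrbProj_coe (p : orbProj k Q l) : toOrbProj p.1 = p := Subtype.ext p.2

instance : Module.Projective (IAlg k Q) (orbProj k Q l) :=
  .of_split (orbProj k Q l).subtype toOrbProj (LinearMap.ext toOrbProj_coe)

/-- The map `x ↦ (0, (x a)_a)`. -/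
def orbToFamily : orbProj k Q l →ₗ[IAlg k Q] familyProj k Q l where
  toFun x := ⟨(0, fun a => x.1 * arr k Q a), zero_mul _, fun a => by
    dsimp only
    rw [mul_assoc, arr_mul_gate, ← mul_assoc, show x.1 * orb k Q l = x.1 from x.2]⟩
  map_add' p q := Subtype.ext (Prod.ext (zero_add _).symm (funext fun a => add_mul _ _ _))
  map_smul' c p := Subtype.ext (Prod.ext (mul_zero _).symm (funext fun a => mul_assoc _ _ _))

/-- At a sink r one has x e_r = c e_r + d ε e_r. For an arrow a into r this gives x a = c a + d ε a,
whose two coefficients are c a and d a with a ≠ 0. Every vertex of the orbit receives an arrow, by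
applying τ if necessary. -/
theorem eq_zero_of_mul_arr {l : V} (hl : Q.IsSink l) (hne : ∃ a, Q.tgt a = l) {x : IAlg k Q}
    (hx : x * orb k Q l = x) (h : ∀ a, x * arr k Q a = 0) : x = 0 := by
  have key : ∀ r : V, Q.IsSink r → (∃ a, Q.tgt a = r) → x * vert k Q r = 0 := by
    rintro r hr ⟨a, rfl⟩
    obtain ⟨c, d, hcd⟩ := mul_vert_of_isSink hr x
    have h1 := congrArg (· * arr k Q a) hcd
    simp only [mul_assoc, vert_tgt_mul_arr, h, add_mul, smul_mul_assoc] at h1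
    have h2 := congrArg (fun x => coC k Q (val k Q x)) h1
    have h3 := congrArg (fun x => coD k Q (val k Q x)) h1
    simp only [map_zero, map_add, map_smul, coC_val_eps_mul, coD_val_eps_mul] at h2 h3
    simp only [arr, coC_val_ofPath, coD_val_ofPath, smul_zero, add_zero, zero_add] at h2 h3
    have hc := (smul_eq_zero.1 h2.symm).resolve_right (PathAlg.arr_ne_zero a)
    have hd := (smul_eq_zero.1 h3.symm).resolve_right (PathAlg.arr_ne_zero a)
    rw [hcd, hc, hd, zero_smul, zero_smul, add_zero]
  rw [← hx, orb, Finset.mul_sum]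
  refine Finset.sum_eq_zero fun r hr => key r ?_ ?_
  · rintro a rfl
    exact hl.not_inOrbit a (Finset.mem_filter.1 hr).2
  · obtain ⟨a, ha⟩ := hne
    obtain rfl | rfl := (Finset.mem_filter.1 hr).2
    · exact ⟨a, ha⟩
    · exact ⟨Q.tauE a, by rw [Q.tgt_tauE, ha]⟩

theorem orbToFamily_injective (hl : Q.IsSink l) (hne : ∃ a, Q.tgt a = l) :
    Function.Injective (orbToFamily (k := k) (Q := Q) (l := l)) := by
  rw [injective_iff_map_eq_zero]
  intro x hx
  exact Subtype.ext (eq_zero_of_mul_arr hl hne x.2 fun a =>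
    congrFun (congrArg (fun y : familyProj k Q l => y.1.2) hx) a)

variable [Fintype E]

theorem linearMap_pi_apply {A : Type*} [Ring A] {L : Type*} [AddCommGroup L] [Module A L]
    [DecidableEq E] (g : A × (E → A) →ₗ[A] L) (p : A × (E → A)) :
    g p = p.1 • g (1, 0) + ∑ a, p.2 a • g (0, Pi.single a 1) := by
  simp only [← map_smul, ← map_sum, ← map_add]
  congr 1
  refine Prod.ext (by simp [Prod.fst_sum]) (funext fun b => ?_)
  simp [Prod.snd_sum, Finset.sum_apply, Pi.single_apply]

namespace IsGenericFamily

variable {T : Type u} [AddCommGroup T] [Module (IAlg k Q) T] {u : T × (E → T)}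

variable (u) in
/-- The map `(x, y) ↦ x u + ∑ y_a u_a`. -/
def evalFamily : IAlg k Q × (E → IAlg k Q) →ₗ[IAlg k Q] T where
  toFun p := p.1 • u.1 + ∑ a, p.2 a • u.2 a
  map_add' p q := by
    simp only [Prod.fst_add, Prod.snd_add, Pi.add_apply, add_smul, Finset.sum_add_distrib]
    abel
  map_smul' c p := by simp [mul_smul, Finset.smul_sum]

variable (u) in
/-- The restriction of `evalFamily` to `familyProj`. -/
def proj : familyProj k Q l →ₗ[IAlg k Q] T := evalFamily u ∘ₗ (familyProj k Q l).subtype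

theorem proj_toFamilyProj (hu : IsGenericFamily (k := k) Q l u) (p : IAlg k Q × (E → IAlg k Q)) :
    proj u (toFamilyProj (l := l) p) = evalFamily u p := by
  simp [proj, evalFamily, toFamilyProj, mul_smul, hu.isReflFamily.one_sub_orb_smul,
    hu.isReflFamily.gate_smul]

theorem proj_surjective (hu : IsGenericFamily (k := k) Q l u) :
    Function.Surjective (proj (k := k) (Q := Q) (l := l) u) := by
  classical
  rw [← LinearMap.range_eq_top, eq_top_iff, ← hu.span_eq_top, Submodule.span_le]
  rintro _ (rfl | ⟨a, rfl⟩)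
  · refine ⟨toFamilyProj (1, 0), ?_⟩
    rw [hu.proj_toFamilyProj]
    simp [evalFamily]
  · refine ⟨toFamilyProj (0, Pi.single a 1), ?_⟩
    rw [hu.proj_toFamilyProj]
    simp [evalFamily, Pi.single_apply]

/-- The cokernel of `orbToFamily` carries the tautological family. The universal property gives a
map g from T to it such that g ∘ `evalFamily u` is the quotient map on `familyProj`, so whatever
dies in T already dies in the cokernel. -/
theorem exact (hu : IsGenericFamily (k := k) Q l u) :
    Function.Exact orbToFamily (proj (k := k) (Q := Q) (l := l) u) := by
  classical
  rw [LinearMap.exact_iff]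
  apply le_antisymm
  · let mk := (LinearMap.range (orbToFamily (k := k) (Q := Q) (l := l))).mkQ
    obtain ⟨g, h1, h2⟩ := hu.exists_lift
      (mk (toFamilyProj (1, 0)), fun a => mk (toFamilyProj (0, Pi.single a 1)))
      { orb_smul := by
          rw [← map_smul]
          convert map_zero mk
          refine Subtype.ext (Prod.ext ?_ (funext fun a => ?_))
          · simp [toFamilyProj, mul_sub, orb_mul_orb]
          · simp [toFamilyProj]
        gate_smul := fun a => by
          rw [← map_smul]
          congr 1
          refine Subtype.ext (Prod.ext ?_ (funext fun b => ?_))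
          · simp [toFamilyProj]
          · by_cases h : b = a
            · subst h; simp [toFamilyProj, gate_mul_gate]
            · simp [toFamilyProj, h]
        sum_eq_zero := by
          simp only [← map_smul, ← map_sum]
          -- The relation ∑ a · (class of the a-th unit) is the image of the generator e of Λ^ı e.
          refine (Submodule.Quotient.mk_eq_zero _).2 ⟨⟨orb k Q l, orb_mul_orb l⟩, ?_⟩
          refine Subtype.ext (Prod.ext ?_ (funext fun b => ?_))
          · simp [toFamilyProj, orbToFamily, Prod.fst_sum]
          · simp [toFamilyProj, orbToFamily, Prod.snd_sum, Finset.sum_apply, Pi.single_apply,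
              arr_mul_gate] }
    have hg : g ∘ₗ evalFamily u = mk ∘ₗ toFamilyProj := by
      refine LinearMap.ext fun p => ?_
      rw [linearMap_pi_apply (g ∘ₗ evalFamily u), linearMap_pi_apply (mk ∘ₗ toFamilyProj)]
      simp [evalFamily, Pi.single_apply, h1, h2]
    intro p hp
    have := LinearMap.congr_fun hg p.1
    rw [LinearMap.comp_apply, LinearMap.comp_apply, toFamilyProj_coe,
      show evalFamily u p.1 = 0 from hp, map_zero] at this
    exact (Submodule.Quotient.mk_eq_zero _).1 this.symm
  · rintro _ ⟨x, rfl⟩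
    change (0 : IAlg k Q) • u.1 + ∑ a, (x.1 * arr k Q a) • u.2 a = 0
    simp only [mul_smul, ← Finset.smul_sum, hu.isReflFamily.sum_eq_zero, smul_zero, zero_smul,
      add_zero]

/-- A map f from Λ^ı e is determined by f(e) ∈ e T. Writing f(e) = ∑ e a z_a, the map sending the
a-th generator to z_a extends f. -/
theorem exists_extension (hl : Q.IsSink l) (hu : IsGenericFamily (k := k) Q l u)
    (f : orbProj k Q l →ₗ[IAlg k Q] T) :
    ∃ g : familyProj k Q l →ₗ[IAlg k Q] T, g ∘ₗ orbToFamily = f := by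
  let o : orbProj k Q l := ⟨orb k Q l, orb_mul_orb l⟩
  have ho : ∀ x : orbProj k Q l, x = x.1 • o := fun x => Subtype.ext x.2.symm
  obtain ⟨z, hz⟩ := hu.exists_orb_smul_eq hl (f o)
  refine ⟨evalFamily (0, z) ∘ₗ (familyProj k Q l).subtype, LinearMap.ext fun x => ?_⟩
  rw [ho x, map_smul, map_smul]
  congr 1
  have : f o = orb k Q l • f o := by rw [← map_smul, ← ho o]
  rw [this, hz]
  simp [evalFamily, orbToFamily, o, mul_smul]

/-- T₀ is `familyProj`. The embedding is the identity on the summand Λ^ı(1-e) and `orbToFamily` on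
Λ^ı e, so the cokernel retains the part of T generated by the u_a. -/
theorem coresolution (hl : Q.IsSink l) (hne : ∃ a, Q.tgt a = l)
    (hu : IsGenericFamily (k := k) Q l u) :
    ∃ (T₀ T₁ : ModuleCat.{u} (IAlg k Q)) (f : IAlg k Q →ₗ[IAlg k Q] T₀)
      (g : T₀ →ₗ[IAlg k Q] T₁), InAdd (A := IAlg k Q) T T₀ ∧ InAdd (A := IAlg k Q) T T₁ ∧
      Function.Injective f ∧ Function.Exact f g ∧ Function.Surjective g := by
  classical
  let f : IAlg k Q →ₗ[IAlg k Q] familyProj k Q l :=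
    toFamilyProj ∘ₗ LinearMap.prod LinearMap.id
      (LinearMap.pi fun a => LinearMap.toSpanSingleton (IAlg k Q) _ (arr k Q a))
  have hf1 : ∀ x, (f x).1.1 = x * (1 - orb k Q l) := fun x => rfl
  have hf2 : ∀ x a, (f x).1.2 a = x * orb k Q l * arr k Q a := fun x a => by
    change x * arr k Q a * gate k Q l a = _
    rw [mul_assoc, arr_mul_gate, mul_assoc]
  let T₁ := familyProj k Q l ⧸ LinearMap.range f
  let mk : familyProj k Q l →ₗ[IAlg k Q] T₁ := (LinearMap.range f).mkQ
  refine ⟨ModuleCat.of _ (familyProj k Q l), ModuleCat.of _ T₁, f, mk, ?_, ?_, ?_, ?_, ?_⟩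
  -- This lift exhibits Λ^ı(1-e) as a direct summand of T, generated by u.1. Each Λ^ı e_{src a} is
  -- in turn a summand of Λ^ı(1-e), as src a lies outside the orbit; hence one copy of T per element
  -- of `Option E`.
  · obtain ⟨h, h1, h2⟩ := hu.exists_lift (L := IAlg k Q) (1 - orb k Q l, 0)
      { orb_smul := by simp [mul_sub, orb_mul_orb]
        gate_smul := by simp
        sum_eq_zero := by simp }
    let i : familyProj k Q l →ₗ[IAlg k Q] (Option E → T) :=
      (LinearMap.pi fun o => o.elim
        (LinearMap.toSpanSingleton (IAlg k Q) _ u.1 ∘ₗ LinearMap.fst _ _ _)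
        fun a => LinearMap.toSpanSingleton (IAlg k Q) _ u.1 ∘ₗ LinearMap.proj a ∘ₗ
          LinearMap.snd _ _ _) ∘ₗ (familyProj k Q l).subtype
    let r : (Option E → T) →ₗ[IAlg k Q] familyProj k Q l :=
      toFamilyProj ∘ₗ LinearMap.prod (h ∘ₗ LinearMap.proj none)
        (LinearMap.pi fun a => h ∘ₗ LinearMap.proj (some a))
    refine InAdd.of_linearMap i r fun p => Subtype.ext (Prod.ext ?_ (funext fun a => ?_))
    · change h (p.1.1 • u.1) * (1 - orb k Q l) = p.1.1
      rw [map_smul, h1, smul_eq_mul, mul_assoc]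
      simp [mul_sub, sub_mul, p.2.1, orb_mul_orb]
    · change h (p.1.2 a • u.1) * gate k Q l a = p.1.2 a
      rw [map_smul, h1, smul_eq_mul, mul_assoc]
      simp [sub_mul, p.2.2 a, orb_mul_gate hl]
  -- T₁ is a retract of a single copy of T: `s` forgets the first entry and evaluates the others on
  -- u, while `g` below kills u.1 and sends u_a to the a-th generator.
  · let s : T₁ →ₗ[IAlg k Q] T := (LinearMap.range f).liftQ
      (evalFamily (0, u.2) ∘ₗ (familyProj k Q l).subtype) (by
        rintro _ ⟨x, rfl⟩
        change (f x).1.1 • (0 : T) + ∑ a, (f x).1.2 a • u.2 a = 0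
        simp only [hf2, mul_smul, ← Finset.smul_sum, hu.isReflFamily.sum_eq_zero, smul_zero,
          add_zero])
    obtain ⟨g, h1, h2⟩ := hu.exists_lift
      ((0 : T₁), fun a => mk (toFamilyProj (0, Pi.single a 1)))
      { orb_smul := smul_zero _
        gate_smul := fun a => by
          rw [← map_smul]
          congr 1
          refine Subtype.ext (Prod.ext ?_ (funext fun b => ?_))
          · simp [toFamilyProj]
          · by_cases h : b = a
            · subst h; simp [toFamilyProj, gate_mul_gate]
            · simp [toFamilyProj, h]
        sum_eq_zero := by
          simp only [← map_smul, ← map_sum]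
          refine (Submodule.Quotient.mk_eq_zero _).2 ⟨orb k Q l, ?_⟩
          refine Subtype.ext (Prod.ext ?_ (funext fun b => ?_))
          · simp [toFamilyProj, hf1, mul_sub, orb_mul_orb, Prod.fst_sum]
          · simp [toFamilyProj, hf2, orb_mul_orb, Prod.snd_sum, Finset.sum_apply, Pi.single_apply,
              arr_mul_gate] }
    have hgs : ∀ y : T₁, g (s y) = y := by
      intro y
      obtain ⟨p, rfl⟩ := (LinearMap.range f).mkQ_surjective y
      change g (p.1.1 • (0 : T) + ∑ a, p.1.2 a • u.2 a) = mk p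
      have h3 : mk p = mk (toFamilyProj (0, p.1.2)) := by
        refine (Submodule.Quotient.eq _).2 ⟨p.1.1, ?_⟩
        refine Subtype.ext (Prod.ext ?_ (funext fun b => ?_))
        · simp [toFamilyProj, hf1, mul_sub, p.2.1]
        · simp [toFamilyProj, hf2, p.2.1, p.2.2 b]
      rw [h3, ← LinearMap.comp_apply, linearMap_pi_apply (mk ∘ₗ toFamilyProj)]
      simp [h2]
    exact InAdd.of_linearMap (ι := Unit) (LinearMap.pi fun _ => s) (g ∘ₗ LinearMap.proj ()) hgs
  · rw [injective_iff_map_eq_zero]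
    intro x hx
    -- The first entry forces x ∈ Λ^ı e; the other entries then say x a = 0 for all arrows.
    have h1 : x * orb k Q l = x := by
      have := hf1 x
      rw [hx, mul_sub, mul_one] at this
      exact (sub_eq_zero.1 this.symm).symm
    refine eq_zero_of_mul_arr hl hne h1 fun a => ?_
    have := hf2 x a
    rw [hx, h1] at this
    exact this.symm
  · exact LinearMap.exact_map_mkQ_range f
  · exact (LinearMap.range f).mkQ_surjective

end IsGenericFamily

theorem IsGenericFamily.isTilting {T : ModuleCat.{u} (IAlg k Q)} {u : T × (E → T)}
    (hl : Q.IsSink l) (hne : ∃ a, Q.tgt a = l) (hu : IsGenericFamily (k := k) Q l u) :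
    IsTilting T where
  projDim_le := hasProjectiveDimensionLE_one_of_exact orbToFamily (proj (l := l) u)
    (orbToFamily_injective hl hne) hu.exact hu.proj_surjective
  ext_eq_zero := subsingleton_ext_one_of_exact orbToFamily (proj (l := l) u)
    (orbToFamily_injective hl hne) hu.exact hu.proj_surjective (hu.exists_extension hl)
  coresolution := hu.coresolution hl hne

end Tilting

/-! ### Linearity and stability checked on generators of Λ^ı. -/

section Generators

open IAlg

variable {k : Type u} [Field k] {V E : Type u} [Fintype V] {Q : IQuiver V E}

namespace RepData

variable {N : Type*} [AddCommGroup N] [Module k N] (ρ : RepData (k := k) Q N)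

theorem vert_smul (i : V) (n : ρ.Carrier) : vert k Q i • n = (ρ.e i n : N) := by
  change ρ.toAlgHom (vert k Q i) n = _
  rw [toAlgHom_apply, vert, coC_val_ofPath, coD_val_ofPath]
  simp [onPath]

theorem arr_smul (a : E) (n : ρ.Carrier) : arr k Q a • n = (ρ.f a n : N) := by
  change ρ.toAlgHom (arr k Q a) n = _
  rw [toAlgHom_apply, arr, coC_val_ofPath, coD_val_ofPath]
  simp [onPath]

theorem eps_smul (n : ρ.Carrier) : eps k Q • n = (ρ.ε n : N) := by
  change ρ.toAlgHom (eps k Q) n = _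
  rw [toAlgHom_apply, ← mul_one (eps k Q), coC_val_eps_mul, coD_val_eps_mul]
  simp [Algebra.TensorProduct.one_def, R2.one_c]

end RepData

/-- A `k`-linear map which commutes with the generators of `Λ^ı` is `Λ^ı`-linear. -/
def IAlg.linearMapOfGenerators {M N : Type*} [AddCommGroup M] [AddCommGroup N] [Module k M]
    [Module k N] [Module (IAlg k Q) M] [Module (IAlg k Q) N] [IsScalarTower k (IAlg k Q) M]
    [IsScalarTower k (IAlg k Q) N] (f : M →ₗ[k] N)
    (hv : ∀ i m, f (vert k Q i • m) = vert k Q i • f m)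
    (ha : ∀ a m, f (arr k Q a • m) = arr k Q a • f m)
    (he : ∀ m, f (eps k Q • m) = eps k Q • f m) : M →ₗ[IAlg k Q] N where
  toFun := f
  map_add' := f.map_add
  map_smul' x := by
    rw [RingHom.id_apply]
    induction x using IAlg.induction with
    | hk c => intro m; rw [algebraMap_smul, algebraMap_smul, map_smul]
    | hv i => exact hv i
    | ha a => exact ha a
    | he => exact he
    | hadd x y hx hy => intro m; rw [add_smul, map_add, hx, hy, add_smul]
    | hmul x y hx hy => intro m; rw [mul_smul, hx, hy, mul_smul]

/-- A subspace which is stable under the generators of `Λ^ı` is a submodule. -/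
def IAlg.submoduleOfGenerators {M : Type*} [AddCommGroup M] [Module k M]
    [Module (IAlg k Q) M] [IsScalarTower k (IAlg k Q) M] (K : Submodule k M)
    (hv : ∀ i, ∀ m ∈ K, vert k Q i • m ∈ K) (ha : ∀ a, ∀ m ∈ K, arr k Q a • m ∈ K)
    (he : ∀ m ∈ K, eps k Q • m ∈ K) : Submodule (IAlg k Q) M where
  carrier := K
  zero_mem' := K.zero_mem
  add_mem' := K.add_mem
  smul_mem' x := by
    induction x using IAlg.induction with
    | hk c => intro m hm; rw [algebraMap_smul]; exact K.smul_mem c hm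
    | hv i => exact hv i _
    | ha a => exact ha a _
    | he => exact he _
    | hadd x y hx hy => intro m hm; rw [add_smul]; exact K.add_mem (hx hm) (hy hm)
    | hmul x y hx hy => intro m hm; rw [mul_smul]; exact hx (hy hm)

end Generators

/-! ### Elements of F_l⁺ L and the action of s_lΛ^ı on them. -/

section Refl

open IAlg

variable {k : Type u} [Field k] {V E : Type u} [Fintype V] [DecidableEq V] [Fintype E]
  {Q : IQuiver V E} {l : V} {hl : Q.IsSink l}
variable {L : Type u} [AddCommGroup L] [Module k L] [Module (IAlg k Q) L]
  [IsScalarTower k (IAlg k Q) L]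

namespace Refl

/-- The pair of which an element of `F_l⁺ L` consists. -/
def val : Refl (k := k) Q l L hl →ₗ[k] L × (E → L) := (reflSubmodule (k := k) Q l L).subtype

theorem val_injective : Function.Injective (val (k := k) (Q := Q) (l := l) (hl := hl) (L := L)) :=
  Subtype.val_injective

theorem isReflFamily (p : Refl (k := k) Q l L hl) : IsReflFamily (k := k) Q l (val p) :=
  mem_reflSubmodule_iff.1 p.2

/-- The element of `F_l⁺ L` given by a pair. -/
def mk (p : L × (E → L)) (hp : IsReflFamily (k := k) Q l p) : Refl (k := k) Q l L hl :=
  (⟨p, mem_reflSubmodule_iff.2 hp⟩ : reflSubmodule (k := k) Q l L)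

theorem val_mk (p : L × (E → L)) (hp : IsReflFamily (k := k) Q l p) :
    val (hl := hl) (mk p hp) = p := rfl

theorem val_vert_smul (r : V) (p : Refl (k := k) Q l L hl) :
    val (vert k (Q.reflect l) r • p) =
      (vert k Q r • (val p).1, fun a => if Q.tgt a = r then (val p).2 a else 0) := by
  rw [RepData.vert_smul]; rfl

theorem val_arr_smul (a : E) (p : Refl (k := k) Q l L hl) :
    val (arr k (Q.reflect l) a • p) =
      (if Q.InOrbit l (Q.tgt a) then (val p).2 a else arr k Q a • (val p).1, 0) := by
  rw [RepData.arr_smul]; rfl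

theorem val_eps_smul (p : Refl (k := k) Q l L hl) :
    val (eps k (Q.reflect l) • p) =
      (eps k Q • (val p).1, fun a => eps k Q • (val p).2 (Q.tauE a)) := by
  rw [RepData.eps_smul]; rfl

theorem vert_smul_val_fst {r : V} (hr : Q.InOrbit l r) (p : Refl (k := k) Q l L hl) :
    vert k Q r • (val p).1 = 0 :=
  ((mem_reflSubmodule Q).1 (mem_reflSubmodule_iff.2 p.isReflFamily)).1 r hr

theorem val_reflMap {L' : Type u} [AddCommGroup L'] [Module k L'] [Module (IAlg k Q) L']
    [IsScalarTower k (IAlg k Q) L'] (g : L →ₗ[IAlg k Q] L') (p : Refl (k := k) Q l L hl) :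
    val (reflMap (k := k) Q l hl g p) = (g (val p).1, fun a => g ((val p).2 a)) := rfl

end Refl

end Refl

/-! ### The left adjoint of F_l⁺ on the regular module of s_lΛ^ı. -/

section Reflected

open IAlg

variable (k : Type u) [Field k] {V E : Type u} [Fintype V] [DecidableEq V]
  (Q : IQuiver V E) (l : V)

variable {k Q l} in
theorem vert_src_mul_arr_reflect {a : E} (ha : Q.InOrbit l (Q.tgt a)) :
    vert k (Q.reflect l) (Q.src a) * arr k (Q.reflect l) a = arr k (Q.reflect l) a := by
  have := vert_tgt_mul_arr k (Q.reflect l) a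
  rwa [show (Q.reflect l).tgt a = Q.src a from if_pos ha] at this

variable {k Q l} in
theorem arr_reflect_mul_vert_tgt {a : E} (ha : Q.InOrbit l (Q.tgt a)) :
    arr k (Q.reflect l) a * vert k (Q.reflect l) (Q.tgt a) = arr k (Q.reflect l) a := by
  have := arr_mul_vert_src k (Q.reflect l) a
  rwa [show (Q.reflect l).src a = Q.tgt a from if_pos ha] at this

variable {k Q l} in
theorem vert_tgt_mul_arr_reflect {a : E} (ha : ¬ Q.InOrbit l (Q.tgt a)) :
    vert k (Q.reflect l) (Q.tgt a) * arr k (Q.reflect l) a = arr k (Q.reflect l) a := by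
  have := vert_tgt_mul_arr k (Q.reflect l) a
  rwa [show (Q.reflect l).tgt a = Q.tgt a from if_neg ha] at this

variable {k Q l} in
theorem arr_reflect_mul_vert_src {a : E} (ha : ¬ Q.InOrbit l (Q.tgt a)) :
    arr k (Q.reflect l) a * vert k (Q.reflect l) (Q.src a) = arr k (Q.reflect l) a := by
  have := arr_mul_vert_src k (Q.reflect l) a
  rwa [show (Q.reflect l).src a = Q.src a from if_neg ha] at this

variable {k Q l} in
theorem eps_reflect_mul_vert (i : V) : eps k (Q.reflect l) * vert k (Q.reflect l) i =
    vert k (Q.reflect l) (Q.tauV i) * eps k (Q.reflect l) := eps_mul_vert k (Q.reflect l) i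

variable {k Q l} in
theorem eps_reflect_mul_arr (a : E) : eps k (Q.reflect l) * arr k (Q.reflect l) a =
    arr k (Q.reflect l) (Q.tauE a) * eps k (Q.reflect l) := eps_mul_arr k (Q.reflect l) a

open Classical in
/-- A representation which presents the image of the regular module of `s_l Λ^ı` under the left
adjoint of the reflection functor. -/
def coreflPreRep : RepData (k := k) Q
    (IAlg k (Q.reflect l) × (E → IAlg k (Q.reflect l))) where
  e r :=
    { toFun := fun p => (vert k _ r * p.1, fun a => if Q.tgt a = r then p.2 a else 0)
      map_add' := fun p q => by
        refine Prod.ext (mul_add _ _ _) (funext fun a => ?_)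
        dsimp; split_ifs <;> simp
      map_smul' := fun c p => by
        refine Prod.ext (mul_smul_comm _ _ _) (funext fun a => ?_)
        dsimp; split_ifs <;> simp }
  f a :=
    -- An arrow into the orbit stores the component at its source in its own slot, which belongs to
    -- the vertex tgt a; the remaining arrows act on the first entry as in s_lΛ^ı.
    { toFun := fun p => if Q.InOrbit l (Q.tgt a)
        then (0, fun b => if b = a then vert k _ (Q.src a) * p.1 else 0) else (arr k _ a * p.1, 0)
      map_add' := fun p q => by
        split_ifs
        · refine Prod.ext (by simp) (funext fun b => ?_)
          dsimp; split_ifs <;> simp [mul_add]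
        · simp [mul_add]
      map_smul' := fun c p => by
        split_ifs
        · refine Prod.ext (by simp) (funext fun b => ?_)
          dsimp; split_ifs <;> simp
        · simp }
  ε :=
    { toFun := fun p => (eps k _ * p.1, fun a => eps k _ * p.2 (Q.tauE a))
      map_add' := fun p q => Prod.ext (mul_add _ _ _) (funext fun a => mul_add _ _ _)
      map_smul' := fun c p => Prod.ext (mul_smul_comm _ _ _) (funext fun a => by simp) }
  idem r := by
    refine LinearMap.ext fun p => Prod.ext ?_ (funext fun a => ?_)
    · simp [← mul_assoc, vert_mul_vert]
    · simp
      exact fun h1 h2 => absurd h2 h1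
  orth r s h := by
    refine LinearMap.ext fun p => Prod.ext ?_ (funext fun a => ?_)
    · simp [← mul_assoc, vert_mul_vert_of_ne h]
    · simp
      grind
  sum_one := by
    refine LinearMap.ext fun p => Prod.ext ?_ (funext fun a => ?_)
    · simp [LinearMap.sum_apply, Prod.fst_sum, ← Finset.sum_mul, sum_vert]
    · simp [LinearMap.sum_apply, Prod.snd_sum]
  tgt a := by
    by_cases h : Q.InOrbit l (Q.tgt a)
    · refine LinearMap.ext fun p => Prod.ext ?_ (funext fun b => ?_)
      · simp [h]
      · simp [h]
        rintro h1 rfl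
        exact absurd rfl h1
    · refine LinearMap.ext fun p => Prod.ext ?_ (funext fun b => ?_)
      · simp [h, ← mul_assoc, vert_tgt_mul_arr_reflect]
      · simp [h]
  src a := by
    by_cases h : Q.InOrbit l (Q.tgt a)
    · refine LinearMap.ext fun p => Prod.ext ?_ (funext fun b => ?_)
      · simp [h]
      · simp [h, ← mul_assoc, vert_mul_vert]
    · refine LinearMap.ext fun p => Prod.ext ?_ (funext fun b => ?_)
      · simp [h, ← mul_assoc, arr_reflect_mul_vert_src]
      · simp [h]
  ε_sq := by
    refine LinearMap.ext fun p => Prod.ext ?_ (funext fun b => ?_) <;>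
      simp [← mul_assoc, eps_mul_eps]
  ε_e r := by
    have hr : ∀ i, Q.tauV i = r ↔ i = Q.tauV r := fun i =>
      ⟨fun h => by rw [← h, Q.tauV_tauV], fun h => by rw [h, Q.tauV_tauV]⟩
    refine LinearMap.ext fun p => Prod.ext ?_ (funext fun b => ?_)
    · simp [← mul_assoc, eps_reflect_mul_vert]
    · simp [Q.tgt_tauE, hr]
  ε_f a := by
    have ht : ∀ b, Q.tauE b = a ↔ b = Q.tauE a := fun b =>
      ⟨fun h => by rw [← h, Q.tauE_tauE], fun h => by rw [h, Q.tauE_tauE]⟩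
    by_cases h : Q.InOrbit l (Q.tgt a)
    · refine LinearMap.ext fun p => Prod.ext ?_ (funext fun b => ?_)
      · simp [h, IQuiver.inOrbit_tgt_tau]
      · simp [h, IQuiver.inOrbit_tgt_tau, ht, ← mul_assoc, eps_reflect_mul_vert, Q.src_tauE]
    · refine LinearMap.ext fun p => Prod.ext ?_ (funext fun b => ?_)
      · simp [h, IQuiver.inOrbit_tgt_tau, ← mul_assoc, eps_reflect_mul_arr]
      · simp [h, IQuiver.inOrbit_tgt_tau]

/-- The `Λ^ı`-module given by `coreflPreRep`. -/
abbrev CoreflPre : Type u := (coreflPreRep k Q l).Carrier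

variable {k Q l}

namespace CoreflPre

/-- The element of `CoreflPre` given by a pair. -/
def ofPair : (IAlg k (Q.reflect l) × (E → IAlg k (Q.reflect l))) →ₗ[k] CoreflPre k Q l :=
  LinearMap.id

/-- The pair of which an element of `CoreflPre` consists. -/
def toPair : CoreflPre k Q l →ₗ[k] IAlg k (Q.reflect l) × (E → IAlg k (Q.reflect l)) :=
  LinearMap.id

theorem toPair_ofPair (p : IAlg k (Q.reflect l) × (E → IAlg k (Q.reflect l))) :
    toPair (ofPair p) = p := rfl

theorem toPair_injective : Function.Injective (toPair (k := k) (Q := Q) (l := l)) :=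
  fun _ _ h => h

theorem toPair_vert_smul (r : V) (p : CoreflPre k Q l) :
    toPair (vert k Q r • p) =
      (vert k _ r * (toPair p).1, fun a => if Q.tgt a = r then (toPair p).2 a else 0) := by
  rw [RepData.vert_smul]; rfl

open Classical in
theorem toPair_arr_smul (a : E) (p : CoreflPre k Q l) :
    toPair (arr k Q a • p) = if Q.InOrbit l (Q.tgt a)
      then (0, fun b => if b = a then vert k _ (Q.src a) * (toPair p).1 else 0)
      else (arr k _ a * (toPair p).1, 0) := by
  rw [RepData.arr_smul]; rfl

theorem toPair_eps_smul (p : CoreflPre k Q l) :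
    toPair (eps k Q • p) = (eps k _ * (toPair p).1, fun a => eps k _ * (toPair p).2 (Q.tauE a)) := by
  rw [RepData.eps_smul]; rfl

end CoreflPre

open CoreflPre

variable (k) in
/-- The relations by which `CoreflPre` has to be divided. -/
def coreflRel (hl : Q.IsSink l) : Submodule (IAlg k Q) (CoreflPre k Q l) :=
  submoduleOfGenerators (k := k)
    -- The first entry may be anything in the orbit part, so that part dies. At r in the orbit the
    -- quotient is the cokernel of n ↦ (a n)_a from e_r s_lΛ^ı to ⨁ e_{src a} s_lΛ^ı. Slots of
    -- arrows not ending in the orbit are unconstrained, hence also die. One n serves both vertices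
    -- of the orbit, through its components.
    { carrier := {p | (∀ i, ¬ Q.InOrbit l i → vert k _ i * (toPair p).1 = 0) ∧
        ∃ n : IAlg k (Q.reflect l), (∀ i, ¬ Q.InOrbit l i → vert k _ i * n = 0) ∧
          ∀ a, Q.InOrbit l (Q.tgt a) → vert k _ (Q.src a) * (toPair p).2 a = arr k _ a * n}
      zero_mem' := ⟨by simp, 0, by simp⟩
      add_mem' := by
        rintro p q ⟨h1, n, h2, h3⟩ ⟨h1', n', h2', h3'⟩
        refine ⟨fun i hi => ?_, n + n', fun i hi => ?_, fun a ha => ?_⟩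
        · rw [map_add, Prod.fst_add, mul_add, h1 i hi, h1' i hi, add_zero]
        · rw [mul_add, h2 i hi, h2' i hi, add_zero]
        · rw [map_add, Prod.snd_add, Pi.add_apply, mul_add, mul_add, h3 a ha, h3' a ha]
      smul_mem' := by
        rintro c p ⟨h1, n, h2, h3⟩
        refine ⟨fun i hi => ?_, c • n, fun i hi => ?_, fun a ha => ?_⟩
        · rw [map_smul, Prod.smul_fst, mul_smul_comm, h1 i hi, smul_zero]
        · rw [mul_smul_comm, h2 i hi, smul_zero]
        · rw [map_smul, Prod.smul_snd, Pi.smul_apply, mul_smul_comm, mul_smul_comm, h3 a ha] }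
    (by
      rintro r p ⟨h1, n, h2, h3⟩
      refine ⟨fun i hi => ?_, vert k _ r * n, fun i hi => ?_, fun a ha => ?_⟩
      · rw [toPair_vert_smul]
        rcases eq_or_ne i r with rfl | h
        · rw [h1 i hi, mul_zero]
        · rw [← mul_assoc, vert_mul_vert_of_ne h, zero_mul]
      · rcases eq_or_ne i r with rfl | h
        · rw [h2 i hi, mul_zero]
        · rw [← mul_assoc, vert_mul_vert_of_ne h, zero_mul]
      · rw [toPair_vert_smul]
        dsimp only
        split_ifs with h
        · rw [h3 a ha, ← mul_assoc, ← h, arr_reflect_mul_vert_tgt ha]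
        · rw [← arr_reflect_mul_vert_tgt ha, mul_assoc, ← mul_assoc (vert k _ (Q.tgt a)),
            vert_mul_vert_of_ne h, zero_mul, mul_zero, mul_zero])
    (by
      classical
      rintro a p ⟨h1, n, h2, h3⟩
      refine ⟨fun i hi => ?_, 0, by simp, fun b hb => ?_⟩
      · rw [toPair_arr_smul]
        split_ifs with ha
        · simp
        · dsimp only
          rw [← arr_reflect_mul_vert_src ha, mul_assoc, h1 _ (hl.not_inOrbit a), mul_zero,
            mul_zero]
      · rw [toPair_arr_smul]
        split_ifs with ha
        · dsimp only
          split_ifs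
          · rw [h1 _ (hl.not_inOrbit a), mul_zero, mul_zero]
          · simp
        · simp)
    (by
      rintro p ⟨h1, n, h2, h3⟩
      have hv : ∀ i, vert k (Q.reflect l) i * eps k _ = eps k _ * vert k _ (Q.tauV i) := fun i => by
        rw [eps_reflect_mul_vert, Q.tauV_tauV]
      refine ⟨fun i hi => ?_, eps k _ * n, fun i hi => ?_, fun a ha => ?_⟩
      · rw [toPair_eps_smul, ← mul_assoc, hv, mul_assoc, h1 _ ((Q.inOrbit_tau l i).not.2 hi), mul_zero]
      · rw [← mul_assoc, hv, mul_assoc, h2 _ ((Q.inOrbit_tau l i).not.2 hi), mul_zero]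
      · have := h3 _ ((Q.inOrbit_tgt_tau l a).2 ha)
        rw [Q.src_tauE] at this
        rw [toPair_eps_smul, ← mul_assoc, hv, mul_assoc, this, ← mul_assoc, eps_reflect_mul_arr,
          Q.tauE_tauE, mul_assoc])

theorem mem_coreflRel {hl : Q.IsSink l} {p : CoreflPre k Q l} : p ∈ coreflRel k hl ↔
    (∀ i, ¬ Q.InOrbit l i → vert k _ i * (toPair p).1 = 0) ∧
      ∃ n : IAlg k (Q.reflect l), (∀ i, ¬ Q.InOrbit l i → vert k _ i * n = 0) ∧
        ∀ a, Q.InOrbit l (Q.tgt a) → vert k _ (Q.src a) * (toPair p).2 a = arr k _ a * n := Iff.rfl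

variable (k) in
/-- The image of the regular module of `s_l Λ^ı` under the left adjoint of the reflection
functor. -/
abbrev Corefl (hl : Q.IsSink l) : Type u := CoreflPre k Q l ⧸ coreflRel k hl

namespace Corefl

variable (hl : Q.IsSink l)

variable (k) in
/-- The class of `(x, 0)`. -/
def incl : IAlg k (Q.reflect l) →ₗ[k] Corefl k hl :=
  ((coreflRel k hl).mkQ.restrictScalars k) ∘ₗ ofPair ∘ₗ LinearMap.inl k _ _

theorem incl_eq_zero_iff {x : IAlg k (Q.reflect l)} :
    incl k hl x = 0 ↔ ∀ i, ¬ Q.InOrbit l i → vert k _ i * x = 0 := by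
  refine (Submodule.Quotient.mk_eq_zero _).trans ⟨fun h => (mem_coreflRel.1 h).1,
    fun h => mem_coreflRel.2 ⟨h, 0, by simp, fun a ha => ?_⟩⟩
  rw [LinearMap.comp_apply, toPair_ofPair]
  simp

theorem vert_smul_incl (r : V) (x : IAlg k (Q.reflect l)) :
    vert k Q r • incl k hl x = incl k hl (vert k _ r * x) := by
  refine congrArg (coreflRel k hl).mkQ (toPair_injective
    (a₁ := vert k Q r • ofPair (x, 0)) (a₂ := ofPair (LinearMap.inl k _ _ _)) ?_)
  rw [toPair_vert_smul, toPair_ofPair, toPair_ofPair]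
  simp
  rfl

theorem arr_smul_incl {a : E} (ha : ¬ Q.InOrbit l (Q.tgt a)) (x : IAlg k (Q.reflect l)) :
    arr k Q a • incl k hl x = incl k hl (arr k _ a * x) := by
  refine congrArg (coreflRel k hl).mkQ (toPair_injective
    (a₁ := arr k Q a • ofPair (x, 0)) (a₂ := ofPair (LinearMap.inl k _ _ _)) ?_)
  rw [toPair_arr_smul, toPair_ofPair, toPair_ofPair, if_neg ha]
  rfl

theorem eps_smul_incl (x : IAlg k (Q.reflect l)) :
    eps k Q • incl k hl x = incl k hl (eps k _ * x) := by
  refine congrArg (coreflRel k hl).mkQ (toPair_injective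
    (a₁ := eps k Q • ofPair (x, 0)) (a₂ := ofPair (LinearMap.inl k _ _ _)) ?_)
  rw [toPair_eps_smul, toPair_ofPair, toPair_ofPair]
  simp
  rfl

theorem incl_vert_mul_of_inOrbit {r : V} (hr : Q.InOrbit l r) (x : IAlg k (Q.reflect l)) :
    incl k hl (vert k _ r * x) = 0 := by
  rw [incl_eq_zero_iff]
  intro i hi
  rw [← mul_assoc, vert_mul_vert_of_ne, zero_mul]
  rintro rfl
  exact hi hr

/-- The slots that survive in the quotient belong to vertices of the orbit; at r only the first
entry remains. -/
theorem exists_vert_smul_eq_incl {r : V} (hr : ¬ Q.InOrbit l r) (y : Corefl k hl) :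
    ∃ x, vert k Q r • y = incl k hl (vert k _ r * x) := by
  obtain ⟨p, rfl⟩ := (coreflRel k hl).mkQ_surjective y
  refine ⟨(toPair p).1, ?_⟩
  rw [← map_smul]
  refine (Submodule.Quotient.eq _).2 (mem_coreflRel.2 ?_)
  rw [map_sub, toPair_vert_smul]
  refine ⟨fun i hi => by rw [LinearMap.comp_apply, toPair_ofPair]; simp, 0, by simp, fun a ha => ?_⟩
  rw [LinearMap.comp_apply, toPair_ofPair]
  have : Q.tgt a ≠ r := by rintro rfl; exact hr ha
  simp [this]

/-- This is the description of the kernel that F_l⁺ takes at the orbit: families with ∑ a z_a = 0 in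
`Corefl` come from the orbit part of s_lΛ^ı. One direction makes the unit well defined, the other
makes it surjective. -/
theorem sum_arr_smul_incl_eq_zero_iff [Fintype E] {z : E → IAlg k (Q.reflect l)}
    (hz : ∀ a, Q.InOrbit l (Q.tgt a) → vert k _ (Q.src a) * z a = z a) :
    ∑ a with Q.InOrbit l (Q.tgt a), arr k Q a • incl k hl (z a) = 0 ↔
    ∃ n : IAlg k (Q.reflect l), (∀ i, ¬ Q.InOrbit l i → vert k _ i * n = 0) ∧
        ∀ a, Q.InOrbit l (Q.tgt a) → z a = arr k _ a * n := by
  classical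
  have h1 : ∀ a, Q.InOrbit l (Q.tgt a) →
      arr k Q a • incl k hl (z a) = (coreflRel k hl).mkQ (ofPair (0, Pi.single a (z a))) := by
    intro a ha
    refine congrArg (coreflRel k hl).mkQ (toPair_injective
    (a₁ := arr k Q a • ofPair (z a, 0)) (a₂ := ofPair _) ?_)
    rw [toPair_arr_smul, toPair_ofPair, toPair_ofPair, if_pos ha, hz a ha]
    refine Prod.ext rfl (funext fun b => ?_)
    change _ = (Pi.single a (z a) : E → IAlg k (Q.reflect l)) b
    simp [Pi.single_apply]
  have h2 : ∀ a, Q.InOrbit l (Q.tgt a) → vert k _ (Q.src a) * (toPair (k := k) (Q := Q) (l := l)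
      (∑ a with Q.InOrbit l (Q.tgt a), ofPair (0, Pi.single a (z a)))).2 a = z a := by
    intro a ha
    rw [← map_sum, toPair_ofPair, Prod.snd_sum, Finset.sum_apply]
    simp [Pi.single_apply, ha, hz a ha]
  rw [Finset.sum_congr rfl fun a ha => h1 a (Finset.mem_filter.1 ha).2, ← map_sum]
  refine (Submodule.Quotient.mk_eq_zero _).trans (mem_coreflRel.trans ⟨?_, ?_⟩)
  · rintro ⟨-, n, h3, h4⟩
    exact ⟨n, h3, fun a ha => by rw [← h4 a ha, h2 a ha]⟩
  · rintro ⟨n, h3, h4⟩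
    refine ⟨fun i _ => ?_, n, h3, fun a ha => by rw [h2 a ha, h4 a ha]⟩
    rw [← map_sum, toPair_ofPair, Prod.fst_sum]
    simp

end Corefl

end Reflected

/-! ### The unit of the adjunction, its bijectivity, and the adjoint maps. -/

section Unit

open IAlg CoreflPre

variable {k : Type u} [Field k] {V E : Type u} [Fintype V]

theorem arr_smul_arr_smul_of_inOrbit {Q : IQuiver V E} {l : V} (hl : Q.IsSink l) {L : Type*} [AddCommGroup L]
    [Module (IAlg k Q) L] (b : E) {a : E}
    (ha : Q.InOrbit l (Q.tgt a)) (y : L) : arr k Q b • arr k Q a • y = 0 := by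
  rw [smul_smul, ← arr_mul_vert_src, ← vert_tgt_mul_arr k Q a, mul_assoc,
    ← mul_assoc (vert k Q (Q.src b)), vert_mul_vert_of_ne, zero_mul, mul_zero, zero_smul]
  exact fun h => hl.not_inOrbit b (h ▸ ha)

variable [DecidableEq V] {Q : IQuiver V E} {l : V} (hl : Q.IsSink l)

namespace Corefl

variable (k) in
/-- The pair `([(x, 0)], ([(a x, 0)])_a)`. -/
def unitPair : IAlg k (Q.reflect l) →ₗ[k] Corefl k hl × (E → Corefl k hl) :=
  LinearMap.prod (incl k hl) (LinearMap.pi fun a =>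
    if Q.InOrbit l (Q.tgt a) then incl k hl ∘ₗ LinearMap.mulLeft k (arr k _ a) else 0)

theorem unitPair_fst (x : IAlg k (Q.reflect l)) : (unitPair k hl x).1 = incl k hl x := rfl

theorem unitPair_snd (x : IAlg k (Q.reflect l)) (a : E) : (unitPair k hl x).2 a =
    if Q.InOrbit l (Q.tgt a) then incl k hl (arr k _ a * x) else 0 := by
  change (if _ then _ else _ : IAlg k (Q.reflect l) →ₗ[k] _) x = _
  split_ifs <;> rfl

variable [Fintype E]

theorem isReflFamily_unitPair (x : IAlg k (Q.reflect l)) :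
    IsReflFamily (k := k) Q l (unitPair k hl x) where
  orb_smul := by
    rw [orb, Finset.sum_smul]
    refine Finset.sum_eq_zero fun r hr => ?_
    rw [unitPair_fst, vert_smul_incl, incl_vert_mul_of_inOrbit hl (Finset.mem_filter.1 hr).2]
  gate_smul a := by
    rw [unitPair_snd, gate]
    split_ifs with h
    · rw [vert_smul_incl, ← mul_assoc, vert_src_mul_arr_reflect h]
    · simp
  sum_eq_zero := by
    have h1 : ∑ a, arr k Q a • (unitPair k hl x).2 a =
        ∑ a with Q.InOrbit l (Q.tgt a), arr k Q a • incl k hl (arr k _ a * x) := by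
      rw [Finset.sum_filter]
      refine Finset.sum_congr rfl fun a _ => ?_
      rw [unitPair_snd]
      split_ifs <;> simp
    rw [h1, sum_arr_smul_incl_eq_zero_iff hl fun a ha => by
      rw [← mul_assoc, vert_src_mul_arr_reflect ha]]
    -- The witness n is the orbit part of x: a reversed arrow starts in the orbit and sees nothing
    -- else of x.
    refine ⟨∑ r with Q.InOrbit l r, vert k _ r * x, fun i hi => ?_, fun a ha => ?_⟩
    · rw [Finset.mul_sum]
      refine Finset.sum_eq_zero fun r hr => ?_
      rw [← mul_assoc, vert_mul_vert_of_ne, zero_mul]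
      rintro rfl
      exact hi (Finset.mem_filter.1 hr).2
    · rw [Finset.mul_sum, Finset.sum_eq_single (Q.tgt a)]
      · rw [← mul_assoc, arr_reflect_mul_vert_tgt ha]
      · intro r _ hr
        rw [← arr_reflect_mul_vert_tgt ha, mul_assoc, ← mul_assoc (vert k _ _),
          vert_mul_vert_of_ne (Ne.symm hr), zero_mul, mul_zero]
      · intro h
        exact absurd (Finset.mem_filter.2 ⟨Finset.mem_univ _, ha⟩) h

variable (k) in
/-- The unit `s_l Λ^ı → F_l⁺ (Corefl)` of the adjunction. -/
def unit : IAlg k (Q.reflect l) →ₗ[IAlg k (Q.reflect l)] Refl (k := k) Q l (Corefl k hl) hl :=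
  linearMapOfGenerators (k := k)
    { toFun := fun x => Refl.mk (unitPair k hl x) (isReflFamily_unitPair hl x)
      map_add' := fun x y => Refl.val_injective (map_add (unitPair k hl) x y)
      map_smul' := fun c x => Refl.val_injective (map_smul (unitPair k hl) c x) }
    (fun r x => Refl.val_injective (by
      change unitPair k hl (vert k _ r * x) = Refl.val (vert k _ r •
        Refl.mk (unitPair k hl x) (isReflFamily_unitPair hl x))
      rw [Refl.val_vert_smul, Refl.val_mk]
      refine Prod.ext ?_ (funext fun a => ?_)
      · rw [unitPair_fst, unitPair_fst, vert_smul_incl]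
      · rw [unitPair_snd]
        dsimp only
        rw [unitPair_snd]
        split_ifs with h1 h2 h2
        · rw [← mul_assoc, ← h2, arr_reflect_mul_vert_tgt h1]
        · rw [← arr_reflect_mul_vert_tgt h1, mul_assoc, ← mul_assoc (vert k _ _),
            vert_mul_vert_of_ne h2, zero_mul, mul_zero, map_zero]
        · rfl
        · rfl))
    (fun b x => Refl.val_injective (by
      change unitPair k hl (arr k _ b * x) = Refl.val (arr k _ b •
        Refl.mk (unitPair k hl x) (isReflFamily_unitPair hl x))
      rw [Refl.val_arr_smul, Refl.val_mk]
      refine Prod.ext ?_ (funext fun a => ?_)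
      · rw [unitPair_fst, unitPair_fst, unitPair_snd]
        dsimp only
        split_ifs with h1
        · rfl
        · rw [arr_smul_incl hl h1]
      · rw [unitPair_snd]
        change _ = (0 : Corefl k hl)
        split_ifs with h1
        · have h2 : vert k (Q.reflect l) (Q.tgt a) * arr k (Q.reflect l) b = 0 := by
            by_cases hb : Q.InOrbit l (Q.tgt b)
            · rw [← vert_src_mul_arr_reflect hb, ← mul_assoc, vert_mul_vert_of_ne, zero_mul]
              exact fun h => hl.not_inOrbit b (h ▸ h1)
            · rw [← vert_tgt_mul_arr_reflect hb, ← mul_assoc, vert_mul_vert_of_ne, zero_mul]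
              exact fun h => hb (h ▸ h1)
          rw [← arr_reflect_mul_vert_tgt h1, mul_assoc, ← mul_assoc (vert k _ _), h2, zero_mul,
            mul_zero, map_zero]
        · rfl))
    (fun x => Refl.val_injective (by
      change unitPair k hl (eps k _ * x) = Refl.val (eps k _ •
        Refl.mk (unitPair k hl x) (isReflFamily_unitPair hl x))
      rw [Refl.val_eps_smul, Refl.val_mk]
      refine Prod.ext ?_ (funext fun a => ?_)
      · rw [unitPair_fst, unitPair_fst, eps_smul_incl]
      · rw [unitPair_snd]
        dsimp only
        rw [unitPair_snd]
        simp only [Q.inOrbit_tgt_tau]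
        split_ifs with h1
        · rw [eps_smul_incl, ← mul_assoc, ← mul_assoc, eps_reflect_mul_arr, Q.tauE_tauE]
        · rw [smul_zero]))

theorem val_unit (x : IAlg k (Q.reflect l)) : Refl.val (unit k hl x) = unitPair k hl x := rfl

/-- Outside the orbit the first entry detects x. At a vertex r of the orbit the entries are a x for
the reversed arrows a starting at r, and left multiplication by a is injective on e_r s_lΛ^ı; this
requires at least one such arrow. -/
theorem unit_injective (hne : ∃ a, Q.tgt a = l) : Function.Injective (unit k hl) := by
  rw [injective_iff_map_eq_zero]
  intro x hx
  have hx : unitPair k hl x = 0 := by rw [← val_unit, hx, map_zero]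
  have h1 := congrArg Prod.fst hx
  rw [unitPair_fst, Prod.fst_zero, incl_eq_zero_iff] at h1
  have h2 : ∀ a, Q.InOrbit l (Q.tgt a) → arr k (Q.reflect l) a * x = 0 := by
    intro a ha
    have h3 := congrFun (congrArg Prod.snd hx) a
    rw [unitPair_snd, if_pos ha, Prod.snd_zero, Pi.zero_apply, incl_eq_zero_iff] at h3
    rw [← vert_src_mul_arr_reflect ha, mul_assoc, h3 _ (hl.not_inOrbit a)]
  rw [← one_mul x, ← sum_vert k (Q.reflect l), Finset.sum_mul]
  refine Finset.sum_eq_zero fun r _ => ?_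
  by_cases hr : Q.InOrbit l r
  · obtain ⟨a, rfl⟩ : ∃ a, Q.tgt a = r := by
      obtain ⟨a, ha⟩ := hne
      obtain rfl | rfl := hr
      · exact ⟨a, ha⟩
      · exact ⟨Q.tauE a, by rw [Q.tgt_tauE, ha]⟩
    refine eq_zero_of_arr_mul (a := a) ?_ ?_
    · rw [show (Q.reflect l).src a = Q.tgt a from if_pos hr, ← mul_assoc, vert_mul_vert]
    · rw [← mul_assoc, arr_reflect_mul_vert_tgt hr, h2 a hr]
  · exact h1 r hr

theorem unit_surjective : Function.Surjective (unit k hl) := by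
  intro p
  have hp := p.isReflFamily
  obtain ⟨x, hx⟩ : ∃ x, (Refl.val p).1 = incl k hl x := by
    have : ∀ r, ∃ x, vert k Q r • (Refl.val p).1 = incl k hl x := fun r => by
      by_cases hr : Q.InOrbit l r
      · exact ⟨0, by rw [Refl.vert_smul_val_fst hr, map_zero]⟩
      · obtain ⟨x, hx⟩ := exists_vert_smul_eq_incl hl hr (Refl.val p).1
        exact ⟨_, hx⟩
    choose x hx using this
    refine ⟨∑ r, x r, ?_⟩
    rw [map_sum, ← Finset.sum_congr rfl fun r _ => hx r, ← Finset.sum_smul, sum_vert, one_smul]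
  have hz : ∀ a, ∃ z, (vert k _ (Q.src a) * z = z) ∧
      (Q.InOrbit l (Q.tgt a) → (Refl.val p).2 a = incl k hl z) := fun a => by
    obtain ⟨z, hz⟩ := exists_vert_smul_eq_incl hl (hl.not_inOrbit a) ((Refl.val p).2 a)
    refine ⟨vert k _ (Q.src a) * z, by rw [← mul_assoc, vert_mul_vert], fun ha => ?_⟩
    rw [← hz]
    have := hp.gate_smul a
    rw [gate, if_pos ha] at this
    exact this.symm
  choose z hz1 hz2 using hz
  obtain ⟨n, h1, h2⟩ := (sum_arr_smul_incl_eq_zero_iff hl fun a _ => hz1 a).1 (by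
    rw [← hp.sum_eq_zero, Finset.sum_filter]
    refine Finset.sum_congr rfl fun a _ => ?_
    split_ifs with ha
    · rw [hz2 a ha]
    · rw [hp.eq_zero ha, smul_zero])
  -- The preimage is x' + n: the reversed arrows annihilate x', which lies outside the orbit, and
  -- `incl` annihilates n, which lies in it. So x' accounts for the first entry and n for the
  -- others.
  let x' := ∑ r with ¬ Q.InOrbit l r, vert k (Q.reflect l) r * x
  refine ⟨x' + n, Refl.val_injective (Prod.ext ?_ (funext fun a => ?_))⟩
  · rw [val_unit, unitPair_fst, map_add, (incl_eq_zero_iff hl).2 h1, add_zero, hx]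
    rw [← sub_eq_zero, ← map_sub, incl_eq_zero_iff]
    intro i hi
    rw [mul_sub, Finset.mul_sum, Finset.sum_eq_single i, ← mul_assoc, vert_mul_vert, sub_self]
    · intro r _ hr
      rw [← mul_assoc, vert_mul_vert_of_ne (Ne.symm hr), zero_mul]
    · intro h
      exact absurd (by simpa using hi) h
  · rw [val_unit, unitPair_snd]
    split_ifs with ha
    · have h3 : arr k (Q.reflect l) a * x' = 0 := by
        rw [Finset.mul_sum]
        refine Finset.sum_eq_zero fun r hr => ?_
        rw [← arr_reflect_mul_vert_tgt ha, mul_assoc, ← mul_assoc (vert k _ _),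
          vert_mul_vert_of_ne, zero_mul, mul_zero]
        exact fun h => (Finset.mem_filter.1 hr).2 (h ▸ ha)
      rw [mul_add, h3, zero_add, ← h2 a ha, hz2 a ha]
    · rw [hp.eq_zero ha]

variable {hl} {L : Type u} [AddCommGroup L] [Module k L] [Module (IAlg k Q) L]
  [IsScalarTower k (IAlg k Q) L] (p : Refl (k := k) Q l L hl)

/-- The map `x ↦` the first component of `x p`. -/
def actFst : IAlg k (Q.reflect l) →ₗ[k] L :=
  LinearMap.fst k L (E → L) ∘ₗ Refl.val ∘ₗ
    (LinearMap.toSpanSingleton (IAlg k (Q.reflect l)) _ p).restrictScalars k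

theorem actFst_apply (x : IAlg k (Q.reflect l)) : actFst p x = (Refl.val (x • p)).1 := rfl

theorem actFst_vert_mul (r : V) (x : IAlg k (Q.reflect l)) :
    actFst p (vert k _ r * x) = vert k Q r • actFst p x := by
  rw [actFst_apply, mul_smul, Refl.val_vert_smul, actFst_apply]

theorem actFst_arr_mul {a : E} (ha : ¬ Q.InOrbit l (Q.tgt a)) (x : IAlg k (Q.reflect l)) :
    actFst p (arr k _ a * x) = arr k Q a • actFst p x := by
  rw [actFst_apply, mul_smul, Refl.val_arr_smul, if_neg ha, actFst_apply]

theorem actFst_arr_mul_of_inOrbit {a : E} (ha : Q.InOrbit l (Q.tgt a))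
    (x : IAlg k (Q.reflect l)) : actFst p (arr k _ a * x) = (Refl.val (x • p)).2 a := by
  rw [actFst_apply, mul_smul, Refl.val_arr_smul, if_pos ha]

theorem actFst_eps_mul (x : IAlg k (Q.reflect l)) :
    actFst p (eps k _ * x) = eps k Q • actFst p x := by
  rw [actFst_apply, mul_smul, Refl.val_eps_smul, actFst_apply]

/-- The linear map `(x, y) ↦ (x p)₁ + ∑ a (y_a p)₁`. -/
def descPre : CoreflPre k Q l →ₗ[IAlg k Q] L :=
  linearMapOfGenerators (k := k)
    ((actFst p).coprod (∑ a with Q.InOrbit l (Q.tgt a),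
      (Algebra.lsmul k k L (arr k Q a)) ∘ₗ actFst p ∘ₗ LinearMap.proj a) ∘ₗ toPair)
    (fun r m => by
      simp only [LinearMap.comp_apply, LinearMap.coprod_apply, toPair_vert_smul,
        LinearMap.sum_apply, LinearMap.proj_apply, Algebra.lsmul_coe, actFst_vert_mul, smul_add,
        Finset.smul_sum]
      congr 1
      refine Finset.sum_congr rfl fun a _ => ?_
      split_ifs with h
      · rw [smul_smul, ← h, vert_tgt_mul_arr]
      · rw [map_zero, smul_zero, smul_smul, ← vert_tgt_mul_arr, ← mul_assoc,
          vert_mul_vert_of_ne (Ne.symm h), zero_mul, zero_smul])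
    (fun b m => by
      simp only [LinearMap.comp_apply, LinearMap.coprod_apply, toPair_arr_smul,
        LinearMap.sum_apply, LinearMap.proj_apply, Algebra.lsmul_coe, smul_add,
        Finset.smul_sum]
      rw [Finset.sum_eq_zero (f := fun a => arr k Q b • arr k Q a • _) fun a ha =>
        arr_smul_arr_smul_of_inOrbit hl b (Finset.mem_filter.1 ha).2 _, add_zero]
      split_ifs with hb
      · rw [map_zero, zero_add, Finset.sum_eq_single b]
        · dsimp only
          rw [if_pos rfl, actFst_vert_mul, smul_smul, arr_mul_vert_src]
        · intro a _ hab
          dsimp only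
          rw [if_neg hab, map_zero, smul_zero]
        · intro h
          exact absurd (by simpa using hb) h
      · rw [actFst_arr_mul p hb]
        simp)
    (fun m => by
      simp only [LinearMap.comp_apply, LinearMap.coprod_apply, toPair_eps_smul,
        LinearMap.sum_apply, LinearMap.proj_apply, Algebra.lsmul_coe, actFst_eps_mul, smul_add,
        Finset.smul_sum]
      congr 1
      refine Finset.sum_nbij' Q.tauE Q.tauE ?_ ?_ (fun a _ => Q.tauE_tauE a)
        (fun a _ => Q.tauE_tauE a) fun a _ => ?_
      · intro a ha
        simpa [Q.inOrbit_tgt_tau] using ha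
      · intro a ha
        simpa [Q.inOrbit_tgt_tau] using ha
      · rw [smul_smul, smul_smul, eps_mul_arr, Q.tauE_tauE])

theorem descPre_apply (m : CoreflPre k Q l) : descPre p m = actFst p (toPair m).1 +
    ∑ a with Q.InOrbit l (Q.tgt a), arr k Q a • actFst p ((toPair m).2 a) := by
  change ((actFst p).coprod _ ∘ₗ toPair) m = _
  simp [LinearMap.sum_apply]

theorem actFst_eq_zero {x : IAlg k (Q.reflect l)}
    (hx : ∀ i, ¬ Q.InOrbit l i → vert k _ i * x = 0) : actFst p x = 0 := by
  rw [← one_smul (IAlg k Q) (actFst p x), ← sum_vert, Finset.sum_smul]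
  refine Finset.sum_eq_zero fun r _ => ?_
  by_cases hr : Q.InOrbit l r
  · exact Refl.vert_smul_val_fst hr (x • p)
  · rw [← actFst_vert_mul, hx r hr, map_zero]

/-- The homomorphism from `Corefl` given by an element of `F_l⁺ L`. -/
def desc : Corefl k hl →ₗ[IAlg k Q] L :=
  (coreflRel k hl).liftQ (descPre p) fun m hm => by
    obtain ⟨h1, n, h2, h3⟩ := mem_coreflRel.1 hm
    rw [LinearMap.mem_ker, descPre_apply, actFst_eq_zero p h1, zero_add]
    -- On a relation given by n the sum is ∑ a (n p)_a, which vanishes because n p is again an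
    -- element of F_l⁺ L.
    have hn := (n • p).isReflFamily
    rw [← hn.sum_eq_zero, Finset.sum_filter]
    refine Finset.sum_congr rfl fun a _ => ?_
    split_ifs with ha
    · have h4 : ∀ x, arr k Q a • actFst p x = arr k Q a • actFst p (vert k _ (Q.src a) * x) :=
        fun x => by rw [actFst_vert_mul, smul_smul, arr_mul_vert_src]
      rw [h4, h3 a ha, actFst_arr_mul_of_inOrbit p ha]
    · rw [hn.eq_zero ha, smul_zero]

theorem desc_incl (x : IAlg k (Q.reflect l)) : desc p (incl k hl x) = actFst p x := by
  change descPre p (ofPair (x, 0)) = _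
  rw [descPre_apply, toPair_ofPair]
  simp

/-- The identity expressing that `desc p` is adjoint to the map x ↦ x p. -/
theorem reflMap_desc_unit (x : IAlg k (Q.reflect l)) :
    reflMap (k := k) Q l hl (desc p) (unit k hl x) = x • p := by
  refine Refl.val_injective (Prod.ext ?_ (funext fun a => ?_))
  · rw [Refl.val_reflMap, val_unit, unitPair_fst, desc_incl]
    rfl
  · rw [Refl.val_reflMap, val_unit]
    dsimp only
    rw [unitPair_snd]
    split_ifs with ha
    · rw [desc_incl, actFst_arr_mul_of_inOrbit p ha]
    · rw [map_zero, (x • p).isReflFamily.eq_zero ha]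

end Corefl

end Unit

/-! ### F_l⁺ T is free of rank one on the universal family. -/

namespace IsGenericFamily

variable {k : Type u} [Field k] {V E : Type u} [Fintype V] [DecidableEq V] [Fintype E]
  {Q : IQuiver V E} {l : V} {T : Type u} [AddCommGroup T] [Module k T] [Module (IAlg k Q) T]
  [IsScalarTower k (IAlg k Q) T] {u : T × (E → T)}

/-- `F_l⁺ T` is free of rank one, generated by the universal family. -/
theorem bijective_smul (hl : Q.IsSink l) (hne : ∃ a, Q.tgt a = l)
    (hu : IsGenericFamily (k := k) Q l u) :
    Function.Bijective fun x : IAlg k (Q.reflect l) =>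
      x • (Refl.mk u hu.isReflFamily : Refl (k := k) Q l T hl) := by
  let u₀ : Refl (k := k) Q l T hl := Refl.mk u hu.isReflFamily
  -- The map g : T → `Corefl` sends u to the unit of 1, and `desc u₀` goes back. Only `desc u₀ ∘ g =
  -- id` is needed.
  obtain ⟨g, h1, h2⟩ := hu.exists_lift _ (Corefl.isReflFamily_unitPair hl 1)
  have hg : reflMap (k := k) Q l hl g u₀ = Corefl.unit k hl 1 :=
    Refl.val_injective (Prod.ext h1 (funext h2))
  have hg' : ∀ x : IAlg k (Q.reflect l), reflMap (k := k) Q l hl g (x • u₀) =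
      Corefl.unit k hl x := fun x => by
    rw [map_smul, hg, ← map_smul, smul_eq_mul, mul_one]
  have hd : Corefl.desc u₀ ∘ₗ g = LinearMap.id := by
    refine hu.hom_ext ?_ fun a => ?_
    · have := congrArg (fun y => (Refl.val y).1) (Corefl.reflMap_desc_unit u₀ 1)
      rw [← hg, one_smul] at this
      exact this
    · have := congrArg (fun y => (Refl.val y).2 a) (Corefl.reflMap_desc_unit u₀ 1)
      rw [← hg, one_smul] at this
      exact this
  constructor
  · intro x y hxy
    refine Corefl.unit_injective hl hne ?_
    rw [← hg', ← hg']
    exact congrArg _ hxy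
  · intro z
    -- Pushing z to `Corefl` produces x; pulling back along `desc u₀` turns the unit of x into x u₀
    -- and returns z.
    obtain ⟨x, hx⟩ := Corefl.unit_surjective hl (reflMap (k := k) Q l hl g z)
    refine ⟨x, ?_⟩
    change x • u₀ = z
    rw [← Corefl.reflMap_desc_unit, hx]
    refine Refl.val_injective (Prod.ext ?_ (funext fun a => ?_))
    · exact LinearMap.congr_fun hd _
    · exact LinearMap.congr_fun hd _

end IsGenericFamily

/-! ### Restriction of scalars between categories of finite-dimensional modules. -/

section Restriction

variable (k : Type u) [Field k] {A B : Type u} [Ring A] [Algebra k A] [Ring B] [Algebra k B]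

theorem finite_iff_of_addEquiv (M : ModuleCat.{u} A) (N : ModuleCat.{u} B) (e : M ≃+ N)
    (h : ∀ (c : k) (m : M), e (algebraMap k A c • m) = algebraMap k B c • e m) :
    Module.Finite k M ↔ Module.Finite k N := by
  let e' : M ≃ₗ[k] N := { e with map_smul' := h }
  exact ⟨fun _ => Module.Finite.equiv e', fun _ => Module.Finite.equiv e'.symm⟩

instance finite_isClosedUnderIsomorphisms : ObjectProperty.IsClosedUnderIsomorphisms
    (fun M : ModuleCat.{u} A => Module.Finite k M) where
  of_iso {M N} i h := (finite_iff_of_addEquiv k M N i.toLinearEquiv.toAddEquiv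
    fun _ m => map_smul i.toLinearEquiv _ m).1 h

/-- Restriction of scalars along an isomorphism, as an equivalence `mod B ≌ mod A`. -/
def FDMod.restrictEquiv (e : A ≃ₐ[k] B) : FDMod k B ≌ FDMod k A :=
  (ModuleCat.restrictScalarsEquivalenceOfRingEquiv e.toRingEquiv).congrFullSubcategory
    (P := fun M : ModuleCat.{u} B => Module.Finite k M)
    (Q := fun M : ModuleCat.{u} A => Module.Finite k M) (by
      refine funext fun M : ModuleCat.{u} B => propext ?_
      exact finite_iff_of_addEquiv k ((ModuleCat.restrictScalars e.toRingEquiv.toRingHom).obj M) M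
        (AddEquiv.refl M) fun c m => congrArg (fun b : B => (b • m : M)) (e.commutes c))

instance FDMod.restrictEquiv_linear (e : A ≃ₐ[k] B) : (restrictEquiv k e).functor.Linear k where
  map_smul f r := ObjectProperty.hom_ext _ <|
    Functor.Linear.map_smul
      (F := (ModuleCat.restrictScalarsEquivalenceOfRingEquiv e.toRingEquiv).functor) f.hom r

end Restriction

/-! ### The isomorphism End(T)^op ≅ s_lΛ^ı and the comparison of functors. -/

namespace IsGenericFamily

variable {k : Type u} [Field k] {V E : Type u} [Fintype V] [DecidableEq V] [Fintype E]
  {Q : IQuiver V E} {l : V} {T : ModuleCat.{u} (IAlg k Q)} {u : T × (E → T)}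
  (hl : Q.IsSink l) (hne : ∃ a, Q.tgt a = l) (hu : IsGenericFamily (k := k) Q l u)

/-- The universal family as an element of `F_l⁺ T`. -/
def elem : Refl (k := k) Q l T hl := Refl.mk u hu.isReflFamily

/-- The isomorphism `Hom(T, X) ≅ F_l⁺ X` given by the universal family. -/
def homEquiv (X : ModuleCat.{u} (IAlg k Q)) : HomMod T X ≃ₗ[k] Refl (k := k) Q l X hl :=
  LinearEquiv.ofBijective
    { toFun := fun g => reflMap (k := k) Q l hl g.lin (hu.elem hl)
      map_add' := fun _ _ => rfl
      map_smul' := fun _ _ => rfl }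
    ⟨fun g h hgh => by
      have := congrArg Refl.val hgh
      exact hu.hom_ext (congrArg Prod.fst this) fun a => congrFun (congrArg Prod.snd this) a,
    fun p => by
      obtain ⟨g, h1, h2⟩ := hu.exists_lift _ p.isReflFamily
      exact ⟨g, Refl.val_injective (Prod.ext h1 (funext h2))⟩⟩

theorem homEquiv_apply {X : ModuleCat.{u} (IAlg k Q)} (g : HomMod T X) :
    hu.homEquiv hl X g = reflMap (k := k) Q l hl g.lin (hu.elem hl) := rfl

/-- The isomorphism `x ↦ x u` of `s_l Λ^ı` with `F_l⁺ T`. -/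
def smulEquiv : IAlg k (Q.reflect l) ≃ₗ[k] Refl (k := k) Q l T hl :=
  LinearEquiv.ofBijective
    ((LinearMap.toSpanSingleton (IAlg k (Q.reflect l)) _ (hu.elem hl)).restrictScalars k)
    (hu.bijective_smul hl hne)

theorem smulEquiv_apply (x : IAlg k (Q.reflect l)) :
    hu.smulEquiv hl hne x = x • hu.elem hl := rfl

/-- The linear isomorphism `End(T)^op ≅ s_l Λ^ı`. -/
def endLinearEquiv : EndOp T ≃ₗ[k] IAlg k (Q.reflect l) :=
  (MulOpposite.opLinearEquiv k).symm ≪≫ₗ (hu.homEquiv hl T ≪≫ₗ (hu.smulEquiv hl hne).symm)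

/-- The defining property: the scalar attached to b moves u to F_l⁺(b)(u), and freeness makes it
unique. -/
theorem endLinearEquiv_smul (b : EndOp T) : hu.endLinearEquiv hl hne b • hu.elem hl =
    reflMap (k := k) Q l hl (b.unop : T →ₗ[IAlg k Q] T) (hu.elem hl) :=
  (hu.smulEquiv hl hne).apply_symm_apply _

/-- The isomorphism `End(T)^op ≅ s_l Λ^ı` of algebras. -/
def endAlgEquiv : EndOp T ≃ₐ[k] IAlg k (Q.reflect l) :=
  AlgEquiv.ofLinearEquiv (hu.endLinearEquiv hl hne)
    ((hu.smulEquiv hl hne).injective (by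
      rw [smulEquiv_apply, smulEquiv_apply, endLinearEquiv_smul, one_smul]
      rfl))
    -- Since F_l⁺(c) is linear, the scalar of b passes through it to the left: F_l⁺(c) F_l⁺(b) u =
    -- x_b x_c u. This reversal is the reason for the opposite algebra.
    (fun b c => (hu.smulEquiv hl hne).injective (by
      rw [smulEquiv_apply, smulEquiv_apply, endLinearEquiv_smul, mul_smul, endLinearEquiv_smul,
        ← map_smul, endLinearEquiv_smul]
      rfl))

theorem homEquiv_smul {X : ModuleCat.{u} (IAlg k Q)} (b : EndOp T) (g : HomMod T X) :
    hu.homEquiv hl X (b • g) = hu.endAlgEquiv hl hne b • hu.homEquiv hl X g := by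
  rw [homEquiv_apply, homEquiv_apply, ← map_smul]
  change _ = reflMap (k := k) Q l hl g.lin (hu.endLinearEquiv hl hne b • hu.elem hl)
  rw [endLinearEquiv_smul]
  rfl

/-- The isomorphism `F_l⁺ X ≅ Hom(T, X)` of modules over `End(T)^op`. -/
def homModIso (X : ModuleCat.{u} (IAlg k Q)) :
    (ModuleCat.restrictScalars (hu.endAlgEquiv hl hne).toRingEquiv.toRingHom).obj
      (ModuleCat.of (IAlg k (Q.reflect l)) (Refl (k := k) Q l X hl)) ≅
    ModuleCat.of (EndOp T) (HomMod T X) :=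
  (LinearEquiv.toModuleIso (X₁ := ModuleCat.of (EndOp T) (HomMod T X))
    (X₂ := (ModuleCat.restrictScalars (hu.endAlgEquiv hl hne).toRingEquiv.toRingHom).obj
      (ModuleCat.of (IAlg k (Q.reflect l)) (Refl (k := k) Q l X hl)))
    { (hu.homEquiv hl X).toAddEquiv with
      map_smul' := hu.homEquiv_smul hl hne }).symm

/-- `Hom(T, -)` is the reflection functor followed by restriction of scalars. -/
def functorIso {T : FDMod k (IAlg k Q)} {u : T.obj × (E → T.obj)}
    (hu : IsGenericFamily (k := k) Q l u) :
    reflFunctor k Q l hl ⋙ (FDMod.restrictEquiv k (hu.endAlgEquiv hl hne)).functor ≅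
      homFunctor k T :=
  (NatIso.ofComponents
    (fun X => ObjectProperty.isoMk _ (hu.homModIso hl hne X.obj).symm)
    (fun _ => ObjectProperty.hom_ext _ (ModuleCat.hom_ext (LinearMap.ext fun _ => rfl)))).symm

end IsGenericFamily

/-! ### Uniqueness of projective covers and of transposes. -/

section ProjectiveCover

variable {R : Type*} [Ring R] {P P' X : Type*} [AddCommGroup P] [Module R P] [AddCommGroup P']
  [Module R P'] [AddCommGroup X] [Module R X]

/-- Surjectivity of p means that the image of f together with ker p' is everything; a superfluous
kernel can be dropped. -/
theorem LinearMap.surjective_of_isSuperfluous {p : P →ₗ[R] X} {p' : P' →ₗ[R] X}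
    (hp : Function.Surjective p) (hs : IsSuperfluous (ker p')) {f : P →ₗ[R] P'}
    (hf : p' ∘ₗ f = p) : Function.Surjective f := by
  rw [← range_eq_top]
  refine hs _ (eq_top_iff.2 fun x _ => ?_)
  obtain ⟨y, hy⟩ := hp (p' x)
  refine Submodule.mem_sup.2 ⟨x - f y, ?_, f y, ⟨y, rfl⟩, by simp⟩
  rw [mem_ker, map_sub, ← comp_apply, hf, hy, sub_self]

/-- Projective covers are unique. -/
theorem exists_linearEquiv_of_isSuperfluous [Module.Projective R P] [Module.Projective R P']
    {p : P →ₗ[R] X} {p' : P' →ₗ[R] X} (hp : Function.Surjective p) (hp' : Function.Surjective p')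
    (hs : IsSuperfluous (LinearMap.ker p)) (hs' : IsSuperfluous (LinearMap.ker p')) :
    ∃ e : P ≃ₗ[R] P', ∀ x, p' (e x) = p x := by
  obtain ⟨f, hf⟩ := Module.projective_lifting_property p' p hp'
  have hsurj := LinearMap.surjective_of_isSuperfluous hp hs' hf
  -- A section g of f is again a map over X, so it is surjective by the same argument, and f is
  -- injective.
  obtain ⟨g, hg⟩ := Module.projective_lifting_property f LinearMap.id hsurj
  have hgs : Function.Surjective g := LinearMap.surjective_of_isSuperfluous hp' hs (by
    rw [← hf, LinearMap.comp_assoc, hg, LinearMap.comp_id])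
  have hgf : ∀ y, f (g y) = y := LinearMap.congr_fun hg
  refine ⟨LinearEquiv.ofBijective f ⟨fun x y hxy => ?_, hsurj⟩, LinearMap.congr_fun hf⟩
  obtain ⟨x, rfl⟩ := hgs x
  obtain ⟨y, rfl⟩ := hgs y
  rw [hgf, hgf] at hxy
  rw [hxy]

end ProjectiveCover

section Transpose

variable {A : Type u} [Ring A] {X P₀ P₁ P₀' P₁' : Type u} [AddCommGroup X] [Module Aᵐᵒᵖ X]
  [AddCommGroup P₀] [Module Aᵐᵒᵖ P₀] [AddCommGroup P₁] [Module Aᵐᵒᵖ P₁]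
  [AddCommGroup P₀'] [Module Aᵐᵒᵖ P₀'] [AddCommGroup P₁'] [Module Aᵐᵒᵖ P₁']

theorem nonempty_transpose_equiv {p₁ : P₁ →ₗ[Aᵐᵒᵖ] P₀} {p₁' : P₁' →ₗ[Aᵐᵒᵖ] P₀'}
    (e₀ : P₀ ≃ₗ[Aᵐᵒᵖ] P₀') (e₁ : P₁ ≃ₗ[Aᵐᵒᵖ] P₁') (h : ∀ x, p₁' (e₁ x) = e₀ (p₁ x)) :
    Nonempty (Transpose p₁ ≃ₗ[A] Transpose p₁') := by
  refine ⟨Submodule.Quotient.equiv _ _ (LinearEquiv.congrLeft A A e₁) ?_⟩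
  ext f
  simp only [Submodule.mem_map, LinearMap.mem_range]
  constructor
  · rintro ⟨_, ⟨g, rfl⟩, rfl⟩
    refine ⟨g ∘ₗ e₀.symm.toLinearMap, LinearMap.ext fun x => ?_⟩
    obtain ⟨x, rfl⟩ := e₁.surjective x
    change g (e₀.symm (p₁' (e₁ x))) = g (p₁ (e₁.symm (e₁ x)))
    rw [h, e₀.symm_apply_apply, e₁.symm_apply_apply]
  · rintro ⟨g, rfl⟩
    refine ⟨_, ⟨g ∘ₗ e₀.toLinearMap, rfl⟩, LinearMap.ext fun x => ?_⟩
    obtain ⟨x, rfl⟩ := e₁.surjective x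
    change g (e₀ (p₁ (e₁.symm (e₁ x)))) = g (p₁' (e₁ x))
    rw [h, e₁.symm_apply_apply]

/-- An isomorphism of the covers of X identifies the kernels of p₀ and p₀', whereupon P₁ and P₁' are
two projective covers of `ker p₀'`. -/
theorem IsMinProjPres.nonempty_transpose_equiv {p₁ : P₁ →ₗ[Aᵐᵒᵖ] P₀} {p₀ : P₀ →ₗ[Aᵐᵒᵖ] X}
    {p₁' : P₁' →ₗ[Aᵐᵒᵖ] P₀'} {p₀' : P₀' →ₗ[Aᵐᵒᵖ] X} (h : IsMinProjPres p₁ p₀)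
    (h' : IsMinProjPres p₁' p₀') : Nonempty (Transpose p₁ ≃ₗ[A] Transpose p₁') := by
  have := h.projective₀
  have := h.projective₁
  have := h'.projective₀
  have := h'.projective₁
  obtain ⟨e₀, he₀⟩ := exists_linearEquiv_of_isSuperfluous h.surjective h'.surjective
    h.minimal₀ h'.minimal₀
  let q : P₁ →ₗ[Aᵐᵒᵖ] LinearMap.ker p₀' := (e₀.toLinearMap ∘ₗ p₁).codRestrict _ fun x => by
    rw [LinearMap.mem_ker]
    exact (he₀ _).trans (h.exact.apply_apply_eq_zero x)
  let q' : P₁' →ₗ[Aᵐᵒᵖ] LinearMap.ker p₀' := p₁'.codRestrict _ h'.exact.apply_apply_eq_zero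
  have hk : LinearMap.ker q = LinearMap.ker p₁ := by
    ext x
    simp [q]
  have hk' : LinearMap.ker q' = LinearMap.ker p₁' := LinearMap.ker_codRestrict _ _ _
  obtain ⟨e₁, he₁⟩ := exists_linearEquiv_of_isSuperfluous (p := q) (p' := q')
    (fun ⟨y, hy⟩ => by
      obtain ⟨y, rfl⟩ := e₀.surjective y
      obtain ⟨x, rfl⟩ := (h.exact y).1 ((he₀ y).symm.trans hy)
      exact ⟨x, rfl⟩)
    (fun ⟨y, hy⟩ => by
      obtain ⟨x, rfl⟩ := (h'.exact y).1 hy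
      exact ⟨x, rfl⟩)
    (hk ▸ h.minimal₁) (hk' ▸ h'.minimal₁)
  exact _root_.nonempty_transpose_equiv e₀ e₁ fun x => congrArg Subtype.val (he₁ x)

end Transpose

section Opposite

variable (A : Type*) [Ring A]

/-- The right regular module is free of rank one. -/
def regularOpEquiv : Aᵐᵒᵖ ≃ₗ[Aᵐᵒᵖ] A where
  toFun := MulOpposite.unop
  invFun := MulOpposite.op
  map_add' _ _ := rfl
  map_smul' _ _ := rfl

instance free_regularOp : Module.Free Aᵐᵒᵖ A := .of_equiv (regularOpEquiv A)

instance finite_regularOp : Module.Finite Aᵐᵒᵖ A := .equiv (regularOpEquiv A)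

end Opposite

/-! ### The minimal projective presentation of D E_i. -/

section Presentation

open IAlg

variable (k : Type u) [Field k] {V E : Type u} [Fintype V] (Q : IQuiver V E) (r : V)

/-- The right module `e_r Λ^ı`. -/
def vertRight : Submodule (IAlg k Q)ᵐᵒᵖ (IAlg k Q) where
  carrier := {x | vert k Q r * x = x}
  zero_mem' := by simp
  add_mem' {x y} hx hy := by
    rw [Set.mem_ofPred_eq] at *
    rw [mul_add, hx, hy]
  smul_mem' c x hx := by
    rw [Set.mem_ofPred_eq] at *
    rw [MulOpposite.smul_eq_mul_unop, ← mul_assoc, hx]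

/-- The right module `⨁ e_{src a} Λ^ı`, where `a` runs through the arrows ending in `r`. -/
def arrRight : Submodule (IAlg k Q)ᵐᵒᵖ (E → IAlg k Q) where
  carrier := {y | (∀ a, Q.tgt a = r → vert k Q (Q.src a) * y a = y a) ∧
    ∀ a, Q.tgt a ≠ r → y a = 0}
  zero_mem' := by simp
  add_mem' {x y} hx hy :=
    ⟨fun a ha => by rw [Pi.add_apply, mul_add, hx.1 a ha, hy.1 a ha],
      fun a ha => by rw [Pi.add_apply, hx.2 a ha, hy.2 a ha, add_zero]⟩
  smul_mem' c x hx :=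
    ⟨fun a ha => by
      rw [Pi.smul_apply, MulOpposite.smul_eq_mul_unop, ← mul_assoc, hx.1 a ha],
      fun a ha => by rw [Pi.smul_apply, hx.2 a ha, smul_zero]⟩

variable {k Q r}

/-- The projection onto `vertRight`. -/
def toVertRight : IAlg k Q →ₗ[(IAlg k Q)ᵐᵒᵖ] vertRight k Q r where
  toFun x := ⟨vert k Q r * x, show _ * (_ * _) = _ by rw [← mul_assoc, vert_mul_vert]⟩
  map_add' x y := Subtype.ext (mul_add _ _ _)
  map_smul' c x := Subtype.ext (mul_assoc _ _ _).symm

theorem toVertRight_coe (x : vertRight k Q r) : toVertRight x.1 = x := Subtype.ext x.2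

instance : Module.Projective (IAlg k Q)ᵐᵒᵖ (vertRight k Q r) :=
  .of_split (vertRight k Q r).subtype toVertRight (LinearMap.ext toVertRight_coe)

instance : Module.Finite (IAlg k Q)ᵐᵒᵖ (vertRight k Q r) :=
  .of_surjective toVertRight fun x => ⟨x.1, toVertRight_coe x⟩

variable [DecidableEq V]

/-- The projection onto `arrRight`. -/
def toArrRight : (E → IAlg k Q) →ₗ[(IAlg k Q)ᵐᵒᵖ] arrRight k Q r where
  toFun y := ⟨fun a => if Q.tgt a = r then vert k Q (Q.src a) * y a else 0,
    fun a ha => by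
      dsimp only
      rw [if_pos ha, ← mul_assoc, vert_mul_vert],
    fun a ha => if_neg ha⟩
  map_add' x y := Subtype.ext (funext fun a => by
    change (if Q.tgt a = r then vert k Q (Q.src a) * (x a + y a) else 0) =
      (if Q.tgt a = r then vert k Q (Q.src a) * x a else 0) +
        if Q.tgt a = r then vert k Q (Q.src a) * y a else 0
    split_ifs
    · exact mul_add _ _ _
    · simp)
  map_smul' c x := Subtype.ext (funext fun a => by
    change (if Q.tgt a = r then vert k Q (Q.src a) * (x a * c.unop) else 0) =
      (if Q.tgt a = r then vert k Q (Q.src a) * x a else 0) * c.unop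
    split_ifs
    · exact (mul_assoc _ _ _).symm
    · simp)

theorem toArrRight_apply (y : E → IAlg k Q) (a : E) : (toArrRight (r := r) y).1 a =
    if Q.tgt a = r then vert k Q (Q.src a) * y a else 0 := rfl

theorem toArrRight_coe (x : arrRight k Q r) : toArrRight x.1 = x :=
  Subtype.ext (funext fun a => by
    rw [toArrRight_apply]
    split_ifs with h
    · exact x.2.1 a h
    · exact (x.2.2 a h).symm)

instance [Finite E] : Module.Projective (IAlg k Q)ᵐᵒᵖ (arrRight k Q r) :=
  .of_split (arrRight k Q r).subtype toArrRight (LinearMap.ext toArrRight_coe)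

instance [Finite E] : Module.Finite (IAlg k Q)ᵐᵒᵖ (arrRight k Q r) :=
  .of_surjective toArrRight fun x => ⟨x.1, toArrRight_coe x⟩

theorem genSimple_vert_smul (i s : V) (m : GenSimple k Q i) : (vert k Q s • m : GenSimple k Q i) =
    ((if s = i then m.1 else 0, if s = Q.tauV i then m.2 else 0) : k × k) := by
  rw [RepData.vert_smul]; rfl

theorem genSimple_arr_smul (i : V) (a : E) (m : GenSimple k Q i) : arr k Q a • m = 0 := by
  rw [RepData.arr_smul]; rfl

theorem genSimple_eps_smul (i : V) (m : GenSimple k Q i) :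
    (eps k Q • m : GenSimple k Q i) = ((0, m.1) : k × k) := by
  rw [RepData.eps_smul]; rfl

variable (k Q) in
/-- The second component of an element of a generalized simple module. -/
def genSimpleSnd (i : V) : GenSimple k Q i →ₗ[k] k := LinearMap.snd k k k

variable (k Q) in
/-- The projective cover `e_{τ i} Λ^ı → D E_i`. -/
def vertToDual (i : V) :
    vertRight k Q (Q.tauV i) →ₗ[(IAlg k Q)ᵐᵒᵖ] StdDual k (GenSimple k Q i) where
  toFun x := (genSimpleSnd k Q i ∘ₗ Algebra.lsmul k k _ x.1 : GenSimple k Q i →ₗ[k] k)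
  map_add' x y := LinearMap.ext fun m =>
    (congrArg (genSimpleSnd k Q i) (add_smul x.1 y.1 m)).trans (map_add _ _ _)
  map_smul' c x := LinearMap.ext fun m => congrArg (genSimpleSnd k Q i) (mul_smul x.1 c.unop m)

theorem vertToDual_apply (i : V) (x : vertRight k Q (Q.tauV i)) (m : GenSimple k Q i) :
    (vertToDual k Q i x).lin m = genSimpleSnd k Q i (x.1 • m) := rfl

variable [Fintype E]

variable (k Q r) in
/-- The map `(y_a)_a ↦ ∑ a y_a`. -/
def arrToVert : arrRight k Q r →ₗ[(IAlg k Q)ᵐᵒᵖ] vertRight k Q r where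
  toFun y := ⟨∑ a with Q.tgt a = r, arr k Q a * y.1 a, by
    change vert k Q r * _ = _
    rw [Finset.mul_sum]
    refine Finset.sum_congr rfl fun a ha => ?_
    have h : vert k Q r * arr k Q a = arr k Q a := by
      rw [← (Finset.mem_filter.1 ha).2]
      exact vert_tgt_mul_arr k Q a
    rw [← mul_assoc, h]⟩
  map_add' x y := Subtype.ext (by
    change ∑ a with Q.tgt a = r, arr k Q a * (x.1 a + y.1 a) = _ + _
    simp only [mul_add, Finset.sum_add_distrib])
  map_smul' c x := Subtype.ext (by
    change ∑ a with Q.tgt a = r, arr k Q a * (x.1 a * c.unop) = (∑ a with _, _) * c.unop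
    rw [Finset.sum_mul]
    simp only [mul_assoc])

theorem arrToVert_apply (y : arrRight k Q r) :
    (arrToVert k Q r y).1 = ∑ a with Q.tgt a = r, arr k Q a * y.1 a := rfl

theorem ker_arrToVert : LinearMap.ker (arrToVert k Q r) = ⊥ := by
  rw [LinearMap.ker_eq_bot']
  intro y hy
  have h := eq_zero_of_sum_arr_mul (s := {a | Q.tgt a = r}) (y := y.1)
    (fun a ha => y.2.1 a (Finset.mem_filter.1 ha).2) (congrArg Subtype.val hy)
  refine Subtype.ext (funext fun a => ?_)
  by_cases ha : Q.tgt a = r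
  · exact h a (by simpa using ha)
  · exact y.2.2 a ha

/-- In the normal form of `vert_mul_eq` at τi, only c and d act on E_i. Hence the kernel of
`vertToDual` is the part with c = d = 0, which is the image of `arrToVert`. -/
theorem genSimpleSnd_smul (i : V) (c d : k) (y : E → IAlg k Q) (m : GenSimple k Q i) :
    genSimpleSnd k Q i ((c • vert k Q (Q.tauV i) + d • (vert k Q (Q.tauV i) * eps k Q) +
      ∑ a with Q.tgt a = Q.tauV i, arr k Q a * y a) • m) = c * m.2 + d * m.1 := by
  have h1 : (∑ a with Q.tgt a = Q.tauV i, arr k Q a * y a) • m = 0 := by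
    rw [Finset.sum_smul]
    exact Finset.sum_eq_zero fun a _ => by rw [mul_smul, genSimple_arr_smul]
  have h2 : genSimpleSnd k Q i (vert k Q (Q.tauV i) • m) = m.2 := by
    rw [genSimple_vert_smul]
    exact if_pos rfl
  have h3 : genSimpleSnd k Q i (vert k Q (Q.tauV i) • eps k Q • m) = m.1 := by
    rw [genSimple_vert_smul]
    refine (if_pos rfl).trans ?_
    rw [genSimple_eps_smul]
  rw [add_smul, add_smul, h1, add_zero, smul_assoc, smul_assoc, mul_smul, map_add,
    (genSimpleSnd k Q i).map_smul c, (genSimpleSnd k Q i).map_smul d, h2, h3, smul_eq_mul,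
    smul_eq_mul]

theorem exists_eq_arrToVert {i : V} {x : vertRight k Q (Q.tauV i)} (hx : vertToDual k Q i x = 0) :
    ∃ y, arrToVert k Q (Q.tauV i) y = x := by
  obtain ⟨c, d, y, hy, h⟩ := vert_mul_eq (Q.tauV i) x.1
  rw [show vert k Q (Q.tauV i) * x.1 = x.1 from x.2] at h
  have key : ∀ m : GenSimple k Q i, c * m.2 + d * m.1 = 0 := fun m => by
    rw [← genSimpleSnd_smul i c d y m, ← h, ← vertToDual_apply, hx]
    rfl
  have hc : c = 0 := by simpa using key ((0, 1) : k × k)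
  have hd : d = 0 := by simpa using key ((1, 0) : k × k)
  refine ⟨toArrRight y, Subtype.ext ?_⟩
  rw [h, hc, hd, zero_smul, zero_smul, zero_add, zero_add, arrToVert_apply]
  refine Finset.sum_congr rfl fun a ha => ?_
  rw [toArrRight_apply, if_pos (Finset.mem_filter.1 ha).2, hy]

/-- Λ^ı e_r is supported on the orbit of the sink r, whereas y_a lies in e_{src a}Λ^ı with src a
outside of it. -/
theorem arrToVert_mul_vert {r : V} (hr : Q.IsSink r) (y : arrRight k Q r) :
    (arrToVert k Q r y).1 * vert k Q r = 0 := by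
  rw [arrToVert_apply, Finset.sum_mul]
  refine Finset.sum_eq_zero fun a ha => ?_
  obtain ⟨c, d, h⟩ := mul_vert_of_isSink hr (y.1 a)
  rw [mul_assoc, ← y.2.1 a (Finset.mem_filter.1 ha).2, mul_assoc, h, mul_add, mul_smul_comm,
    mul_smul_comm, vert_mul_vert_of_ne (hr a), eps_mul_vert, ← mul_assoc, vert_mul_vert_of_ne]
  · simp
  · exact fun h => hr.not_inOrbit a (Or.inr h)

/-- The second coordinate on E_i, which sits at τi, generates D E_i as a right module: composing it
with ε gives the first coordinate. This is why e_{τi}Λ^ı, rather than e_iΛ^ı, is the cover. -/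
theorem isMinProjPres {i : V} (hi : Q.IsSink (Q.tauV i)) :
    IsMinProjPres (arrToVert k Q (Q.tauV i)) (vertToDual k Q i) where
  finite₀ := inferInstance
  finite₁ := inferInstance
  projective₀ := inferInstance
  projective₁ := inferInstance
  surjective φ := by
    let x : IAlg k Q := φ.lin ((0, 1) : k × k) • vert k Q (Q.tauV i) +
      φ.lin ((1, 0) : k × k) • (vert k Q (Q.tauV i) * eps k Q) +
        -- The zero summand keeps x in the shape required by `genSimpleSnd_smul`.
        ∑ a with Q.tgt a = Q.tauV i, arr k Q a * (0 : E → IAlg k Q) a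
    have hx : vert k Q (Q.tauV i) * x = x := by
      simp [x, mul_add, ← mul_assoc, vert_mul_vert]
    refine ⟨⟨x, hx⟩, LinearMap.ext fun m => ?_⟩
    refine (genSimpleSnd_smul i _ _ _ m).trans ?_
    have hm : ∀ m : k × k, m = m.1 • (1, 0) + m.2 • (0, 1) := fun m => by ext <;> simp
    refine Eq.trans ?_ (congrArg φ.lin (hm m)).symm
    refine Eq.trans ?_ (map_add φ.lin (m.1 • ((1, 0) : k × k)) (m.2 • ((0, 1) : k × k))).symm
    refine Eq.trans ?_ (congrArg₂ (· + ·) (map_smul φ.lin m.1 ((1, 0) : k × k))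
      (map_smul φ.lin m.2 ((0, 1) : k × k))).symm
    exact (add_comm _ _).trans (congrArg₂ (· + ·) (mul_comm _ _) (mul_comm _ _))
  exact x := by
    refine ⟨exists_eq_arrToVert, ?_⟩
    rintro ⟨y, rfl⟩
    refine LinearMap.ext fun m => ?_
    have := genSimpleSnd_smul i 0 0 y.1 m
    rw [zero_smul, zero_smul, zero_add, zero_add, zero_mul, zero_mul, zero_add] at this
    exact this
  minimal₀ U hU := by
    let o : vertRight k Q (Q.tauV i) := ⟨vert k Q (Q.tauV i), vert_mul_vert _⟩
    obtain ⟨z, hz, w, hw, hzw⟩ := Submodule.mem_sup.1 (hU ▸ Submodule.mem_top (x := o))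
    obtain ⟨y, rfl⟩ := exists_eq_arrToVert hz
    -- An element w = e_{τi} - ∑ a y_a of U, multiplied on the right by e_{τi}, becomes e_{τi}
    -- itself, the generator of the module.
    have ho : o ∈ U := by
      convert U.smul_mem (MulOpposite.op (vert k Q (Q.tauV i))) hw
      refine Subtype.ext ?_
      have h1 : w.1 = vert k Q (Q.tauV i) - (arrToVert k Q (Q.tauV i) y).1 :=
        eq_sub_of_add_eq' (congrArg Subtype.val hzw)
      change vert k Q (Q.tauV i) = w.1 * vert k Q (Q.tauV i)
      rw [h1, sub_mul, arrToVert_mul_vert hi, vert_mul_vert, sub_zero]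
    rw [eq_top_iff]
    intro x _
    convert U.smul_mem (MulOpposite.op x.1) ho
    exact Subtype.ext x.2.symm
  minimal₁ U hU := by rwa [ker_arrToVert, bot_sup_eq] at hU

end Presentation

namespace IQuiver

variable {V E : Type u} {Q : IQuiver V E} {l : V}

theorem setOf_inOrbit (Q : IQuiver V E) (l : V) : {r | Q.InOrbit l r} = {l, Q.tauV l} := rfl

theorem IsSink.tau (hl : Q.IsSink l) : Q.IsSink (Q.tauV l) :=
  fun a ha => hl.not_inOrbit a (Or.inr ha)

end IQuiver

/-! ### Coordinates and generators of ⨁ e_{src a}Λ^ı. -/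

section ArrRight

open IAlg

variable {k : Type u} [Field k] {V E : Type u} [Fintype V] [DecidableEq V] {Q : IQuiver V E}
  {r : V}

/-- The coordinate functions on `arrRight`. -/
def arrCoord (r : V) (a : E) : arrRight k Q r →ₗ[(IAlg k Q)ᵐᵒᵖ] IAlg k Q :=
  LinearMap.proj a ∘ₗ (arrRight k Q r).subtype

open Classical in
/-- The generators of `arrRight`. -/
def arrUnit (r : V) (a : E) : arrRight k Q r := toArrRight (Pi.single a 1)

theorem arrUnit_apply_of_ne {a b : E} (h : b ≠ a) : (arrUnit (k := k) (Q := Q) r a).1 b = 0 := by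
  classical
  rw [arrUnit, toArrRight_apply, Pi.single_eq_of_ne h, mul_zero, ite_self]

theorem arrUnit_apply_self (a : E) : (arrUnit (k := k) (Q := Q) r a).1 a =
    if Q.tgt a = r then vert k Q (Q.src a) else 0 := by
  classical
  rw [arrUnit, toArrRight_apply, Pi.single_eq_same, mul_one]

end ArrRight

/-! ### Universal arrow families and the transpose. -/

section ArrowFamily

open IAlg

variable {k : Type u} [Field k] {V E : Type u} [Fintype V] [DecidableEq V] [Fintype E]
  (Q : IQuiver V E) (S : Set V)

/-- A family `z_a ∈ e_{src a} L`, indexed by the arrows ending in `S`, such that `∑ a z_a = 0`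
for the arrows ending in any given vertex. -/
structure IsArrowFamily {L : Type u} [AddCommGroup L] [Module (IAlg k Q) L] (z : E → L) :
    Prop where
  vert_smul : ∀ a, Q.tgt a ∈ S → vert k Q (Q.src a) • z a = z a
  eq_zero : ∀ a, Q.tgt a ∉ S → z a = 0
  sum_eq_zero : ∀ r, ∑ a with Q.tgt a = r, arr k Q a • z a = 0

/-- A universal family as in `IsArrowFamily`. -/
structure IsGenericArrowFamily {Y : Type u} [AddCommGroup Y] [Module (IAlg k Q) Y] (t : E → Y) :
    Prop where
  isArrowFamily : IsArrowFamily (k := k) Q S t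
  span_eq_top : Submodule.span (IAlg k Q) (Set.range t) = ⊤
  exists_lift : ∀ {L : Type u} [AddCommGroup L] [Module (IAlg k Q) L] (z : E → L),
    IsArrowFamily (k := k) Q S z → ∃ g : Y →ₗ[IAlg k Q] L, ∀ a, g (t a) = z a

variable {Q S} {Y Y' L : Type u} [AddCommGroup Y] [Module (IAlg k Q) Y] [AddCommGroup Y']
  [Module (IAlg k Q) Y'] [AddCommGroup L] [Module (IAlg k Q) L]

theorem IsArrowFamily.map {z : E → Y} (hz : IsArrowFamily (k := k) Q S z)
    (g : Y →ₗ[IAlg k Q] L) : IsArrowFamily (k := k) Q S (fun a => g (z a)) where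
  vert_smul a ha := by rw [← map_smul, hz.vert_smul a ha]
  eq_zero a ha := by rw [hz.eq_zero a ha, map_zero]
  sum_eq_zero r := by simp only [← map_smul, ← map_sum, hz.sum_eq_zero, map_zero]

theorem IsArrowFamily.restrict {S' : Set V} {z : E → L} (hz : IsArrowFamily (k := k) Q S z)
    (hS : S' ⊆ S) [DecidablePred (· ∈ S')] :
    IsArrowFamily (k := k) Q S' (fun a => if Q.tgt a ∈ S' then z a else 0) where
  vert_smul a ha := by simpa only [if_pos ha] using hz.vert_smul a (hS ha)
  eq_zero a ha := if_neg ha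
  sum_eq_zero r := by
    by_cases hr : r ∈ S'
    · rw [← hz.sum_eq_zero r]
      refine Finset.sum_congr rfl fun a ha => ?_
      rw [if_pos ((Finset.mem_filter.1 ha).2 ▸ hr)]
    · refine Finset.sum_eq_zero fun a ha => ?_
      rw [if_neg (by rwa [(Finset.mem_filter.1 ha).2]), smul_zero]

namespace IsGenericArrowFamily

theorem map_equiv {t : E → Y} (ht : IsGenericArrowFamily (k := k) Q S t)
    (e : Y ≃ₗ[IAlg k Q] Y') : IsGenericArrowFamily (k := k) Q S (fun a => e (t a)) where
  isArrowFamily := ht.isArrowFamily.map e.toLinearMap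
  span_eq_top := by
    have := congrArg (Submodule.map e.toLinearMap) ht.span_eq_top
    rw [Submodule.map_span, Submodule.map_top, LinearEquiv.range, ← Set.range_comp] at this
    exact this
  exists_lift z hz := by
    obtain ⟨g, hg⟩ := ht.exists_lift z hz
    exact ⟨g ∘ₗ e.symm.toLinearMap, by simp [hg]⟩

/-- Universal families on disjoint sets of vertices combine to one on the union. -/
theorem prod {S' : Set V} (hS : Disjoint S S') {t : E → Y} {t' : E → Y'}
    (ht : IsGenericArrowFamily (k := k) Q S t) (ht' : IsGenericArrowFamily (k := k) Q S' t') :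
    IsGenericArrowFamily (k := k) Q (S ∪ S') (fun a => (t a, t' a)) where
  isArrowFamily :=
    { vert_smul := fun a ha => by
        rw [Prod.smul_mk]
        rcases ha with ha | ha
        · rw [ht.isArrowFamily.vert_smul a ha,
            ht'.isArrowFamily.eq_zero a (Set.disjoint_left.1 hS ha), smul_zero]
        · rw [ht'.isArrowFamily.vert_smul a ha,
            ht.isArrowFamily.eq_zero a (Set.disjoint_right.1 hS ha), smul_zero]
      eq_zero := fun a ha => by
        rw [ht.isArrowFamily.eq_zero a fun h => ha (Or.inl h),
          ht'.isArrowFamily.eq_zero a fun h => ha (Or.inr h), Prod.mk_zero_zero]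
      sum_eq_zero := fun r => Prod.ext
        (by simpa [Prod.fst_sum] using ht.isArrowFamily.sum_eq_zero r)
        (by simpa [Prod.snd_sum] using ht'.isArrowFamily.sum_eq_zero r) }
  span_eq_top := by
    rw [eq_top_iff, ← Submodule.prod_top, ← ht.span_eq_top, ← ht'.span_eq_top,
      ← LinearMap.span_inl_union_inr, Submodule.span_le]
    rintro _ (⟨_, ⟨a, rfl⟩, rfl⟩ | ⟨_, ⟨a, rfl⟩, rfl⟩)
    · by_cases ha : Q.tgt a ∈ S
      · refine Submodule.subset_span ⟨a, Prod.ext rfl ?_⟩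
        exact ht'.isArrowFamily.eq_zero a (Set.disjoint_left.1 hS ha)
      · rw [ht.isArrowFamily.eq_zero a ha, map_zero]
        exact Submodule.zero_mem _
    · by_cases ha : Q.tgt a ∈ S'
      · refine Submodule.subset_span ⟨a, Prod.ext ?_ rfl⟩
        exact ht.isArrowFamily.eq_zero a (Set.disjoint_right.1 hS ha)
      · rw [ht'.isArrowFamily.eq_zero a ha, map_zero]
        exact Submodule.zero_mem _
  exists_lift z hz := by
    classical
    obtain ⟨g, hg⟩ := ht.exists_lift _ (hz.restrict Set.subset_union_left)
    obtain ⟨g', hg'⟩ := ht'.exists_lift _ (hz.restrict Set.subset_union_right)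
    refine ⟨g.coprod g', fun a => ?_⟩
    rw [LinearMap.coprod_apply, hg, hg']
    by_cases ha : Q.tgt a ∈ S
    · rw [if_pos ha, if_neg (Set.disjoint_left.1 hS ha), add_zero]
    · rw [if_neg ha, zero_add]
      split_ifs with ha'
      · rfl
      · exact (hz.eq_zero a (by rintro (h | h) <;> contradiction)).symm

end IsGenericArrowFamily

section Transpose

variable {r : V}

theorem arrToVert_arrUnit {a : E} (ha : Q.tgt a = r) :
    arrToVert k Q r (arrUnit r a) = toVertRight (arr k Q a) := by
  refine Subtype.ext ?_
  rw [arrToVert_apply, Finset.sum_eq_single a]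
  · rw [arrUnit_apply_self, if_pos ha, arr_mul_vert_src]
    change _ = vert k Q r * arr k Q a
    rw [← ha, vert_tgt_mul_arr]
  · intro b _ hb
    rw [arrUnit_apply_of_ne hb, mul_zero]
  · simp [ha]

/-- Dual basis formula: the coordinate functions generate the dual, with the values on `arrUnit` as
coefficients. -/
theorem eq_sum_smul_arrCoord (f : arrRight k Q r →ₗ[(IAlg k Q)ᵐᵒᵖ] IAlg k Q) :
    f = ∑ a, f (arrUnit r a) • arrCoord r a := by
  classical
  refine LinearMap.ext fun y => ?_
  have hy : y.1 = ∑ a, MulOpposite.op (y.1 a) • (Pi.single a 1 : E → IAlg k Q) := by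
    funext b
    simp [Finset.sum_apply, Pi.single_apply]
  conv_lhs => rw [← toArrRight_coe y, hy]
  simp only [map_sum, map_smul, LinearMap.sum_apply, LinearMap.smul_apply]
  refine Finset.sum_congr rfl fun a _ => ?_
  rw [MulOpposite.smul_eq_mul_unop, MulOpposite.unop_op, smul_eq_mul, arrUnit]
  congr!

/-- The homomorphism on the dual of `arrRight` given by a family of elements. -/
def arrDualLift (r : V) (z : E → L) :
    (arrRight k Q r →ₗ[(IAlg k Q)ᵐᵒᵖ] IAlg k Q) →ₗ[IAlg k Q] L where
  toFun f := ∑ a, f (arrUnit r a) • z a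
  map_add' f g := by simp only [LinearMap.add_apply, add_smul, Finset.sum_add_distrib]
  map_smul' c f := by
    simp only [LinearMap.smul_apply, smul_eq_mul, mul_smul, Finset.smul_sum, RingHom.id_apply]

theorem arrDualLift_apply (z : E → L) (f : arrRight k Q r →ₗ[(IAlg k Q)ᵐᵒᵖ] IAlg k Q) :
    arrDualLift r z f = ∑ a, f (arrUnit r a) • z a := rfl

theorem arrDualLift_arrCoord {z : E → L} (hz : IsArrowFamily (k := k) Q {r} z) (b : E) :
    arrDualLift r z (arrCoord (k := k) (Q := Q) r b) = z b := by
  rw [arrDualLift_apply, Finset.sum_eq_single b]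
  · change (arrUnit (k := k) (Q := Q) r b).1 b • z b = z b
    rw [arrUnit_apply_self]
    split_ifs with h
    · exact hz.vert_smul b h
    · rw [hz.eq_zero b h, smul_zero]
  · intro a _ ha
    change (arrUnit (k := k) (Q := Q) r a).1 b • z a = 0
    rw [arrUnit_apply_of_ne ha.symm, zero_smul]
  · simp

theorem arrDualLift_comp_arrToVert {z : E → L} (hz : IsArrowFamily (k := k) Q {r} z)
    (h : vertRight k Q r →ₗ[(IAlg k Q)ᵐᵒᵖ] IAlg k Q) :
    arrDualLift r z (h ∘ₗ arrToVert k Q r) = 0 := by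
  -- A right-linear map on the regular module is left multiplication by its value at 1; thus the
  -- dual of e_rΛ^ı contributes only multiples of the single relation ∑ a z_a = 0.
  have key : ∀ x : IAlg k Q, h (toVertRight x) = h (toVertRight 1) * x := fun x => by
    have : x = MulOpposite.op x • (1 : IAlg k Q) := by simp
    conv_lhs => rw [this, map_smul, map_smul]
    rfl
  have h1 : arrDualLift r z (h ∘ₗ arrToVert k Q r) =
      h (toVertRight 1) • ∑ a with Q.tgt a = r, arr k Q a • z a := by
    rw [arrDualLift_apply, Finset.smul_sum, Finset.sum_filter]
    refine Finset.sum_congr rfl fun a _ => ?_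
    split_ifs with ha
    · rw [LinearMap.comp_apply, arrToVert_arrUnit ha, key, mul_smul]
    · rw [hz.eq_zero a ha, smul_zero]
  rw [h1, hz.sum_eq_zero, smul_zero]

/-- The coordinate functions satisfy e_{src a} t_a = t_a, and the image of the inclusion e_rΛ^ı ⊆
Λ^ı under transposition is ∑ a t_a. These are all the relations, by the preceding lemma. -/
theorem isGenericArrowFamily_transpose (r : V) :
    IsGenericArrowFamily (k := k) Q {r}
      (fun a => (Submodule.Quotient.mk (arrCoord r a) : Transpose (arrToVert k Q r))) where
  isArrowFamily :=
    { vert_smul := fun a ha => by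
        rw [← Submodule.Quotient.mk_smul]
        congr 1
        exact LinearMap.ext fun y => y.2.1 a ha
      eq_zero := fun a ha => by
        rw [← Submodule.Quotient.mk_zero]
        congr 1
        exact LinearMap.ext fun y => y.2.2 a ha
      sum_eq_zero := fun s => by
        by_cases hs : s = r
        · subst hs
          change ∑ a with Q.tgt a = s, arr k Q a • Submodule.mkQ _ (arrCoord s a) = 0
          simp only [← map_smul, ← map_sum]
          refine (Submodule.Quotient.mk_eq_zero _).2 ⟨(vertRight k Q s).subtype, ?_⟩
          refine LinearMap.ext fun y => ?_
          rw [LinearMap.sum_apply]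
          exact arrToVert_apply y
        · refine Finset.sum_eq_zero fun a ha => ?_
          have ha' : Q.tgt a ≠ r := by rwa [(Finset.mem_filter.1 ha).2]
          have : arrCoord (k := k) (Q := Q) r a = 0 := LinearMap.ext fun y => y.2.2 a ha'
          rw [this, Submodule.Quotient.mk_zero, smul_zero] }
  span_eq_top := by
    rw [eq_top_iff]
    rintro x -
    obtain ⟨f, rfl⟩ := Submodule.mkQ_surjective _ x
    rw [eq_sum_smul_arrCoord f, map_sum]
    refine Submodule.sum_mem _ fun a _ => ?_
    rw [map_smul]
    exact Submodule.smul_mem _ _ (Submodule.subset_span ⟨a, rfl⟩)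
  exists_lift z hz :=
    ⟨Submodule.liftQ _ (arrDualLift r z) (by
      rintro _ ⟨h, rfl⟩
      exact arrDualLift_comp_arrToVert hz h), arrDualLift_arrCoord hz⟩

/-- TrD E_i is universal for the arrows ending in τi, not i, because the top of D E_i is at τi. -/
theorem exists_isGenericArrowFamily_of_isTrD {i : V} (hi : Q.IsSink (Q.tauV i))
    [Module k Y] (h : IsTrD k (IAlg k Q) (GenSimple k Q i) Y) :
    ∃ t : E → Y, IsGenericArrowFamily (k := k) Q {Q.tauV i} t := by
  obtain ⟨P₀, P₁, p₁, p₀, hp, ⟨e⟩⟩ := h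
  obtain ⟨e'⟩ := (isMinProjPres hi).nonempty_transpose_equiv hp
  exact ⟨_, (isGenericArrowFamily_transpose (Q.tauV i)).map_equiv (e'.trans e.symm)⟩

variable (k) in
theorem isTrD_transpose {i : V} (hi : Q.IsSink (Q.tauV i)) :
    IsTrD k (IAlg k Q) (GenSimple k Q i)
      (ModuleCat.of (IAlg k Q) (Transpose (arrToVert k Q (Q.tauV i)))) :=
  ⟨ModuleCat.of _ (vertRight k Q (Q.tauV i)), ModuleCat.of _ (arrRight k Q (Q.tauV i)),
    arrToVert k Q (Q.tauV i), vertToDual k Q i, isMinProjPres hi, ⟨LinearEquiv.refl _ _⟩⟩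

end Transpose

/-! ### Assembling the universal family of T. -/

variable {l : V}

/-- The conditions on x and on (y_a)_a are independent: the class of 1 modulo the orbit idempotents
is universal for x, the arrow family for y. -/
theorem isGenericFamily_prod {J : Submodule (IAlg k Q) (IAlg k Q)}
    (hJ : J = Submodule.span (IAlg k Q) (vert k Q '' {r | Q.InOrbit l r})) {t : E → Y}
    (ht : IsGenericArrowFamily (k := k) Q {r | Q.InOrbit l r} t) :
    IsGenericFamily (k := k) Q l
      (((Submodule.Quotient.mk 1, 0), fun a => (0, t a)) :
        ((IAlg k Q ⧸ J) × Y) × (E → (IAlg k Q ⧸ J) × Y)) where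
  isReflFamily := isReflFamily_iff.1 ⟨fun r hr => by
      refine Prod.ext ?_ (smul_zero _)
      change vert k Q r • Submodule.Quotient.mk (p := J) 1 = 0
      rw [← Submodule.Quotient.mk_smul, Submodule.Quotient.mk_eq_zero, smul_eq_mul, mul_one, hJ]
      exact Submodule.subset_span ⟨r, hr, rfl⟩,
    fun a ha => Prod.ext (smul_zero _) (ht.isArrowFamily.vert_smul a ha),
    fun a ha => Prod.ext rfl (ht.isArrowFamily.eq_zero a ha),
    fun r _ => Prod.ext (by simp [Prod.fst_sum])
      (by simpa [Prod.snd_sum] using ht.isArrowFamily.sum_eq_zero r)⟩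
  span_eq_top := by
    have h1 : Submodule.span (IAlg k Q) {Submodule.Quotient.mk (p := J) 1} = ⊤ := by
      rw [eq_top_iff]
      rintro x -
      obtain ⟨x, rfl⟩ := Submodule.mkQ_surjective _ x
      refine Submodule.mem_span_singleton.2 ⟨x, ?_⟩
      rw [← Submodule.Quotient.mk_smul, smul_eq_mul, mul_one]
      rfl
    rw [eq_top_iff, ← Submodule.prod_top, ← h1, ← ht.span_eq_top,
      ← LinearMap.span_inl_union_inr, Submodule.span_le]
    rintro _ (⟨_, rfl, rfl⟩ | ⟨_, ⟨a, rfl⟩, rfl⟩)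
    · exact Submodule.subset_span (Set.mem_insert _ _)
    · exact Submodule.subset_span (Set.mem_insert_of_mem _ ⟨a, rfl⟩)
  exists_lift {L} _ _ p hp := by
    obtain ⟨h1, h2, h3, h4⟩ := isReflFamily_iff.2 hp
    obtain ⟨g, hg⟩ := ht.exists_lift p.2 ⟨h2, h3, fun r => by
      by_cases hr : Q.InOrbit l r
      · exact h4 r hr
      · refine Finset.sum_eq_zero fun a ha => ?_
        rw [h3 a (by rwa [(Finset.mem_filter.1 ha).2]), smul_zero]⟩
    let f : (IAlg k Q ⧸ J) →ₗ[IAlg k Q] L :=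
      J.liftQ (LinearMap.toSpanSingleton (IAlg k Q) L p.1) (by
        rw [hJ, Submodule.span_le]
        rintro _ ⟨r, hr, rfl⟩
        exact h1 r hr)
    have hf : f (Submodule.Quotient.mk 1) = p.1 := one_smul _ _
    exact ⟨f.coprod g, by simp [hf], by simp [hg]⟩

theorem IsAPRModule.exists_isGenericFamily (hl : Q.IsSink l) {T : ModuleCat.{u} (IAlg k Q)}
    (hT : IsAPRModule k Q l T) : ∃ u : T × (E → T), IsGenericFamily (k := k) Q l u := by
  obtain ⟨hτ, Y, hY, ⟨e⟩⟩ | ⟨hτ, Y, Y', hY, hY', ⟨e⟩⟩ := hT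
  · obtain ⟨t, ht⟩ := exists_isGenericArrowFamily_of_isTrD (hτ.symm ▸ hl) hY
    have hS : {Q.tauV l} = {r | Q.InOrbit l r} := by rw [Q.setOf_inOrbit, hτ, Set.pair_eq_singleton]
    rw [hS] at ht
    exact ⟨_, (isGenericFamily_prod (by rw [← hS, hτ, Set.image_singleton]) ht).map_equiv e.symm⟩
  -- TrD E_l supplies the arrows into τl and TrD E_{τl} those into l; the product covers the orbit.
  · obtain ⟨t, ht⟩ := exists_isGenericArrowFamily_of_isTrD hl.tau hY
    obtain ⟨t', ht'⟩ :=
      exists_isGenericArrowFamily_of_isTrD ((Q.tauV_tauV l).symm ▸ hl) hY'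
    have h := ht.prod (by rwa [Q.tauV_tauV, Set.disjoint_singleton]) ht'
    have hS : {Q.tauV l} ∪ {Q.tauV (Q.tauV l)} = {r | Q.InOrbit l r} := by
      rw [Q.setOf_inOrbit, Q.tauV_tauV, Set.union_singleton]
    rw [hS] at h
    exact ⟨_, (isGenericFamily_prod (by rw [Q.setOf_inOrbit, Set.image_pair]) h).map_equiv e.symm⟩

theorem IsGenericFamily.finite {T : Type u} [AddCommGroup T] [Module (IAlg k Q) T]
    {u : T × (E → T)} (hu : IsGenericFamily (k := k) Q l u) : Module.Finite (IAlg k Q) T :=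
  ⟨⟨((Set.finite_range u.2).insert u.1).toFinset, by
    rw [Set.Finite.coe_toFinset, hu.span_eq_top]⟩⟩

variable (k) in
theorem exists_isAPRModule (hl : Q.IsSink l) :
    ∃ T : ModuleCat.{u} (IAlg k Q), IsAPRModule k Q l T := by
  by_cases hτ : Q.tauV l = l
  · exact ⟨ModuleCat.of (IAlg k Q) ((IAlg k Q ⧸ Submodule.span (IAlg k Q) {vert k Q l}) ×
      Transpose (arrToVert k Q (Q.tauV l))),
      Or.inl ⟨hτ, _, isTrD_transpose k (hτ.symm ▸ hl),
      ⟨LinearEquiv.refl _ _⟩⟩⟩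
  · exact ⟨ModuleCat.of (IAlg k Q)
      ((IAlg k Q ⧸ Submodule.span (IAlg k Q) {vert k Q l, vert k Q (Q.tauV l)}) ×
        Transpose (arrToVert k Q (Q.tauV l)) × Transpose (arrToVert k Q (Q.tauV (Q.tauV l)))),
      Or.inr ⟨hτ, _, _, isTrD_transpose k hl.tau,
      isTrD_transpose k ((Q.tauV_tauV l).symm ▸ hl), ⟨LinearEquiv.refl _ _⟩⟩⟩

end ArrowFamily

end

theorem theoremA {k : Type u} [Field k] {V E : Type u} [Fintype V] [DecidableEq V] [Fintype E]
    (Q : IQuiver V E) (hQ : Q.Acyclic) (l : V) (hl : Q.IsSink l) (hne : ∃ a, Q.tgt a = l) :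
    (∃ T : FDMod k (IAlg k Q), IsAPRModule k Q l T.obj) ∧
    ∀ T : FDMod k (IAlg k Q), IsAPRModule k Q l T.obj →
      IsTilting T.obj ∧
      (∃ S : FDMod k (IAlg k (Q.reflect l)) ≌ FDMod k (EndOp T.obj),
        S.functor.Linear k ∧
        Nonempty (reflFunctor k Q l hl ⋙ S.functor ≅ homFunctor k T)) ∧
      Nonempty (IAlg k (Q.reflect l) ≃ₐ[k] EndOp T.obj) := by
  refine ⟨?_, fun T hT => ?_⟩
  · obtain ⟨T, hT⟩ := exists_isAPRModule k hl
    obtain ⟨u, hu⟩ := hT.exists_isGenericFamily hl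
    have := hu.finite
    have := IAlg.finite (k := k) hQ
    -- T is generated by the finitely many entries of u over Λ^ı, which is finite-dimensional by
    -- acyclicity.
    exact ⟨⟨T, Module.Finite.trans (IAlg k Q) T⟩, hT⟩
  · obtain ⟨u, hu⟩ := hT.exists_isGenericFamily hl
    exact ⟨hu.isTilting hl hne,
      ⟨FDMod.restrictEquiv k (hu.endAlgEquiv hl hne), inferInstance, ⟨hu.functorIso hl hne⟩⟩,
      ⟨(hu.endAlgEquiv hl hne).symm⟩⟩
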